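/- Consider the discontinuous planar piecewise linear near-Hamiltonian system with three zones $$\dot x = H_y(x,y)+\epsilon f(x,y),\qquad \dot y=-H_x(x,y)+\epsilon g(x,y),$$ where $$H(x,y)=\begin{cases} H^L=\frac{b_L}{2}y^2-\frac{c_L}{2}x^2+a_Lxy+a_Ly-\beta_Lx, & x\le -1,\\ H^C=\frac12x^2+\frac12y^2, & -1\le x\le 1,\\ H^R=\frac{b_R}{2}y^2-\frac{c_R}{2}x^2+a_Rxy-a_Ry-\beta_Rx, & x\ge 1, \end{cases}$$ and, in the zone $i\in\{L,C,R\}$, $f=p_ix+q_iy+r_i$ and $g=s_ix+u_iy+v_i$ with real coefficients. Let $a_L=b_R=c_R=1$, $b_L=2$, $c_L=-1$, $a_R=0$ and $\beta_L=\beta_R=-2$. Periodic orbits are understood to be crossing ones: traces of nonconstant periodic solutions that meet the lines $x=\pm1$ only at points where the first components of the two adjacent vector fields have the same strict sign, and that pass there from one zone to the other. A limit cycle is a periodic orbit that has a neighbourhood containing no other periodic orbit. For $\epsilon=0$ the left and central subsystems have real centers (lying in $x<-1$ and in $-1<x<1$, respectively), the right subsystem has a real saddle (lying in $x>1$), and for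 every $h\in(0,1)$ there is a periodic orbit $L_h$ through the points $(1,h)$, $(1,-h)$, $(-1,-h)$ and $(-1,h)$. Moreover, at least three limit cycles can bifurcate from this periodic annulus: there are coefficients $p_i,q_i,r_i,s_i,u_i,v_i$ $(i=L,C,R)$, three distinct numbers $h_1,h_2,h_3\in(0,1)$ and $\epsilon_0>0$ such that for every $\epsilon\in(0,\epsilon_0)$ the system has three distinct limit cycles $\Gamma_1(\epsilon),\Gamma_2(\epsilon),\Gamma_3(\epsilon)$, and $\Gamma_j(\epsilon)\to L_{h_j}$ in the Hausdorff distance as $\epsilon\to0^+$, for $j=1,2,3$. -/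

import Mathlib

open Set Filter Topology

noncomputable section

/-- Coefficients of the quadratic Hamiltonian
`H(x,y) = (b/2) y² - (c/2) x² + a x y + α y - β x`. -/
structure HamCoeff where
  a : ℝ
  b : ℝ
  c : ℝ
  α : ℝ
  β : ℝ

namespace HamCoeff

/-- The Hamiltonian function. -/
def ham (k : HamCoeff) (x y : ℝ) : ℝ :=
  k.b / 2 * y ^ 2 - k.c / 2 * x ^ 2 + k.a * x * y + k.α * y - k.β * x

/-- The Hamiltonian vector field `(H_y, -H_x)`. -/
def field (k : HamCoeff) (z : ℝ × ℝ) : ℝ × ℝ :=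
  (deriv (fun y => k.ham z.1 y) z.2, -deriv (fun x => k.ham x z.2) z.1)

theorem field_eq (k : HamCoeff) (z : ℝ × ℝ) :
    k.field z = (k.a * z.1 + k.b * z.2 + k.α, k.c * z.1 - k.a * z.2 + k.β) := by
  have h1 : HasDerivAt (fun y => k.ham z.1 y) (k.a * z.1 + k.b * z.2 + k.α) z.2 := by
    unfold ham
    refine ((((((hasDerivAt_id' z.2).fun_pow 2).const_mul (k.b / 2)).sub_const
      (k.c / 2 * z.1 ^ 2)).fun_add ((hasDerivAt_id' z.2).const_mul (k.a * z.1))).fun_add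
      ((hasDerivAt_id' z.2).const_mul k.α) |>.sub_const (k.β * z.1)).congr_deriv ?_
    norm_num
    ring
  have h2 : HasDerivAt (fun x => k.ham x z.2) (-(k.c * z.1 - k.a * z.2 + k.β)) z.1 := by
    unfold ham
    refine ((((((hasDerivAt_id' z.1).fun_pow 2).const_mul (k.c / 2)).const_sub
      (k.b / 2 * z.2 ^ 2)).fun_add (((hasDerivAt_id' z.1).const_mul k.a).mul_const z.2)).add_const
      (k.α * z.2) |>.fun_sub ((hasDerivAt_id' z.1).const_mul k.β)).congr_deriv ?_
    norm_num
    ring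
  simp [field, h1.deriv, h2.deriv]

/-- The matrix of the linear part of the Hamiltonian vector field (see `field_eq`). -/
def linearPart (k : HamCoeff) : Matrix (Fin 2) (Fin 2) ℝ :=
  !![k.a, k.b; k.c, -k.a]

/-- The subsystem has a center at `p`: an equilibrium whose linear part has the eigenvalues
`± iω` with `ω > 0`. -/
def IsCenter (k : HamCoeff) (p : ℝ × ℝ) : Prop :=
  k.field p = 0 ∧
    ∃ ω : ℝ, 0 < ω ∧ k.linearPart.charpoly = Polynomial.X ^ 2 + Polynomial.C (ω ^ 2)

/-- The subsystem has a saddle at `p`: an equilibrium whose linear part has one negative and one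
positive eigenvalue. -/
def IsSaddle (k : HamCoeff) (p : ℝ × ℝ) : Prop :=
  k.field p = 0 ∧
    ∃ l m : ℝ, l < 0 ∧ 0 < m ∧
      k.linearPart.charpoly =
        (Polynomial.X - Polynomial.C l) * (Polynomial.X - Polynomial.C m)

end HamCoeff

/-- Coefficients of the affine perturbation `(p x + q y + r, s x + u y + v)`. -/
structure PertCoeff where
  p : ℝ
  q : ℝ
  r : ℝ
  s : ℝ
  u : ℝ
  v : ℝ

/-- The perturbation vector field `(f, g)`. -/
def PertCoeff.field (w : PertCoeff) (z : ℝ × ℝ) : ℝ × ℝ :=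
  (w.p * z.1 + w.q * z.2 + w.r, w.s * z.1 + w.u * z.2 + w.v)

/-- A planar piecewise vector field with the three zones `x ≤ -1` (left), `-1 ≤ x ≤ 1` (central)
and `1 ≤ x` (right). On a switching line both adjacent fields are available. -/
structure ThreeZoneField where
  left : ℝ × ℝ → ℝ × ℝ
  center : ℝ × ℝ → ℝ × ℝ
  right : ℝ × ℝ → ℝ × ℝ

/-- A piecewise Hamiltonian system (one quadratic Hamiltonian in each zone). -/
structure ThreeZoneHam where
  left : HamCoeff
  center : HamCoeff
  right : HamCoeff

/-- A piecewise affine perturbation. -/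
structure ThreeZonePert where
  left : PertCoeff
  center : PertCoeff
  right : PertCoeff

/-- The unperturbed piecewise Hamiltonian vector field. -/
def ThreeZoneHam.field (K : ThreeZoneHam) : ThreeZoneField where
  left := K.left.field
  center := K.center.field
  right := K.right.field

/-- The near-Hamiltonian vector field `(H_y + ε f, -H_x + ε g)`. -/
def ThreeZoneHam.perturbedField (K : ThreeZoneHam) (w : ThreeZonePert) (ε : ℝ) :
    ThreeZoneField where
  left z := K.left.field z + ε • w.left.field z
  center z := K.center.field z + ε • w.center.field z
  right z := K.right.field z + ε • w.right.field z

/-- The normal form: `H_C = (x² + y²)/2`, `α_L = a_L` and `α_R = -a_R`. -/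
def normalForm (aL bL cL βL aR bR cR βR : ℝ) : ThreeZoneHam where
  left := { a := aL, b := bL, c := cL, α := aL, β := βL }
  center := { a := 0, b := 1, c := -1, α := 0, β := 0 }
  right := { a := aR, b := bR, c := cR, α := -aR, β := βR }

/-- At time `t` the curve `γ` crosses the vertical line through `γ t`, where `V` is the vector field
to the left and `W` the vector field to the right of that line. The point `γ t` is a crossing point
(the horizontal components of `V` and `W` have the same strict sign), and `γ` arrives with the
field of the zone that it leaves and departs with the field of the zone that it enters. -/
def CrossesAt (V W : ℝ × ℝ → ℝ × ℝ) (γ : ℝ → ℝ × ℝ) (t : ℝ) : Prop :=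
  (0 < (V (γ t)).1 ∧ 0 < (W (γ t)).1 ∧
      HasDerivWithinAt γ (V (γ t)) (Iic t) t ∧ HasDerivWithinAt γ (W (γ t)) (Ici t) t) ∨
    ((V (γ t)).1 < 0 ∧ (W (γ t)).1 < 0 ∧
      HasDerivWithinAt γ (W (γ t)) (Iic t) t ∧ HasDerivWithinAt γ (V (γ t)) (Ici t) t)

namespace ThreeZoneField

/-- `γ : ℝ → ℝ²` is a (global) solution that meets the switching lines `x = ±1` only at crossing
points. -/
def IsCrossingSolution (X : ThreeZoneField) (γ : ℝ → ℝ × ℝ) : Prop :=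
  ∀ t : ℝ,
    ((γ t).1 < -1 → HasDerivAt γ (X.left (γ t)) t) ∧
    (-1 < (γ t).1 → (γ t).1 < 1 → HasDerivAt γ (X.center (γ t)) t) ∧
    (1 < (γ t).1 → HasDerivAt γ (X.right (γ t)) t) ∧
    ((γ t).1 = -1 → CrossesAt X.left X.center γ t) ∧
    ((γ t).1 = 1 → CrossesAt X.center X.right γ t)

/-- `Γ` is a (crossing) periodic orbit: the trace of a nonconstant periodic solution. -/
def IsPeriodicOrbit (X : ThreeZoneField) (Γ : Set (ℝ × ℝ)) : Prop :=
  ∃ (γ : ℝ → ℝ × ℝ) (T : ℝ), 0 < T ∧ X.IsCrossingSolution γ ∧ Function.Periodic γ T ∧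
    (∃ t, γ t ≠ γ 0) ∧ Γ = range γ

/-- `Γ` is a limit cycle: a periodic orbit with a neighbourhood that contains no other periodic
orbit. (`Γ` is compact and meets the switching lines only at crossing points, so a small
neighbourhood of `Γ` contains no other points of these lines, and every periodic
orbit inside it is a crossing one.) -/
def IsLimitCycle (X : ThreeZoneField) (Γ : Set (ℝ × ℝ)) : Prop :=
  X.IsPeriodicOrbit Γ ∧
    ∃ U : Set (ℝ × ℝ), IsOpen U ∧ Γ ⊆ U ∧ ∀ Γ' ⊆ U, X.IsPeriodicOrbit Γ' → Γ' = Γ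

end ThreeZoneField

/-- The CCS system with `a_L = b_R = c_R = 1`, `b_L = 2`, `c_L = -1`, `a_R = 0` and
`β_L = β_R = -2`. -/
def ccsSystem : ThreeZoneHam :=
  normalForm (aL := 1) (bL := 2) (cL := -1) (βL := -2) (aR := 0) (bR := 1) (cR := 1) (βR := -2)

end

/-!
The perturbations used are dilations about the equilibria of the three subsystems and a drift in the
right zone (`Strengths.pert`). With them every perturbed subsystem is still integrated by elementary
functions: the central and the left one are linear foci, the right one is a saddle (`focusArc`,
`saddleArc`). An orbit that circles the origin clockwise passes the lines `x = ±1` at four gates;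
in each zone it leads from the height `y` at one gate to the height `y'` at the next one exactly
when a level equation `F i y = G i y'` with strictly increasing `F i` and `G i` holds
(`Strengths.IsSmall.isAnnulus`). A solution of the four level equations is a crossing periodic orbit
(`ThreeZoneField.IsAnnulus.isPeriodicOrbit_cycle`); for `ε = 0` any four equal heights solve them,
which gives the periodic annulus.

With `y' = y + ε d` the level equations can be divided by `ε` and become equations `Φ i ε y d = 0`
that are of class `C¹` up to `ε = 0`, where they read `d = D i y` (`Strengths.IsSmall.level_iff`,
`Strengths.disp_zero`). The four quotients `d` of a periodic orbit have the sum zero, so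
that at `ε = 0` one is left with `∑ i, D i h = 0`, which is the equation `M h = 0` for the Melnikov
function `M` up to the factor `2 / h` (`Strengths.sum_shift`). At a simple zero of `M` the inverse
function theorem in `ℝ⁵` yields a locally unique solution for every small `ε > 0`
(`exists_chain_solution`).

The corresponding orbit is a limit cycle (`ThreeZoneField.IsAnnulus.isLimitCycle_cycle`): a nearby
periodic orbit must pass the gates, since for `ε > 0` no subsystem has periodic orbits of its own
(`Strengths.periodic_eq_const`); it returns to the gate `0` at its starting height, because the
passages are increasing functions of the height; so it solves the level equations, and local
uniqueness applies. Since arcs and transit times are continuous in `ε` and the heights, these limit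
cycles tend to the orbit of the annulus in the Hausdorff distance
(`Strengths.tendsto_hausdorffEDist_cycle`).

For the `strengths` chosen, `M` is a combination of `1 + h²`, `h` and `artanh h ± arctan h` with
polynomial coefficients (`melnikov_strengths`). Polynomial bounds for the last two show that `M`
changes sign on three disjoint intervals on which its derivative does not vanish
(`exists_three_simple_zeros`).
-/

/-! ### Crossing solutions: gluing of pieces -/

namespace ThreeZoneField

/-- The local condition at time `t` that defines a crossing solution. -/
def SolvesAt (X : ThreeZoneField) (γ : ℝ → ℝ × ℝ) (t : ℝ) : Prop :=
  ((γ t).1 < -1 → HasDerivAt γ (X.left (γ t)) t) ∧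
  (-1 < (γ t).1 → (γ t).1 < 1 → HasDerivAt γ (X.center (γ t)) t) ∧
  (1 < (γ t).1 → HasDerivAt γ (X.right (γ t)) t) ∧
  ((γ t).1 = -1 → CrossesAt X.left X.center γ t) ∧
  ((γ t).1 = 1 → CrossesAt X.center X.right γ t)

/-- At the point `z` of a switching line an orbit may arrive with velocity `v` and depart with
velocity `v'`. -/
def Junction (X : ThreeZoneField) (z v v' : ℝ × ℝ) : Prop :=
  (z.1 = -1 ∧
    ((0 < (X.left z).1 ∧ 0 < (X.center z).1 ∧ v = X.left z ∧ v' = X.center z) ∨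
      ((X.left z).1 < 0 ∧ (X.center z).1 < 0 ∧ v = X.center z ∧ v' = X.left z))) ∨
  (z.1 = 1 ∧
    ((0 < (X.center z).1 ∧ 0 < (X.right z).1 ∧ v = X.center z ∧ v' = X.right z) ∨
      ((X.center z).1 < 0 ∧ (X.right z).1 < 0 ∧ v = X.right z ∧ v' = X.center z)))

theorem solvesAt_of_junction {X : ThreeZoneField} {γ : ℝ → ℝ × ℝ} {t : ℝ} {v v' : ℝ × ℝ}
    (hJ : X.Junction (γ t) v v') (hl : HasDerivWithinAt γ v (Iic t) t)
    (hr : HasDerivWithinAt γ v' (Ici t) t) : X.SolvesAt γ t := by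
  rcases hJ with ⟨hz, hJ⟩ | ⟨hz, hJ⟩
  · refine ⟨fun h => by linarith, fun h => by linarith, fun h => by linarith, fun _ => ?_,
      fun h => by linarith⟩
    rcases hJ with ⟨h1, h2, rfl, rfl⟩ | ⟨h1, h2, rfl, rfl⟩
    · exact Or.inl ⟨h1, h2, hl, hr⟩
    · exact Or.inr ⟨h1, h2, hl, hr⟩
  · refine ⟨fun h => by linarith, fun _ h => by linarith, fun h => by linarith,
      fun h => by linarith, fun _ => ?_⟩
    rcases hJ with ⟨h1, h2, rfl, rfl⟩ | ⟨h1, h2, rfl, rfl⟩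
    · exact Or.inl ⟨h1, h2, hl, hr⟩
    · exact Or.inr ⟨h1, h2, hl, hr⟩

theorem SolvesAt.congr {X : ThreeZoneField} {γ γ' : ℝ → ℝ × ℝ} {t : ℝ}
    (h : X.SolvesAt γ t) (e : γ' =ᶠ[𝓝 t] γ) : X.SolvesAt γ' t := by
  have e0 : γ' t = γ t := e.eq_of_nhds
  have w : ∀ {v : ℝ × ℝ} {s : Set ℝ}, HasDerivWithinAt γ v s t → HasDerivWithinAt γ' v s t :=
    fun hv => hv.congr_of_eventuallyEq (e.filter_mono nhdsWithin_le_nhds) e0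
  have cr : ∀ {V W : ℝ × ℝ → ℝ × ℝ}, CrossesAt V W γ t → CrossesAt V W γ' t := by
    intro V W hc
    unfold CrossesAt
    rw [e0]
    exact hc.imp (fun ⟨a, b, c, d⟩ => ⟨a, b, w c, w d⟩) (fun ⟨a, b, c, d⟩ => ⟨a, b, w c, w d⟩)
  obtain ⟨h1, h2, h3, h4, h5⟩ := h
  unfold SolvesAt
  rw [e0]
  exact ⟨fun q => (h1 q).congr_of_eventuallyEq e, fun q q' => (h2 q q').congr_of_eventuallyEq e,
    fun q => (h3 q).congr_of_eventuallyEq e, fun q => cr (h4 q), fun q => cr (h5 q)⟩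

theorem hasDerivWithinAt_comp_sub {γ : ℝ → ℝ × ℝ} {v : ℝ × ℝ} {a t : ℝ} {s s' : Set ℝ}
    (h : HasDerivWithinAt γ v s (t - a)) (hs : MapsTo (fun x => x - a) s' s) :
    HasDerivWithinAt (fun x => γ (x - a)) v s' t := by
  have := HasDerivWithinAt.scomp (h := fun x => x - a) (h' := (1 : ℝ)) t h
    ((hasDerivWithinAt_id t s').sub_const a) hs
  simpa [Function.comp_def] using this

theorem SolvesAt.comp_sub {X : ThreeZoneField} {γ : ℝ → ℝ × ℝ} {a t : ℝ}
    (h : X.SolvesAt γ (t - a)) : X.SolvesAt (fun x => γ (x - a)) t := by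
  have w : ∀ {v : ℝ × ℝ}, HasDerivAt γ v (t - a) → HasDerivAt (fun x => γ (x - a)) v t :=
    fun hv => hv.comp_sub_const t a
  have wl : ∀ {v : ℝ × ℝ}, HasDerivWithinAt γ v (Iic (t - a)) (t - a) →
      HasDerivWithinAt (fun x => γ (x - a)) v (Iic t) t :=
    fun hv => hasDerivWithinAt_comp_sub hv (fun x hx => by simpa using hx)
  have wr : ∀ {v : ℝ × ℝ}, HasDerivWithinAt γ v (Ici (t - a)) (t - a) →
      HasDerivWithinAt (fun x => γ (x - a)) v (Ici t) t :=
    fun hv => hasDerivWithinAt_comp_sub hv (fun x hx => by simpa using hx)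
  have cr : ∀ {V W : ℝ × ℝ → ℝ × ℝ}, CrossesAt V W γ (t - a) →
      CrossesAt V W (fun x => γ (x - a)) t := fun hc =>
    hc.imp (fun ⟨a, b, c, d⟩ => ⟨a, b, wl c, wr d⟩) (fun ⟨a, b, c, d⟩ => ⟨a, b, wl c, wr d⟩)
  obtain ⟨h1, h2, h3, h4, h5⟩ := h
  exact ⟨fun q => w (h1 q), fun q q' => w (h2 q q'), fun q => w (h3 q), fun q => cr (h4 q),
    fun q => cr (h5 q)⟩

/-- On `[0, T]` the curve `γ` is a crossing solution with initial velocity `v` and final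
velocity `v'`. -/
structure IsSegment (X : ThreeZoneField) (γ : ℝ → ℝ × ℝ) (T : ℝ) (v v' : ℝ × ℝ) : Prop where
  pos : 0 < T
  solves : ∀ t ∈ Ioo 0 T, X.SolvesAt γ t
  deriv_start : HasDerivWithinAt γ v (Ici 0) 0
  deriv_end : HasDerivWithinAt γ v' (Iic T) T

/-- Follow `γ` until time `a`, then `γ'`. -/
noncomputable def concat (γ γ' : ℝ → ℝ × ℝ) (a : ℝ) (t : ℝ) : ℝ × ℝ :=
  if t ≤ a then γ t else γ' (t - a)

theorem concat_of_le {γ γ' : ℝ → ℝ × ℝ} {a t : ℝ} (h : t ≤ a) : concat γ γ' a t = γ t :=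
  if_pos h

theorem concat_of_ge {γ γ' : ℝ → ℝ × ℝ} {a t : ℝ} (e : γ a = γ' 0) (h : a ≤ t) :
    concat γ γ' a t = γ' (t - a) := by
  rcases h.eq_or_lt with rfl | h
  · simp [concat, e]
  · exact if_neg h.not_ge

theorem IsSegment.concat {X : ThreeZoneField} {γ γ' : ℝ → ℝ × ℝ} {a b : ℝ} {v w v' w' : ℝ × ℝ}
    (h : X.IsSegment γ a v w) (h' : X.IsSegment γ' b v' w') (e : γ a = γ' 0)
    (hJ : X.Junction (γ a) w v') : X.IsSegment (concat γ γ' a) (a + b) v w' := by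
  have ha := h.pos
  have hb := h'.pos
  refine ⟨by linarith, fun t ht => ?_, ?_, ?_⟩
  · rcases lt_trichotomy t a with hta | rfl | hta
    · refine (h.solves t ⟨ht.1, hta⟩).congr ?_
      filter_upwards [Iio_mem_nhds hta] with s hs using concat_of_le (le_of_lt hs)
    · refine solvesAt_of_junction (v := w) (v' := v') ?_ ?_ ?_
      · rwa [concat_of_le le_rfl]
      · exact h.deriv_end.congr (fun s hs => concat_of_le hs) (concat_of_le le_rfl)
      · have : HasDerivWithinAt (fun x => γ' (x - t)) v' (Ici t) t :=
          hasDerivWithinAt_comp_sub (s := Ici 0) (by simpa using h'.deriv_start)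
            (fun x hx => by simpa using hx)
        exact this.congr (fun s hs => concat_of_ge e hs) (concat_of_ge e le_rfl)
    · refine ((h'.solves (t - a) ⟨by linarith, by linarith [ht.2]⟩).comp_sub).congr ?_
      filter_upwards [Ioi_mem_nhds hta] with s hs using concat_of_ge e (le_of_lt hs)
  · refine h.deriv_start.congr_of_eventuallyEq ?_ (concat_of_le ha.le)
    filter_upwards [nhdsWithin_le_nhds (Iio_mem_nhds ha)] with s hs
      using concat_of_le (le_of_lt hs)
  · have : HasDerivWithinAt (fun x => γ' (x - a)) w' (Iic (a + b)) (a + b) :=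
      hasDerivWithinAt_comp_sub (s := Iic b) (by simpa using h'.deriv_end)
        (fun x hx => by simp at hx ⊢; linarith)
    refine this.congr_of_eventuallyEq ?_ (concat_of_ge e (by linarith))
    filter_upwards [nhdsWithin_le_nhds (Ioi_mem_nhds (show a < a + b by linarith))] with s hs
      using concat_of_ge e (le_of_lt hs)

theorem image_concat {γ γ' : ℝ → ℝ × ℝ} {a b : ℝ} (ha : 0 ≤ a) (hb : 0 ≤ b) (e : γ a = γ' 0) :
    concat γ γ' a '' Icc 0 (a + b) = γ '' Icc 0 a ∪ γ' '' Icc 0 b := by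
  ext z
  constructor
  · rintro ⟨t, ht, rfl⟩
    rcases le_total t a with h | h
    · exact Or.inl ⟨t, ⟨ht.1, h⟩, (concat_of_le h).symm⟩
    · exact Or.inr ⟨t - a, ⟨by linarith, by linarith [ht.2]⟩, (concat_of_ge e h).symm⟩
  · rintro (⟨t, ht, rfl⟩ | ⟨t, ht, rfl⟩)
    · exact ⟨t, ⟨ht.1, by linarith [ht.2]⟩, concat_of_le ht.2⟩
    · refine ⟨t + a, ⟨by linarith [ht.1], by linarith [ht.2]⟩, ?_⟩
      rw [concat_of_ge e (by linarith [ht.1])]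
      simp

/-- A segment whose end is joined to its start closes up to a periodic orbit. -/
theorem IsSegment.isPeriodicOrbit {X : ThreeZoneField} {γ : ℝ → ℝ × ℝ} {T : ℝ} {v w : ℝ × ℝ}
    (h : X.IsSegment γ T v w) (e : γ T = γ 0) (hJ : X.Junction (γ T) w v)
    (hne : ∃ t ∈ Icc 0 T, γ t ≠ γ 0) : X.IsPeriodicOrbit (γ '' Icc 0 T) := by
  have hT := h.pos
  set δ : ℝ → ℝ × ℝ := fun t => γ (toIcoMod hT 0 t) with hδ
  have per : Function.Periodic δ T := fun t => by simp [hδ, toIcoMod_add_right]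
  have d1 : ∀ t ∈ Ico 0 T, δ t = γ t := fun t ht => by
    have : toIcoMod hT 0 t = t := (toIcoMod_eq_self hT).2 (by simpa using ht)
    simp [hδ, this]
  have d2 : ∀ t ∈ Ico (-T) 0, δ t = γ (t + T) := fun t ht => by
    rw [← d1 (t + T) ⟨by linarith [ht.1], by linarith [ht.2]⟩, per]
  have d3 : ∀ t ∈ Icc (-T) 0, δ t = γ (t + T) := fun t ht => by
    rcases ht.2.eq_or_lt with rfl | h0
    · rw [d1 0 ⟨le_rfl, hT⟩, zero_add, e]
    · exact d2 t ⟨ht.1, h0⟩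
  have s0 : ∀ t ∈ Ico 0 T, X.SolvesAt δ t := by
    intro t ht
    rcases ht.1.eq_or_lt with rfl | h0
    · refine solvesAt_of_junction (v := w) (v' := v) ?_ ?_ ?_
      · rwa [d1 0 ht, ← e]
      · have : HasDerivWithinAt (fun x => γ (x - -T)) w (Iic 0) 0 :=
          hasDerivWithinAt_comp_sub (s := Iic T) (by simpa using h.deriv_end)
            (fun x hx => by simp at hx ⊢; linarith)
        refine this.congr_of_eventuallyEq ?_ (by rw [d3 0 ⟨by linarith, le_rfl⟩]; simp)
        filter_upwards [nhdsWithin_le_nhds (Ioi_mem_nhds (show -T < 0 by linarith)),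
          self_mem_nhdsWithin] with s hs hs'
        rw [d3 s ⟨le_of_lt hs, hs'⟩, sub_neg_eq_add]
      · refine h.deriv_start.congr_of_eventuallyEq ?_ (d1 0 ht)
        filter_upwards [nhdsWithin_le_nhds (Iio_mem_nhds hT), self_mem_nhdsWithin] with s hs hs'
        exact d1 s ⟨hs', hs⟩
    · refine (h.solves t ⟨h0, ht.2⟩).congr ?_
      filter_upwards [Ioo_mem_nhds h0 ht.2] with s hs using d1 s (Ioo_subset_Ico_self hs)
  refine ⟨δ, T, hT, fun t => ?_, per, ?_, ?_⟩
  · have h1 : toIcoMod hT 0 t = t - toIcoDiv hT 0 t • T := rfl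
    have h2 := s0 _ (by simpa using toIcoMod_mem_Ico hT 0 t)
    rw [h1] at h2
    have h3 := h2.comp_sub
    have h4 : (fun x => δ (x - toIcoDiv hT 0 t • T)) = δ := by
      funext x
      exact per.sub_zsmul_eq _
    rw [h4] at h3
    exact h3
  · obtain ⟨t, ht, hne⟩ := hne
    refine ⟨t, ?_⟩
    rw [d1 0 ⟨le_rfl, hT⟩]
    rcases ht.2.eq_or_lt with rfl | h0
    · exact absurd e hne
    · rwa [d1 t ⟨ht.1, h0⟩]
  · ext z
    constructor
    · rintro ⟨t, ht, rfl⟩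
      rcases ht.2.eq_or_lt with rfl | h0
      · exact ⟨0, by rw [d1 0 ⟨le_rfl, hT⟩, e]⟩
      · exact ⟨t, d1 t ⟨ht.1, h0⟩⟩
    · rintro ⟨t, rfl⟩
      have := toIcoMod_mem_Ico hT 0 t
      exact ⟨toIcoMod hT 0 t, ⟨this.1, by simpa using this.2.le⟩, rfl⟩

end ThreeZoneField

/-! ### Gates, zones and the passage through a zone -/

namespace ThreeZoneField

/-- The four points, of height `y` or `-y`, at which an orbit around the origin passes from one zone
to the next, in the order in which a clockwise orbit meets them. -/
def gate : Fin 4 → ℝ → ℝ × ℝ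
  | 0, y => (-1, y)
  | 1, y => (1, y)
  | 2, y => (1, -y)
  | 3, y => (-1, -y)

/-- The open zone that a clockwise orbit enters at the gate `i`. -/
def arcZone : Fin 4 → Set (ℝ × ℝ)
  | 0 => {z | -1 < z.1 ∧ z.1 < 1}
  | 1 => {z | 1 < z.1}
  | 2 => {z | -1 < z.1 ∧ z.1 < 1}
  | 3 => {z | z.1 < -1}

/-- The vector field of the zone that a clockwise orbit enters at the gate `i`. -/
def arcField (X : ThreeZoneField) : Fin 4 → ℝ × ℝ → ℝ × ℝ
  | 0 => X.center
  | 1 => X.right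
  | 2 => X.center
  | 3 => X.left

/-- Along the four gates of height `y` both adjacent fields point clockwise. -/
structure GateSigns (X : ThreeZoneField) (y : ℝ) : Prop where
  left_up : 0 < (X.left (-1, y)).1
  center_left_up : 0 < (X.center (-1, y)).1
  center_right_up : 0 < (X.center (1, y)).1
  right_up : 0 < (X.right (1, y)).1
  right_down : (X.right (1, -y)).1 < 0
  center_right_down : (X.center (1, -y)).1 < 0
  center_left_down : (X.center (-1, -y)).1 < 0
  left_down : (X.left (-1, -y)).1 < 0

variable {X : ThreeZoneField}

theorem isOpen_arcZone (i : Fin 4) : IsOpen (arcZone i) := by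
  fin_cases i
  · exact (isOpen_lt continuous_const continuous_fst).inter
      (isOpen_lt continuous_fst continuous_const)
  · exact isOpen_lt continuous_const continuous_fst
  · exact (isOpen_lt continuous_const continuous_fst).inter
      (isOpen_lt continuous_fst continuous_const)
  · exact isOpen_lt continuous_fst continuous_const

theorem ne_of_mem_arcZone {i : Fin 4} {z : ℝ × ℝ} (hz : z ∈ arcZone i) : z.1 ≠ -1 ∧ z.1 ≠ 1 := by
  fin_cases i <;> simp only [arcZone, mem_ofPred_eq] at hz <;> constructor <;> intro h <;>
    linarith [hz]

theorem gate_fst (i : Fin 4) (y : ℝ) : (gate i y).1 = -1 ∨ (gate i y).1 = 1 := by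
  fin_cases i <;> simp [gate]

theorem gate_notMem_arcZone (i j : Fin 4) (y : ℝ) : gate i y ∉ arcZone j := fun h =>
  (gate_fst i y).elim (ne_of_mem_arcZone h).1 (ne_of_mem_arcZone h).2

theorem gate_injective {i j : Fin 4} {y z : ℝ} (hy : 0 < y) (hz : 0 < z)
    (h : gate i y = gate j z) : i = j ∧ y = z := by
  fin_cases i <;> fin_cases j <;> simp [gate, Prod.ext_iff] at h ⊢ <;> linarith

theorem solvesAt_iff_of_mem_arcZone {i : Fin 4} {γ : ℝ → ℝ × ℝ} {t : ℝ} (h : γ t ∈ arcZone i) :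
    X.SolvesAt γ t ↔ HasDerivAt γ (X.arcField i (γ t)) t := by
  fin_cases i <;> simp only [arcZone, mem_ofPred_eq] at h <;> simp only [arcField]
  · exact ⟨fun H => H.2.1 h.1 h.2, fun H => ⟨fun _ => by linarith, fun _ _ => H,
      fun _ => by linarith, fun _ => by linarith, fun _ => by linarith⟩⟩
  · exact ⟨fun H => H.2.2.1 h, fun H => ⟨fun _ => by linarith, fun _ _ => by linarith,
      fun _ => H, fun _ => by linarith, fun _ => by linarith⟩⟩
  · exact ⟨fun H => H.2.1 h.1 h.2, fun H => ⟨fun _ => by linarith, fun _ _ => H,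
      fun _ => by linarith, fun _ => by linarith, fun _ => by linarith⟩⟩
  · exact ⟨fun H => H.1 h, fun H => ⟨fun _ => H, fun _ _ => by linarith,
      fun _ => by linarith, fun _ => by linarith, fun _ => by linarith⟩⟩

theorem GateSigns.junction {y : ℝ} (h : X.GateSigns y) (i : Fin 4) :
    X.Junction (gate (i + 1) y) (X.arcField i (gate (i + 1) y))
      (X.arcField (i + 1) (gate (i + 1) y)) := by
  fin_cases i
  · exact Or.inr ⟨rfl, Or.inl ⟨h.center_right_up, h.right_up, rfl, rfl⟩⟩
  · exact Or.inr ⟨rfl, Or.inr ⟨h.center_right_down, h.right_down, rfl, rfl⟩⟩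
  · exact Or.inl ⟨rfl, Or.inr ⟨h.left_down, h.center_left_down, rfl, rfl⟩⟩
  · exact Or.inl ⟨rfl, Or.inl ⟨h.left_up, h.center_left_up, rfl, rfl⟩⟩

theorem eventually_lt_of_deriv_pos {f : ℝ → ℝ} {v t : ℝ} (h : HasDerivWithinAt f v (Ici t) t)
    (hv : 0 < v) : ∀ᶠ s in 𝓝[>] t, f t < f s := by
  have h1 := (hasDerivWithinAt_iff_tendsto_slope' (s := Ioi t) (by simp)).1
    (h.mono Ioi_subset_Ici_self)
  filter_upwards [h1.eventually (lt_mem_nhds hv), self_mem_nhdsWithin] with s hs hs'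
  exact (slope_pos_iff_of_le (le_of_lt hs')).1 hs

theorem eventually_gt_of_deriv_neg {f : ℝ → ℝ} {v t : ℝ} (h : HasDerivWithinAt f v (Ici t) t)
    (hv : v < 0) : ∀ᶠ s in 𝓝[>] t, f s < f t := by
  filter_upwards [eventually_lt_of_deriv_pos h.fun_neg (neg_pos.2 hv)] with s hs
  linarith

theorem IsCrossingSolution.continuous {γ : ℝ → ℝ × ℝ} (h : X.IsCrossingSolution γ) :
    Continuous γ := by
  have cr : ∀ {V W : ℝ × ℝ → ℝ × ℝ} {t : ℝ}, CrossesAt V W γ t → ContinuousAt γ t := by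
    intro V W t hc
    rw [continuousAt_iff_continuous_left_right]
    rcases hc with ⟨_, _, h1, h2⟩ | ⟨_, _, h1, h2⟩ <;>
      exact ⟨h1.continuousWithinAt, h2.continuousWithinAt⟩
  refine continuous_iff_continuousAt.2 fun t => ?_
  obtain ⟨h1, h2, h3, h4, h5⟩ := h t
  rcases lt_trichotomy (γ t).1 (-1) with q | q | q
  · exact (h1 q).continuousAt
  · exact cr (h4 q)
  · rcases lt_trichotomy (γ t).1 1 with q' | q' | q'
    · exact (h2 q q').continuousAt
    · exact cr (h5 q')
    · exact (h3 q').continuousAt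

/-- A crossing solution passes every gate in the clockwise direction. -/
theorem GateSigns.enter {y t : ℝ} {γ : ℝ → ℝ × ℝ} {i : Fin 4} (h : X.GateSigns y)
    (hγ : X.IsCrossingSolution γ) (e : γ t = gate i y) :
    HasDerivWithinAt γ (X.arcField i (γ t)) (Ici t) t ∧ ∀ᶠ s in 𝓝[>] t, γ s ∈ arcZone i := by
  have hs : ∀ {v : ℝ × ℝ}, HasDerivWithinAt γ v (Ici t) t →
      HasDerivWithinAt (fun s => (γ s).1) v.1 (Ici t) t := fun hv =>
    HasFDerivAt.comp_hasDerivWithinAt (f := γ) t (hasFDerivAt_fst (p := γ t)) hv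
  have hc : ContinuousAt (fun s => (γ s).1) t := (continuous_fst.comp hγ.continuous).continuousAt
  obtain ⟨-, -, -, h4, h5⟩ := hγ t
  fin_cases i <;> simp only [gate, arcField, arcZone, mem_ofPred_eq] at e ⊢ <;>
    unfold CrossesAt at h4 h5 <;> rw [e] at h4 h5 ⊢
  · rcases h4 rfl with ⟨a, b, c, d⟩ | ⟨a, b, c, d⟩
    · refine ⟨d, ?_⟩
      filter_upwards [eventually_lt_of_deriv_pos (hs d) h.center_left_up,
        nhdsWithin_le_nhds (hc.eventually (gt_mem_nhds (show (γ t).1 < 1 by rw [e]; norm_num)))]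
        with s h1 h2
      rw [e] at h1
      exact ⟨h1, h2⟩
    · exact absurd h.left_up a.not_gt
  · rcases h5 rfl with ⟨a, b, c, d⟩ | ⟨a, b, c, d⟩
    · refine ⟨d, ?_⟩
      filter_upwards [eventually_lt_of_deriv_pos (hs d) h.right_up] with s h1
      rwa [e] at h1
    · exact absurd h.right_up b.not_gt
  · rcases h5 rfl with ⟨a, b, c, d⟩ | ⟨a, b, c, d⟩
    · exact absurd h.right_down b.not_gt
    · refine ⟨d, ?_⟩
      filter_upwards [eventually_gt_of_deriv_neg (hs d) h.center_right_down,
        nhdsWithin_le_nhds (hc.eventually (lt_mem_nhds (show -1 < (γ t).1 by rw [e]; norm_num)))]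
        with s h1 h2
      rw [e] at h1
      exact ⟨h2, h1⟩
  · rcases h4 rfl with ⟨a, b, c, d⟩ | ⟨a, b, c, d⟩
    · exact absurd h.left_down a.not_gt
    · refine ⟨d, ?_⟩
      filter_upwards [eventually_gt_of_deriv_neg (hs d) h.left_down] with s h1
      rwa [e] at h1

/-- A crossing solution that enters a zone where the global solution `c` of the field of that zone
starts follows `c` for as long as `c` stays in the zone. -/
theorem IsCrossingSolution.eq_of_enter {γ c : ℝ → ℝ × ℝ} {i : Fin 4} {t τ : ℝ}
    (hL : ∃ K, LipschitzWith K (X.arcField i)) (hγ : X.IsCrossingSolution γ)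
    (hc : ∀ s, HasDerivAt c (X.arcField i (c s)) s) (hcZ : ∀ s ∈ Ioo 0 τ, c s ∈ arcZone i)
    (h0 : γ t = c 0) (hd : HasDerivWithinAt γ (X.arcField i (γ t)) (Ici t) t)
    (hin : ∀ᶠ s in 𝓝[>] t, γ s ∈ arcZone i) : ∀ s ∈ Icc 0 τ, γ (t + s) = c s := by
  obtain ⟨K, hK⟩ := hL
  have hcc : Continuous c := continuous_iff_continuousAt.2 fun s => (hc s).continuousAt
  have hγc : Continuous fun s => γ (t + s) :=
    hγ.continuous.comp (continuous_const.add continuous_id)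
  -- the closed set of times at which both curves agree can always be extended to the right
  refine IsClosed.Icc_subset_of_forall_exists_gt (s := {s | γ (t + s) = c s})
    ((isClosed_eq hγc hcc).inter isClosed_Icc) (by simpa using h0) ?_
  rintro x ⟨hx, hx0, hxτ⟩ y hy
  have hx : γ (t + x) = c x := hx
  have key : HasDerivWithinAt γ (X.arcField i (γ (t + x))) (Ici (t + x)) (t + x) ∧
      ∀ᶠ s in 𝓝[>] (t + x), γ s ∈ arcZone i := by
    rcases hx0.eq_or_lt with rfl | hx0
    · rw [add_zero]
      exact ⟨hd, hin⟩
    · have hm : γ (t + x) ∈ arcZone i := hx ▸ hcZ x ⟨hx0, hxτ⟩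
      exact ⟨((solvesAt_iff_of_mem_arcZone hm).1 (hγ _)).hasDerivWithinAt,
        nhdsWithin_le_nhds (hγ.continuous.continuousAt.eventually
          ((isOpen_arcZone i).mem_nhds hm))⟩
  obtain ⟨z, hz, hzZ⟩ := (mem_nhdsGT_iff_exists_Ioo_subset).1 key.2
  have hz : t + x < z := hz
  have hy : x < y := hy
  set b := min y (z - t) with hb
  have hxb : x < b := lt_min hy (by linarith)
  have hE : EqOn (fun s => γ (t + s)) c (Icc x b) := by
    refine ODE_solution_unique (v := fun _ => X.arcField i) (K := K) (fun _ => hK)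
      hγc.continuousOn (fun s hs => ?_) hcc.continuousOn
      (fun s _ => (hc s).hasDerivWithinAt) hx
    have hs' : HasDerivWithinAt γ (X.arcField i (γ (t + s))) (Ici (t + s)) (t + s) := by
      rcases hs.1.eq_or_lt with rfl | h1
      · exact key.1
      · have hm : γ (t + s) ∈ arcZone i :=
          hzZ ⟨by linarith, by linarith [hs.2, min_le_right y (z - t)]⟩
        exact ((solvesAt_iff_of_mem_arcZone hm).1 (hγ _)).hasDerivWithinAt
    have := hasDerivWithinAt_comp_sub (γ := γ) (a := -t) (t := s) (s := Ici (t + s)) (s' := Ici s)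
      (by rw [sub_neg_eq_add, add_comm s t]; exact hs') (fun q hq => by
        simp only [mem_Ici] at hq ⊢; linarith)
    simpa [sub_neg_eq_add, add_comm] using this
  exact ⟨b, hE ⟨hxb.le, le_rfl⟩, hxb, min_le_left _ _⟩

/-- Four segments, each joined to the next one and the last one to the first one, form a periodic
orbit. -/
theorem isPeriodicOrbit_of_cycle {γ : Fin 4 → ℝ → ℝ × ℝ} {τ : Fin 4 → ℝ} {v w : Fin 4 → ℝ × ℝ}
    (H : ∀ i, X.IsSegment (γ i) (τ i) (v i) (w i)) (E : ∀ i, γ i (τ i) = γ (i + 1) 0)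
    (J : ∀ i, X.Junction (γ i (τ i)) (w i) (v (i + 1))) (hne : γ 1 0 ≠ γ 0 0) :
    X.IsPeriodicOrbit (⋃ i, γ i '' Icc 0 (τ i)) := by
  have p := fun i => (H i).pos
  have p0 := p 0
  have p1 := p 1
  have p2 := p 2
  have p3 := p 3
  have e0 : γ 0 (τ 0) = γ 1 0 := E 0
  have e1 : γ 1 (τ 1) = γ 2 0 := E 1
  have e2 : γ 2 (τ 2) = γ 3 0 := E 2
  have e3 : γ 3 (τ 3) = γ 0 0 := E 3
  have E1 : concat (γ 0) (γ 1) (τ 0) (τ 0 + τ 1) = γ 1 (τ 1) := by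
    rw [concat_of_ge e0 (by linarith), add_sub_cancel_left]
  have S1 := (H 0).concat (H 1) e0 (J 0)
  have E1' := E1.trans e1
  have S2 := S1.concat (H 2) E1' (by rw [E1]; exact J 1)
  have E2 : concat (concat (γ 0) (γ 1) (τ 0)) (γ 2) (τ 0 + τ 1) (τ 0 + τ 1 + τ 2) = γ 2 (τ 2) := by
    rw [concat_of_ge E1' (by linarith), add_sub_cancel_left]
  have E2' := E2.trans e2
  have S3 := S2.concat (H 3) E2' (by rw [E2]; exact J 2)
  set δ := concat (concat (concat (γ 0) (γ 1) (τ 0)) (γ 2) (τ 0 + τ 1)) (γ 3)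
    (τ 0 + τ 1 + τ 2) with hδ
  have E3 : δ (τ 0 + τ 1 + τ 2 + τ 3) = γ 3 (τ 3) := by
    rw [hδ, concat_of_ge E2' (by linarith), add_sub_cancel_left]
  have Z : δ 0 = γ 0 0 := by
    rw [hδ, concat_of_le (by linarith), concat_of_le (by linarith), concat_of_le (by linarith)]
  have N : δ (τ 0) = γ 1 0 := by
    rw [hδ, concat_of_le (by linarith), concat_of_le (by linarith), concat_of_le le_rfl, e0]
  have := S3.isPeriodicOrbit (E3.trans (e3.trans Z.symm)) (by rw [E3]; exact J 3)
    ⟨τ 0, ⟨by linarith, by linarith⟩, by rwa [N, Z]⟩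
  rw [image_concat (by linarith) p3.le E2', image_concat (by linarith) p2.le E1',
    image_concat p0.le p1.le e0] at this
  convert this using 1
  ext z
  simp only [mem_iUnion, mem_union, Fin.exists_fin_succ, Fin.exists_fin_zero, or_false]
  simp [or_assoc]

end ThreeZoneField

/-! ### Closed curves through the four gates and their isolation -/

namespace ThreeZoneField

/-- A description of the orbits of `X` that pass the four gates at heights in `(l, u)`: the orbit
that starts at the gate `i` at height `y` is `c i y`, and it passes the next gate at height `y'`,
after the time `τ i y y'`, if `F i y = G i y'`. These times have the positive lower bound `τ₀`. -/
structure IsAnnulus (X : ThreeZoneField) (l u τ₀ : ℝ) (F G : Fin 4 → ℝ → ℝ)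
    (c : Fin 4 → ℝ → ℝ → ℝ × ℝ) (τ : Fin 4 → ℝ → ℝ → ℝ) : Prop where
  l_pos : 0 < l
  τ₀_pos : 0 < τ₀
  lipschitz : ∀ i, ∃ K, LipschitzWith K (X.arcField i)
  signs : ∀ y ∈ Ioo l u, X.GateSigns y
  mono_F : ∀ i, StrictMonoOn (F i) (Ioo l u)
  mono_G : ∀ i, StrictMonoOn (G i) (Ioo l u)
  cont_F : ∀ i, ContinuousOn (F i) (Ioo l u)
  cont_G : ∀ i, ContinuousOn (G i) (Ioo l u)
  c_deriv : ∀ i y t, HasDerivAt (c i y) (X.arcField i (c i y t)) t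
  c_zero : ∀ i y, c i y 0 = gate i y
  arc : ∀ i, ∀ y ∈ Ioo l u, ∀ y' ∈ Ioo l u, F i y = G i y' →
    τ₀ ≤ τ i y y' ∧ c i y (τ i y y') = gate (i + 1) y' ∧
      ∀ t ∈ Ioo 0 (τ i y y'), c i y t ∈ arcZone i

/-- The closed curve formed by the four arcs between the gates at the heights `y i`. -/
def cycle (c : Fin 4 → ℝ → ℝ → ℝ × ℝ) (τ : Fin 4 → ℝ → ℝ → ℝ) (y : Fin 4 → ℝ) : Set (ℝ × ℝ) :=
  ⋃ i, c i (y i) '' Icc 0 (τ i (y i) (y (i + 1)))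

namespace IsAnnulus

variable {X : ThreeZoneField} {l u τ₀ : ℝ} {F G : Fin 4 → ℝ → ℝ} {c : Fin 4 → ℝ → ℝ → ℝ × ℝ}
  {τ : Fin 4 → ℝ → ℝ → ℝ} {γ : ℝ → ℝ × ℝ} {y : Fin 4 → ℝ}

theorem pos_of_mem (M : X.IsAnnulus l u τ₀ F G c τ) {z : ℝ} (hz : z ∈ Ioo l u) : 0 < z :=
  M.l_pos.trans hz.1

theorem isPeriodicOrbit_cycle (M : X.IsAnnulus l u τ₀ F G c τ) (hy : ∀ i, y i ∈ Ioo l u)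
    (h : ∀ i, F i (y i) = G i (y (i + 1))) : X.IsPeriodicOrbit (cycle c τ y) := by
  have A := fun i => M.arc i _ (hy i) _ (hy (i + 1)) (h i)
  refine isPeriodicOrbit_of_cycle (v := fun i => X.arcField i (gate i (y i)))
    (w := fun i => X.arcField i (gate (i + 1) (y (i + 1)))) (fun i => ?_) (fun i => ?_)
    (fun i => ?_) ?_
  · refine ⟨M.τ₀_pos.trans_le (A i).1, fun t ht => ?_, ?_, ?_⟩
    · exact (solvesAt_iff_of_mem_arcZone ((A i).2.2 t ht)).2 (M.c_deriv i _ t)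
    · rw [← M.c_zero i]
      exact (M.c_deriv i _ 0).hasDerivWithinAt
    · rw [← (A i).2.1]
      exact (M.c_deriv i _ _).hasDerivWithinAt
  · rw [(A i).2.1, M.c_zero]
  · rw [(A i).2.1]
    exact (M.signs _ (hy (i + 1))).junction i
  · rw [M.c_zero, M.c_zero]
    simp [gate, Prod.ext_iff]
    intro h
    norm_num at h

theorem gate_mem_cycle (M : X.IsAnnulus l u τ₀ F G c τ) (hy : ∀ i, y i ∈ Ioo l u)
    (h : ∀ i, F i (y i) = G i (y (i + 1))) (i : Fin 4) : gate i (y i) ∈ cycle c τ y :=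
  mem_iUnion.2 ⟨i, 0, ⟨le_rfl, M.τ₀_pos.le.trans (M.arc i _ (hy i) _ (hy (i + 1)) (h i)).1⟩,
    M.c_zero i _⟩

/-- From the gate `i` at height `z`, passed at time `t`, the curve `γ` goes to the next gate, at
height `z'`. -/
structure Follows (F G : Fin 4 → ℝ → ℝ) (c : Fin 4 → ℝ → ℝ → ℝ × ℝ) (τ : Fin 4 → ℝ → ℝ → ℝ)
    (γ : ℝ → ℝ × ℝ) (t : ℝ) (i : Fin 4) (z z' : ℝ) : Prop where
  level : F i z = G i z'
  eq : ∀ s ∈ Icc 0 (τ i z z'), γ (t + s) = c i z s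

theorem follows (M : X.IsAnnulus l u τ₀ F G c τ) (hγ : X.IsCrossingSolution γ) {t z z' : ℝ}
    {i : Fin 4} (hz : z ∈ Ioo l u) (hz' : z' ∈ Ioo l u) (e : F i z = G i z')
    (ht : γ t = gate i z) :
    Follows F G c τ γ t i z z' ∧ γ (t + τ i z z') = gate (i + 1) z' := by
  obtain ⟨h1, h2, h3⟩ := M.arc i z hz z' hz' e
  obtain ⟨h4, h5⟩ := (M.signs z hz).enter hγ ht
  have := hγ.eq_of_enter (M.lipschitz i) (M.c_deriv i z) h3 (by rw [ht, M.c_zero]) h4 h5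
  exact ⟨⟨e, this⟩, by rw [this _ ⟨M.τ₀_pos.le.trans h1, le_rfl⟩, h2]⟩

/-- If every passage of `γ` through a gate at a height in `S` leads to a passage through the
next gate at a height in `S`, then from such a passage on `γ` stays on arcs between heights
in `S`. -/
theorem exists_arc_of_step (M : X.IsAnnulus l u τ₀ F G c τ) {S : Fin 4 → Set ℝ}
    (hS : ∀ i, S i ⊆ Ioo l u)
    (hstep : ∀ i, ∀ z ∈ S i, ∀ t, γ t = gate i z → ∃ z' ∈ S (i + 1), Follows F G c τ γ t i z z')
    {i : Fin 4} {z t s : ℝ} (hz : z ∈ S i) (ht : γ t = gate i z) (hs : t ≤ s) :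
    ∃ j, ∃ w ∈ S j, ∃ w' ∈ S (j + 1), F j w = G j w' ∧
      ∃ r ∈ Ico 0 (τ j w w'), γ s = c j w r := by
  have main : ∀ n : ℕ, ∀ i, ∀ z ∈ S i, ∀ t, γ t = gate i z → ∀ s, t ≤ s → s ≤ t + n * τ₀ →
      ∃ j, ∃ w ∈ S j, ∃ w' ∈ S (j + 1), F j w = G j w' ∧
        ∃ r ∈ Ico 0 (τ j w w'), γ s = c j w r := by
    intro n
    induction n with
    | zero =>
      intro i z hz t ht s h1 h2
      obtain ⟨z', hz', hf⟩ := hstep i z hz t ht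
      have h3 := (M.arc i z (hS i hz) z' (hS _ hz') hf.level).1
      have h4 := M.τ₀_pos
      have h5 : s = t := by simp at h2; linarith
      exact ⟨i, z, hz, z', hz', hf.level, 0, ⟨le_rfl, by linarith⟩, by rw [h5, ht, M.c_zero]⟩
    | succ n ih =>
      intro i z hz t ht s h1 h2
      obtain ⟨z', hz', hf⟩ := hstep i z hz t ht
      obtain ⟨h3, h6, -⟩ := M.arc i z (hS i hz) z' (hS _ hz') hf.level
      have h4 := M.τ₀_pos
      rcases lt_or_ge s (t + τ i z z') with h5 | h5
      · refine ⟨i, z, hz, z', hz', hf.level, s - t, ⟨by linarith, by linarith⟩, ?_⟩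
        rw [← hf.eq (s - t) ⟨by linarith, by linarith⟩, add_sub_cancel]
      · refine ih (i + 1) z' hz' (t + τ i z z') ?_ s h5 ?_
        · rw [hf.eq _ ⟨by linarith, le_rfl⟩, h6]
        · push_cast at h2
          linarith
  obtain ⟨n, hn⟩ := exists_nat_ge ((s - t) / τ₀)
  refine main n i z hz t ht s hs ?_
  rw [div_le_iff₀ M.τ₀_pos] at hn
  linarith

/-- Let `R` be an order of the heights that the passages from gate to gate preserve. If a periodic
solution returns to the gate `0` after one turn at a height `B 3` that is `R`-below its starting
height `A 0`, then conversely `A 0` is `R`-below `B 3`. -/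
theorem not_advance (M : X.IsAnnulus l u τ₀ F G c τ) {N : Fin 4 → Set ℝ} {R : ℝ → ℝ → Prop}
    (hN : ∀ i, N i ⊆ Ioo l u)
    (hstep : ∀ i, ∀ z ∈ N i, ∀ t, γ t = gate i z → ∃ z' ∈ N (i + 1), Follows F G c τ γ t i z z')
    {T : ℝ} (hT : 0 < T) (per : Function.Periodic γ T)
    (hF : ∀ i, ∀ z ∈ Ioo l u, ∀ w ∈ Ioo l u, R z w → R (F i z) (F i w))
    (hG : ∀ i, ∀ z ∈ Ioo l u, ∀ w ∈ Ioo l u, R (G i z) (G i w) → R z w)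
    (htr : ∀ a b d, R a b → R b d → R a d) (hrefl : ∀ a, R a a)
    {A B : Fin 4 → ℝ} (hA : ∀ i, A i ∈ N i) (hB : ∀ i, B i ∈ N (i + 1))
    (hAB : ∀ i, F i (A i) = G i (B i)) (hBA : ∀ i, R (B i) (A (i + 1))) {t t' : ℝ}
    (ht : γ t = gate 0 (A 0)) (ht' : γ t' = gate 0 (B 3)) : R (A 0) (B 3) := by
  -- after the first turn all passages happen `R`-below those of the first turn, and by periodicity
  -- the passage at the height `A 0` is one of them
  set S : Fin 4 → Set ℝ := fun i => {z | z ∈ N i ∧ R z (B (i - 1))}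
  have hS : ∀ i, S i ⊆ Ioo l u := fun i z hz => hN i hz.1
  have hst : ∀ i, ∀ z ∈ S i, ∀ t, γ t = gate i z →
      ∃ z' ∈ S (i + 1), Follows F G c τ γ t i z z' := by
    rintro i z ⟨hz, hR⟩ t ht
    obtain ⟨z', hz', hf⟩ := hstep i z hz t ht
    refine ⟨z', ⟨hz', ?_⟩, hf⟩
    have h1 : R z (A i) := by
      have := hBA (i - 1)
      rw [sub_add_cancel] at this
      exact htr _ _ _ hR this
    rw [add_sub_cancel_right]
    refine hG i z' (hN _ hz') _ (hN _ (hB i)) ?_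
    rw [← hf.level, ← hAB i]
    exact hF i _ (hN i hz) _ (hN i (hA i)) h1
  obtain ⟨n, hn⟩ := exists_nat_ge ((t' - t) / T)
  rw [div_le_iff₀ hT] at hn
  obtain ⟨j, w, hw, w', hw', e, r, hr, h⟩ := M.exists_arc_of_step hS hst (i := 0) (z := B 3)
    (t := t') (s := t + n * T) ⟨hB 3, hrefl _⟩ ht' (by linarith)
  have hp : γ (t + n * T) = γ t := by
    have := per.nat_mul n
    exact this t
  rw [hp, ht] at h
  rcases hr.1.eq_or_lt with rfl | h0
  · rw [M.c_zero] at h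
    obtain ⟨rfl, h'⟩ := gate_injective (M.pos_of_mem (hN 0 (hA 0))) (M.pos_of_mem (hS _ hw)) h
    rw [h']
    exact hw.2
  · exact absurd ((M.arc j w (hS _ hw) w' (hS _ hw') e).2.2 r ⟨h0, hr.2⟩)
      (h ▸ gate_notMem_arcZone _ _ _)

theorem eventually_solvable (M : X.IsAnnulus l u τ₀ F G c τ) {i : Fin 4} {a b : ℝ}
    (ha : a ∈ Ioo l u) (hb : b ∈ Ioo l u) (h : F i a = G i b) :
    ∀ᶠ z in 𝓝 a, z ∈ Ioo l u ∧ ∃ z' ∈ Ioo l u, F i z = G i z' := by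
  obtain ⟨b₁, hb₁, hb₁'⟩ := exists_between hb.1
  obtain ⟨b₂, hb₂, hb₂'⟩ := exists_between hb.2
  have h1 : b₁ ∈ Ioo l u := ⟨hb₁, hb₁'.trans hb.2⟩
  have h2 : b₂ ∈ Ioo l u := ⟨hb.1.trans hb₂, hb₂'⟩
  have hc : ContinuousAt (F i) a := (M.cont_F i).continuousAt (Ioo_mem_nhds ha.1 ha.2)
  have hm : Ioo (G i b₁) (G i b₂) ∈ 𝓝 (F i a) :=
    h ▸ Ioo_mem_nhds (M.mono_G i h1 hb hb₁') (M.mono_G i hb h2 hb₂)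
  filter_upwards [Ioo_mem_nhds ha.1 ha.2, hc hm] with z hz hz'
  have hsub : Icc b₁ b₂ ⊆ Ioo l u := fun x hx => ⟨hb₁.trans_le hx.1, hx.2.trans_lt hb₂'⟩
  obtain ⟨z', hz1, hz2⟩ := intermediate_value_Icc (hb₁'.trans hb₂).le ((M.cont_G i).mono hsub)
    ⟨hz'.1.le, hz'.2.le⟩
  exact ⟨hz, z', hsub hz1, hz2.symm⟩

/-- A curve that avoids the switching lines stays in one zone. -/
theorem exists_zone_of_avoids (hγ : Continuous γ) (h : ∀ t, (γ t).1 ≠ -1 ∧ (γ t).1 ≠ 1) :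
    ∃ i, ∀ t, γ t ∈ arcZone i := by
  have hc : Continuous fun t => (γ t).1 := continuous_fst.comp hγ
  have side : ∀ a : ℝ, (∀ t, (γ t).1 ≠ a) → (∀ t, (γ t).1 < a) ∨ ∀ t, a < (γ t).1 := by
    intro a ha
    by_contra! hcon
    obtain ⟨⟨t, ht⟩, s, hs⟩ := hcon
    obtain ⟨r, hr⟩ := mem_range_of_exists_le_of_exists_ge hc ⟨s, hs⟩ ⟨t, ht⟩
    exact ha r hr
  rcases side (-1) (fun t => (h t).1) with h1 | h1
  · exact ⟨3, h1⟩
  · rcases side 1 (fun t => (h t).2) with h2 | h2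
    · exact ⟨0, fun t => ⟨h1 t, h2 t⟩⟩
    · exact ⟨1, h2⟩

/-- The points that lie off the switching lines or near one of the gates at the heights `y i`. -/
def tube (y : Fin 4 → ℝ) (δ : ℝ) : Set (ℝ × ℝ) :=
  {z | (z.1 ≠ -1 ∨ |z.2 - y 0| < δ ∨ |-z.2 - y 3| < δ) ∧
    (z.1 ≠ 1 ∨ |z.2 - y 1| < δ ∨ |-z.2 - y 2| < δ)}

theorem isOpen_tube (y : Fin 4 → ℝ) (δ : ℝ) : IsOpen (tube y δ) := by
  have o : ∀ a : ℝ, IsOpen {z : ℝ × ℝ | z.1 ≠ a} := fun a =>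
    isOpen_ne_fun continuous_fst continuous_const
  have o1 : ∀ a : ℝ, IsOpen {z : ℝ × ℝ | |z.2 - a| < δ} := fun a =>
    isOpen_lt (by fun_prop) continuous_const
  have o2 : ∀ a : ℝ, IsOpen {z : ℝ × ℝ | |-z.2 - a| < δ} := fun a =>
    isOpen_lt (by fun_prop) continuous_const
  exact ((o (-1)).union ((o1 _).union (o2 _))).inter ((o 1).union ((o1 _).union (o2 _)))

theorem mem_tube_of_gate {δ : ℝ} (hδ : 0 < δ) (i : Fin 4) : gate i (y i) ∈ tube y δ := by
  fin_cases i <;> simp [gate, tube, hδ] <;> left <;> norm_num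

theorem mem_tube_of_mem_arcZone {δ : ℝ} {z : ℝ × ℝ} {i : Fin 4} (hz : z ∈ arcZone i) :
    z ∈ tube y δ :=
  ⟨Or.inl (ne_of_mem_arcZone hz).1, Or.inl (ne_of_mem_arcZone hz).2⟩

theorem near_of_gate_mem_tube {δ z : ℝ} (hδ : ∀ i, δ ≤ y i) (hz : 0 < z) {i : Fin 4}
    (h : gate i z ∈ tube y δ) : |z - y i| < δ := by
  have h0 := hδ 0
  have h1 := hδ 1
  have h2 := hδ 2
  have h3 := hδ 3
  fin_cases i <;> simp [gate, tube, abs_lt] at h ⊢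
  · rcases h.1 with h | h <;> constructor <;> linarith
  · rcases h.2 with h | h <;> constructor <;> linarith
  · rcases h.2 with h | h <;> constructor <;> linarith
  · rcases h.1 with h | h <;> constructor <;> linarith

theorem exists_gate_of_mem_tube {δ : ℝ} {z : ℝ × ℝ} (h : z ∈ tube y δ)
    (hz : z.1 = -1 ∨ z.1 = 1) : ∃ i w, |w - y i| < δ ∧ z = gate i w := by
  rcases hz with hz | hz
  · rcases h.1 with h | h | h
    · exact absurd hz h
    · exact ⟨0, z.2, h, Prod.ext hz rfl⟩
    · exact ⟨3, -z.2, h, Prod.ext hz (neg_neg _).symm⟩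
  · rcases h.2 with h | h | h
    · exact absurd hz h
    · exact ⟨1, z.2, h, Prod.ext hz rfl⟩
    · exact ⟨2, -z.2, h, Prod.ext hz (neg_neg _).symm⟩

/-- A locally unique solution of the four level equations gives a limit cycle, if no zone contains
a periodic orbit. The isolating neighbourhood is a `tube`: a periodic orbit inside it meets the
switching lines only near the gates, follows the arcs from gate to gate, and closes up after one
turn by `not_advance`, applied with both orders of the heights. -/
theorem isLimitCycle_cycle (M : X.IsAnnulus l u τ₀ F G c τ) (hy : ∀ i, y i ∈ Ioo l u)
    (h : ∀ i, F i (y i) = G i (y (i + 1)))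
    (hloc : ∃ δ > 0, ∀ z : Fin 4 → ℝ, (∀ i, |z i - y i| < δ) →
      (∀ i, F i (z i) = G i (z (i + 1))) → z = y)
    (hrest : ∀ i (γ : ℝ → ℝ × ℝ) (T : ℝ), 0 < T → Function.Periodic γ T →
      (∀ t, HasDerivAt γ (X.arcField i (γ t)) t) → ∀ t, γ t = γ 0) :
    X.IsLimitCycle (cycle c τ y) := by
  have arcs := fun i => M.arc i _ (hy i) _ (hy (i + 1)) (h i)
  obtain ⟨δ₀, hδ₀, hloc⟩ := hloc
  obtain ⟨δ, hδ, hδy, hδloc, hδsol⟩ : ∃ δ > 0, (∀ i, δ ≤ y i) ∧ δ ≤ δ₀ ∧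
      ∀ i z, |z - y i| < δ → z ∈ Ioo l u ∧ ∃ z' ∈ Ioo l u, F i z = G i z' := by
    have e1 : ∀ᶠ δ in 𝓝[>] (0 : ℝ), ∀ i, δ ≤ y i := eventually_all.2 fun i =>
      nhdsWithin_le_nhds ((gt_mem_nhds (M.pos_of_mem (hy i))).mono fun _ => le_of_lt)
    have e2 : ∀ᶠ δ in 𝓝[>] (0 : ℝ), δ ≤ δ₀ :=
      nhdsWithin_le_nhds ((gt_mem_nhds hδ₀).mono fun _ => le_of_lt)
    have e3 : ∀ᶠ δ in 𝓝[>] (0 : ℝ), ∀ i z, |z - y i| < δ →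
        z ∈ Ioo l u ∧ ∃ z' ∈ Ioo l u, F i z = G i z' := by
      refine eventually_all.2 fun i => ?_
      obtain ⟨ρ, hρ, H⟩ := Metric.eventually_nhds_iff.1
        (M.eventually_solvable (hy i) (hy (i + 1)) (h i))
      filter_upwards [nhdsWithin_le_nhds (gt_mem_nhds hρ)] with δ hδ z hz
      exact H (by rw [Real.dist_eq]; exact hz.trans hδ)
    obtain ⟨δ, h1, h2, h3, h4⟩ := ((eventually_mem_nhdsWithin (a := (0 : ℝ)) (s := Ioi 0)).and
      (e1.and (e2.and e3))).exists
    exact ⟨δ, h1, h2, h3, h4⟩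
  refine ⟨M.isPeriodicOrbit_cycle hy h, tube y δ, isOpen_tube y δ, ?_, ?_⟩
  · refine iUnion_subset fun i => ?_
    rintro _ ⟨t, ht, rfl⟩
    rcases ht.1.eq_or_lt with rfl | h0
    · rw [M.c_zero]
      exact mem_tube_of_gate hδ i
    · rcases ht.2.eq_or_lt with rfl | h1
      · rw [(arcs i).2.1]
        exact mem_tube_of_gate hδ _
      · exact mem_tube_of_mem_arcZone ((arcs i).2.2 t ⟨h0, h1⟩)
  rintro Γ' hU ⟨γ, T, hT, hγ, per, ⟨t₁, hne⟩, rfl⟩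
  have hU : ∀ t, γ t ∈ tube y δ := fun t => hU ⟨t, rfl⟩
  set N : Fin 4 → Set ℝ := fun i => {z | |z - y i| < δ}
  have hN : ∀ i, N i ⊆ Ioo l u := fun i z hz => (hδsol i z hz).1
  have step : ∀ i, ∀ z ∈ N i, ∀ t, γ t = gate i z → ∃ z' ∈ N (i + 1),
      Follows F G c τ γ t i z z' ∧ γ (t + τ i z z') = gate (i + 1) z' := by
    intro i z hz t ht
    obtain ⟨hz1, z', hz2, e⟩ := hδsol i z hz
    obtain ⟨h1, h2⟩ := M.follows hγ hz1 hz2 e ht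
    exact ⟨z', near_of_gate_mem_tube hδy (M.pos_of_mem hz2) (h2 ▸ hU _), h1, h2⟩
  have step' : ∀ i, ∀ z ∈ N i, ∀ t, γ t = gate i z → ∃ z' ∈ N (i + 1),
      Follows F G c τ γ t i z z' := fun i z hz t ht =>
    let ⟨z', h1, h2, _⟩ := step i z hz t ht
    ⟨z', h1, h2⟩
  -- the orbit passes a gate, hence also the gate `0`
  obtain ⟨t₀, a, ha, ht₀⟩ : ∃ t, ∃ z ∈ N 0, γ t = gate 0 z := by
    have first : ∃ i t, ∃ z ∈ N i, γ t = gate i z := by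
      by_contra! hcon
      have av : ∀ t, (γ t).1 ≠ -1 ∧ (γ t).1 ≠ 1 := by
        intro t
        by_contra! hx
        have : (γ t).1 = -1 ∨ (γ t).1 = 1 := by
          by_cases hx1 : (γ t).1 = -1
          · exact Or.inl hx1
          · exact Or.inr (hx hx1)
        obtain ⟨i, w, hw, e⟩ := exists_gate_of_mem_tube (hU t) this
        exact hcon i t w hw e
      obtain ⟨i, hi⟩ := exists_zone_of_avoids hγ.continuous av
      exact hne (hrest i γ T hT per
        (fun t => (solvesAt_iff_of_mem_arcZone (hi t)).1 (hγ t)) t₁)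
    have next : ∀ i, (∃ t, ∃ z ∈ N i, γ t = gate i z) →
        ∃ t, ∃ z ∈ N (i + 1), γ t = gate (i + 1) z := by
      rintro i ⟨t, z, hz, ht⟩
      obtain ⟨z', hz', -, h2⟩ := step i z hz t ht
      exact ⟨_, z', hz', h2⟩
    obtain ⟨i, hi⟩ := first
    fin_cases i
    · exact hi
    · exact next 3 (next 2 (next 1 hi))
    · exact next 3 (next 2 hi)
    · exact next 3 hi
  -- one turn
  obtain ⟨a₁, ha₁, f₀, e₁⟩ := step 0 a ha t₀ ht₀
  obtain ⟨a₂, ha₂, f₁, e₂⟩ := step 1 a₁ ha₁ _ e₁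
  obtain ⟨a₃, ha₃, f₂, e₃⟩ := step 2 a₂ ha₂ _ e₂
  obtain ⟨a₄, ha₄, f₃, e₄⟩ := step 3 a₃ ha₃ _ e₃
  set A : Fin 4 → ℝ := ![a, a₁, a₂, a₃]
  set B : Fin 4 → ℝ := ![a₁, a₂, a₃, a₄]
  have hA : ∀ i, A i ∈ N i := fun i => by fin_cases i <;> assumption
  have hB : ∀ i, B i ∈ N (i + 1) := fun i => by fin_cases i <;> assumption
  have hAB : ∀ i, F i (A i) = G i (B i) := fun i => by
    fin_cases i
    exacts [f₀.level, f₁.level, f₂.level, f₃.level]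
  have ret : a₄ = a := by
    refine le_antisymm ?_ ?_
    · by_contra! hlt
      have := M.not_advance (R := fun x y => y ≤ x) hN step' hT per
        (fun i z hz w hw hzw => (M.mono_F i).monotoneOn hw hz hzw)
        (fun i z hz w hw hzw => ((M.mono_G i).le_iff_le hw hz).1 hzw)
        (fun a b d h1 h2 => h2.trans h1) (fun a => le_rfl) hA hB hAB
        (fun i => by fin_cases i; exacts [le_rfl, le_rfl, le_rfl, hlt.le]) ht₀ e₄
      exact absurd this (not_le.2 hlt)
    · by_contra! hlt
      have := M.not_advance (R := fun x y => x ≤ y) hN step' hT per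
        (fun i z hz w hw hzw => (M.mono_F i).monotoneOn hz hw hzw)
        (fun i z hz w hw hzw => ((M.mono_G i).le_iff_le hz hw).1 hzw)
        (fun a b d h1 h2 => h1.trans h2) (fun a => le_rfl) hA hB hAB
        (fun i => by fin_cases i; exacts [le_rfl, le_rfl, le_rfl, hlt.le]) ht₀ e₄
      exact absurd this (not_le.2 hlt)
  have hAy : A = y := hloc A (fun i => (hA i).trans_le hδloc) fun i => by
    rw [hAB i]
    congr 1
    fin_cases i
    exacts [rfl, rfl, rfl, ret]
  have hay : γ t₀ = gate 0 (y 0) := by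
    rw [ht₀, ← hAy]
    rfl
  have gates : ∀ i, ∃ t, γ t = gate i (y i) := by
    have next : ∀ i, (∃ t, γ t = gate i (y i)) → ∃ t, γ t = gate (i + 1) (y (i + 1)) :=
      fun i ⟨t, ht⟩ => ⟨_, (M.follows hγ (hy i) (hy (i + 1)) (h i) ht).2⟩
    have g0 : ∃ t, γ t = gate 0 (y 0) := ⟨t₀, hay⟩
    intro i
    fin_cases i
    exacts [g0, next 0 g0, next 1 (next 0 g0), next 2 (next 1 (next 0 g0))]
  refine Subset.antisymm ?_ (iUnion_subset fun i => ?_)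
  · rintro _ ⟨t, rfl⟩
    obtain ⟨n, hn⟩ := exists_nat_ge ((t₀ - t) / T)
    rw [div_le_iff₀ hT] at hn
    obtain ⟨j, w, rfl, w', rfl, -, r, hr, e⟩ :=
      M.exists_arc_of_step (γ := γ) (S := fun i => {y i})
      (fun i => singleton_subset_iff.2 (hy i))
      (fun i z hz t ht => ⟨y (i + 1), rfl, by
        rw [mem_singleton_iff.1 hz] at ht ⊢
        exact (M.follows hγ (hy i) (hy (i + 1)) (h i) ht).1⟩) (i := 0) (t := t₀)
      (s := t + n * T) rfl hay (by linarith)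
    have hp : γ (t + n * T) = γ t := per.nat_mul n t
    rw [← hp, e]
    exact mem_iUnion.2 ⟨j, r, Ico_subset_Icc_self hr, rfl⟩
  · rintro _ ⟨s, hs, rfl⟩
    obtain ⟨t, ht⟩ := gates i
    exact ⟨t + s, (M.follows hγ (hy i) (hy (i + 1)) (h i) ht).1.eq s hs⟩

end IsAnnulus
end ThreeZoneField

/-! ### The perturbed system and its explicit orbits -/

/-- Strengths of the perturbations used: dilations about the centers in the central (`p`) and the
left (`m`) zone and about the saddle in the right zone (`q`), and a drift in the right zone
(`r`). -/
structure Strengths where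
  p : ℝ
  m : ℝ
  q : ℝ
  r : ℝ

namespace Strengths

/-- The perturbation `(p x, p y)` in the central, `(m (x + 3), m (y - 1))` in the left and
`(q (x - 2) + r, q y)` in the right zone. -/
def pert (k : Strengths) : ThreeZonePert where
  left := { p := k.m, q := 0, r := 3 * k.m, s := 0, u := k.m, v := -k.m }
  center := { p := k.p, q := 0, r := 0, s := 0, u := k.p, v := 0 }
  right := { p := k.q, q := 0, r := k.r - 2 * k.q, s := 0, u := k.q, v := 0 }

/-- The perturbed system. -/
noncomputable def sys (k : Strengths) (ε : ℝ) : ThreeZoneField := ccsSystem.perturbedField k.pert ε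

variable (k : Strengths) (ε : ℝ)

theorem sys_left (z : ℝ × ℝ) : (k.sys ε).left z =
    (z.1 + 2 * z.2 + 1 + ε * k.m * (z.1 + 3), -z.1 - z.2 - 2 + ε * k.m * (z.2 - 1)) := by
  simp only [sys, ThreeZoneHam.perturbedField, HamCoeff.field_eq, ccsSystem, normalForm, pert,
    PertCoeff.field]
  ext <;> simp <;> ring

theorem sys_center (z : ℝ × ℝ) : (k.sys ε).center z =
    (z.2 + ε * k.p * z.1, -z.1 + ε * k.p * z.2) := by
  simp only [sys, ThreeZoneHam.perturbedField, HamCoeff.field_eq, ccsSystem, normalForm, pert,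
    PertCoeff.field]
  ext <;> simp <;> ring

theorem sys_right (z : ℝ × ℝ) : (k.sys ε).right z =
    (z.2 + ε * (k.q * (z.1 - 2) + k.r), z.1 - 2 + ε * k.q * z.2) := by
  simp only [sys, ThreeZoneHam.perturbedField, HamCoeff.field_eq, ccsSystem, normalForm, pert,
    PertCoeff.field]
  ext <;> simp [-mul_eq_mul_left_iff] <;> ring

end Strengths

/-- An affine planar vector field is Lipschitz. -/
theorem exists_lipschitzWith_affine {V : ℝ × ℝ → ℝ × ℝ} (a b c d e f : ℝ)
    (h : ∀ z, V z = (a * z.1 + b * z.2 + c, d * z.1 + e * z.2 + f)) : ∃ K, LipschitzWith K V := by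
  let L : ℝ × ℝ →L[ℝ] ℝ × ℝ :=
    (a • ContinuousLinearMap.fst ℝ ℝ ℝ + b • ContinuousLinearMap.snd ℝ ℝ ℝ).prod
      (d • ContinuousLinearMap.fst ℝ ℝ ℝ + e • ContinuousLinearMap.snd ℝ ℝ ℝ)
  refine ⟨‖L‖₊, LipschitzWith.of_dist_le_mul fun x y => ?_⟩
  have := L.lipschitz.dist_le_mul x y
  have hV : ∀ z, V z = L z + (c, f) := fun z => by rw [h]; rfl
  rwa [hV, hV, dist_add_right]

/-- The orbit `e^{μt} R(t) (-1, y)` of the focus `x' = y + μ x`, `y' = -x + μ y`. -/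
noncomputable def focusArc (μ y t : ℝ) : ℝ × ℝ :=
  (Real.exp (μ * t) * (-Real.cos t + y * Real.sin t),
    Real.exp (μ * t) * (Real.sin t + y * Real.cos t))

/-- The orbit through `(-1, y)` of the saddle `x' = y + κ x`, `y' = x + κ y`. -/
noncomputable def saddleArc (κ y t : ℝ) : ℝ × ℝ :=
  (Real.exp (κ * t) * (-Real.cosh t + y * Real.sinh t),
    Real.exp (κ * t) * (-Real.sinh t + y * Real.cosh t))

theorem hasDerivAt_exp_mul (μ t : ℝ) :
    HasDerivAt (fun t => Real.exp (μ * t)) (μ * Real.exp (μ * t)) t := by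
  simpa [mul_comm] using ((hasDerivAt_id t).const_mul μ).exp

theorem hasDerivAt_focusArc_fst (μ y t : ℝ) : HasDerivAt (fun t => (focusArc μ y t).1)
    ((focusArc μ y t).2 + μ * (focusArc μ y t).1) t := by
  refine ((hasDerivAt_exp_mul μ t).fun_mul ((Real.hasDerivAt_cos t).fun_neg.fun_add
    ((Real.hasDerivAt_sin t).const_mul y))).congr_deriv ?_
  simp only [focusArc]
  ring

theorem hasDerivAt_focusArc_snd (μ y t : ℝ) : HasDerivAt (fun t => (focusArc μ y t).2)
    (-(focusArc μ y t).1 + μ * (focusArc μ y t).2) t := by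
  refine ((hasDerivAt_exp_mul μ t).fun_mul ((Real.hasDerivAt_sin t).fun_add
    ((Real.hasDerivAt_cos t).const_mul y))).congr_deriv ?_
  simp only [focusArc]
  ring

theorem hasDerivAt_saddleArc_fst (κ y t : ℝ) : HasDerivAt (fun t => (saddleArc κ y t).1)
    ((saddleArc κ y t).2 + κ * (saddleArc κ y t).1) t := by
  refine ((hasDerivAt_exp_mul κ t).fun_mul ((Real.hasDerivAt_cosh t).fun_neg.fun_add
    ((Real.hasDerivAt_sinh t).const_mul y))).congr_deriv ?_
  simp only [saddleArc]
  ring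

theorem hasDerivAt_saddleArc_snd (κ y t : ℝ) : HasDerivAt (fun t => (saddleArc κ y t).2)
    ((saddleArc κ y t).1 + κ * (saddleArc κ y t).2) t := by
  refine ((hasDerivAt_exp_mul κ t).fun_mul ((Real.hasDerivAt_sinh t).fun_neg.fun_add
    ((Real.hasDerivAt_cosh t).const_mul y))).congr_deriv ?_
  simp only [saddleArc]
  ring

theorem focusArc_tan {φ : ℝ} (hφ : Real.cos φ ≠ 0) (μ t : ℝ) :
    focusArc μ (Real.tan φ) t = (-(Real.exp (μ * t) * Real.cos (t + φ) / Real.cos φ),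
      Real.exp (μ * t) * Real.sin (t + φ) / Real.cos φ) := by
  rw [focusArc, Real.tan_eq_sin_div_cos, Real.cos_add, Real.sin_add]
  ext
  · field_simp
    ring
  · field_simp

/-- While the angle to the axis is acute and larger than that of the nullcline, an orbit of a focus
moves away from the switching line. -/
theorem exp_mul_cos_lt {μ φ θ : ℝ} (h0 : 0 < φ) (h : μ * Real.cos φ < Real.sin φ) (h1 : φ < θ)
    (h2 : θ ≤ Real.pi / 2) : Real.exp (μ * (θ - φ)) * Real.cos θ < Real.cos φ := by
  have anti : StrictAntiOn (fun x => Real.exp (μ * x) * Real.cos x) (Icc φ (Real.pi / 2)) := by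
    refine strictAntiOn_of_deriv_neg (convex_Icc _ _) (by fun_prop) fun x hx => ?_
    rw [interior_Icc] at hx
    have hd : HasDerivAt (fun x => Real.exp (μ * x) * Real.cos x)
        (Real.exp (μ * x) * (μ * Real.cos x - Real.sin x)) x :=
      ((hasDerivAt_exp_mul μ x).fun_mul (Real.hasDerivAt_cos x)).congr_deriv (by ring)
    rw [hd.deriv]
    refine mul_neg_of_pos_of_neg (Real.exp_pos _) ?_
    have c1 : 0 < Real.cos x := Real.cos_pos_of_mem_Ioo ⟨by linarith [hx.1], hx.2⟩
    have c2 : 0 < Real.cos φ := Real.cos_pos_of_mem_Ioo ⟨by linarith, by linarith [hx.1, hx.2]⟩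
    have s1 : 0 < Real.sin (x - φ) :=
      Real.sin_pos_of_pos_of_lt_pi (by linarith [hx.1]) (by linarith [hx.2, Real.pi_pos])
    rw [Real.sin_sub] at s1
    have : Real.cos φ * (μ * Real.cos x - Real.sin x) < 0 := by nlinarith
    exact (pos_iff_neg_of_mul_neg this).1 c2
  have := anti ⟨le_rfl, h1.le.trans h2⟩ ⟨h1.le, h2⟩ h1
  simp only at this
  rw [mul_sub, Real.exp_sub, div_mul_eq_mul_div, div_lt_iff₀ (Real.exp_pos _)]
  linarith

theorem focusArc_end {μ φ φ' τ : ℝ} (hφ' : Real.cos φ' ≠ 0)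
    (hτ : Real.exp (μ * τ) * Real.cos φ' = Real.cos φ) :
    Real.exp (μ * τ) / Real.cos φ = 1 / Real.cos φ' := by
  rw [← hτ]
  have := Real.exp_pos (μ * τ)
  field_simp

/-- The arc of a focus between the lines `x = -1` and `x = 1`. -/
theorem focusArc_center {μ φ φ' : ℝ} (h0 : 0 < φ) (h0' : 0 < φ') (h1 : φ < Real.pi / 2)
    (h1' : φ' < Real.pi / 2) (h : μ * Real.cos φ < Real.sin φ)
    (h' : -μ * Real.cos φ' < Real.sin φ')
    (hτ : Real.exp (μ * (Real.pi - φ - φ')) * Real.cos φ' = Real.cos φ) :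
    focusArc μ (Real.tan φ) (Real.pi - φ - φ') = (1, Real.tan φ') ∧
      ∀ t ∈ Ioo 0 (Real.pi - φ - φ'),
        -1 < (focusArc μ (Real.tan φ) t).1 ∧ (focusArc μ (Real.tan φ) t).1 < 1 := by
  have c : 0 < Real.cos φ := Real.cos_pos_of_mem_Ioo ⟨by linarith, h1⟩
  have c' : 0 < Real.cos φ' := Real.cos_pos_of_mem_Ioo ⟨by linarith, h1'⟩
  have he := focusArc_end c'.ne' hτ
  constructor
  · rw [focusArc_tan c.ne', show Real.pi - φ - φ' + φ = Real.pi - φ' by ring, Real.cos_pi_sub,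
      Real.sin_pi_sub, mul_div_right_comm, mul_div_right_comm, he, Real.tan_eq_sin_div_cos]
    ext
    · field_simp
    · simp only
      field_simp
  · intro t ht
    have hp := Real.exp_pos (μ * t)
    rw [focusArc_tan c.ne']
    simp only
    rcases le_or_gt (t + φ) (Real.pi / 2) with ha | ha
    · have h2 := exp_mul_cos_lt h0 h (show φ < t + φ by linarith [ht.1]) ha
      rw [add_sub_cancel_right] at h2
      have h3 : 0 ≤ Real.cos (t + φ) :=
        Real.cos_nonneg_of_mem_Icc ⟨by linarith [ht.1, Real.pi_pos], ha⟩
      have h4 : 0 ≤ Real.exp (μ * t) * Real.cos (t + φ) / Real.cos φ := by positivity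
      have h5 : Real.exp (μ * t) * Real.cos (t + φ) / Real.cos φ < 1 := (div_lt_one c).2 h2
      constructor <;> linarith
    · have h2 := exp_mul_cos_lt h0' h' (show φ' < Real.pi - (t + φ) by linarith [ht.2])
        (by linarith)
      rw [Real.cos_pi_sub] at h2
      have h3 : Real.cos (t + φ) < 0 :=
        Real.cos_neg_of_pi_div_two_lt_of_lt ha (by linarith [ht.2])
      have h4 : Real.exp (μ * t) * Real.cos (t + φ) / Real.cos φ < 0 :=
        div_neg_of_neg_of_pos (mul_neg_of_pos_of_neg hp h3) c
      refine ⟨by linarith, ?_⟩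
      rw [← neg_div, div_lt_one c, ← hτ,
        show μ * t = μ * (Real.pi - φ - φ') + -μ * (Real.pi - (t + φ) - φ') by ring, Real.exp_add]
      have := mul_lt_mul_of_pos_left h2 (Real.exp_pos (μ * (Real.pi - φ - φ')))
      linarith

/-- The arc of a focus to the right of the line `x = -1`. -/
theorem focusArc_left {μ φ φ' : ℝ} (h0 : 0 < φ) (h0' : 0 < φ') (h1 : φ < Real.pi / 2)
    (h1' : φ' < Real.pi / 2) (h : μ * Real.cos φ < Real.sin φ)
    (h' : -μ * Real.cos φ' < Real.sin φ')
    (hτ : Real.exp (μ * (2 * Real.pi - φ - φ')) * Real.cos φ' = Real.cos φ) :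
    focusArc μ (Real.tan φ) (2 * Real.pi - φ - φ') = (-1, -Real.tan φ') ∧
      ∀ t ∈ Ioo 0 (2 * Real.pi - φ - φ'), -1 < (focusArc μ (Real.tan φ) t).1 := by
  have c : 0 < Real.cos φ := Real.cos_pos_of_mem_Ioo ⟨by linarith, h1⟩
  have c' : 0 < Real.cos φ' := Real.cos_pos_of_mem_Ioo ⟨by linarith, h1'⟩
  have he := focusArc_end c'.ne' hτ
  constructor
  · rw [focusArc_tan c.ne', show 2 * Real.pi - φ - φ' + φ = 2 * Real.pi - φ' by ring,
      Real.cos_two_pi_sub, Real.sin_two_pi_sub, mul_div_right_comm, mul_div_right_comm, he,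
      Real.tan_eq_sin_div_cos]
    ext
    · field_simp
    · simp only
      field_simp
  · intro t ht
    have hp := Real.exp_pos (μ * t)
    rw [focusArc_tan c.ne']
    simp only
    rw [neg_lt_neg_iff, div_lt_one c]
    rcases le_or_gt (t + φ) (Real.pi / 2) with ha | ha
    · have h2 := exp_mul_cos_lt h0 h (show φ < t + φ by linarith [ht.1]) ha
      rwa [add_sub_cancel_right] at h2
    · rcases le_or_gt (t + φ) (Real.pi + Real.pi / 2) with hb | hb
      · have h3 : Real.cos (t + φ) ≤ 0 := Real.cos_nonpos_of_pi_div_two_le_of_le ha.le hb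
        exact (mul_nonpos_of_nonneg_of_nonpos hp.le h3).trans_lt c
      · have h2 := exp_mul_cos_lt h0' h' (show φ' < 2 * Real.pi - (t + φ) by linarith [ht.2])
          (by linarith)
        rw [Real.cos_two_pi_sub] at h2
        rw [show μ * t = μ * (2 * Real.pi - φ - φ') + -μ * (2 * Real.pi - (t + φ) - φ') by ring,
          Real.exp_add]
        have := mul_lt_mul_of_pos_left h2 (Real.exp_pos (μ * (2 * Real.pi - φ - φ')))
        linarith

theorem saddleArc_tanh (κ φ t : ℝ) :
    saddleArc κ (Real.tanh φ) t = (-(Real.exp (κ * t) * Real.cosh (t - φ) / Real.cosh φ),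
      -(Real.exp (κ * t) * Real.sinh (t - φ) / Real.cosh φ)) := by
  have := (Real.cosh_pos φ).ne'
  rw [saddleArc, Real.tanh_eq_sinh_div_cosh, Real.cosh_sub, Real.sinh_sub]
  ext <;> field_simp <;> ring

/-- The arc of a saddle to the right of the line `x = -1`. -/
theorem saddleArc_right {κ φ φ' : ℝ} (h0 : 0 < φ) (h0' : 0 < φ') (hκ : |κ| < 1)
    (hτ : Real.exp (κ * (φ + φ')) * Real.cosh φ' = Real.cosh φ) :
    saddleArc κ (Real.tanh φ) (φ + φ') = (-1, -Real.tanh φ') ∧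
      ∀ t ∈ Ioo 0 (φ + φ'), -1 < (saddleArc κ (Real.tanh φ) t).1 := by
  obtain ⟨hκ1, hκ2⟩ := abs_lt.1 hκ
  have c := Real.cosh_pos φ
  have c' := Real.cosh_pos φ'
  constructor
  · have he : Real.exp (κ * (φ + φ')) / Real.cosh φ = 1 / Real.cosh φ' := by
      rw [← hτ]
      have := Real.exp_pos (κ * (φ + φ'))
      field_simp
    rw [saddleArc_tanh, add_sub_cancel_left, mul_div_right_comm, mul_div_right_comm, he,
      Real.tanh_eq_sinh_div_cosh]
    ext
    · simp only
      field_simp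
    · simp only
      field_simp
  · intro t ht
    rw [saddleArc_tanh]
    simp only
    rw [neg_lt_neg_iff, div_lt_one c]
    -- `e^{κt} cosh (t - φ)` is strictly convex and takes the value `cosh φ` at both ends
    set T := φ + φ' with hT
    have hTp : 0 < T := by linarith
    have expand : ∀ s, Real.exp (κ * s) * Real.cosh (s - φ) =
        (Real.exp ((κ + 1) * s - φ) + Real.exp ((κ - 1) * s + φ)) / 2 := fun s => by
      rw [Real.cosh_eq, mul_div_assoc', mul_add, ← Real.exp_add, ← Real.exp_add]
      ring_nf
    have e0 := expand 0
    have eT := expand T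
    rw [show T - φ = φ' by rw [hT]; ring, hτ] at eT
    simp only [mul_zero, Real.exp_zero, one_mul, zero_sub, Real.cosh_neg, zero_add] at e0
    have ha : 0 < 1 - t / T := by
      rw [sub_pos, div_lt_one hTp]
      exact ht.2
    have hb : 0 < t / T := div_pos ht.1 hTp
    have hab : 1 - t / T + t / T = 1 := by ring
    have v1 := strictConvexOn_exp.2 (mem_univ (-φ)) (mem_univ ((κ + 1) * T - φ))
      (by nlinarith) ha hb hab
    have v2 := strictConvexOn_exp.2 (mem_univ φ) (mem_univ ((κ - 1) * T + φ))
      (by nlinarith) ha hb hab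
    simp only [smul_eq_mul] at v1 v2
    rw [show (1 - t / T) * -φ + t / T * ((κ + 1) * T - φ) = (κ + 1) * t - φ by
      field_simp; ring] at v1
    rw [show (1 - t / T) * φ + t / T * ((κ - 1) * T + φ) = (κ - 1) * t + φ by
      field_simp; ring] at v2
    rw [expand]
    have : (1 - t / T) * Real.cosh φ + t / T * Real.cosh φ = Real.cosh φ := by ring
    nlinarith

/-! ### Level functions -/

/-- The level function of the passage through a focus zone: `½ log (x² + y²)` at `|x| = 1`,
corrected by the growth along the orbit. A passage from the height `y` to the height `y'` turns by
the angle `(θ - arctan y) + (θ - arctan y')`, with `θ = π / 2` in the central and `θ = π` in the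
left zone. -/
noncomputable def focusLevel (μ θ y : ℝ) : ℝ :=
  1 / 2 * Real.log (1 + y ^ 2) + μ * (θ - Real.arctan y)

/-- The level function of the passage through the saddle zone: minus the sum of `½ log (x² - y²)`
and `κ artanh (y / x)` at `x = 1`. -/
noncomputable def saddleLevel (κ y : ℝ) : ℝ :=
  -(1 + κ) / 2 * Real.log (1 + y) - (1 - κ) / 2 * Real.log (1 - y)

theorem hasDerivAt_focusLevel (μ θ y : ℝ) :
    HasDerivAt (focusLevel μ θ) ((y - μ) / (1 + y ^ 2)) y := by
  have h : 1 + y ^ 2 ≠ 0 := by positivity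
  refine (((((hasDerivAt_id' y).fun_pow 2).const_add 1).log h).const_mul (1 / 2)
    |>.fun_add (((Real.hasDerivAt_arctan y).const_sub θ).const_mul μ)).congr_deriv ?_
  field_simp
  norm_num
  ring

theorem hasDerivAt_saddleLevel {κ y : ℝ} (h : 1 + y ≠ 0) (h' : 1 - y ≠ 0) :
    HasDerivAt (saddleLevel κ) ((y - κ) / ((1 + y) * (1 - y))) y := by
  refine (((((hasDerivAt_id' y).const_add 1).log h).const_mul (-(1 + κ) / 2)).fun_sub
    ((((hasDerivAt_id' y).const_sub 1).log h').const_mul ((1 - κ) / 2))).congr_deriv ?_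
  field_simp
  ring

theorem strictMonoOn_focusLevel (μ θ : ℝ) : StrictMonoOn (focusLevel μ θ) (Ici μ) := by
  refine strictMonoOn_of_deriv_pos (convex_Ici _)
    (fun y _ => (hasDerivAt_focusLevel μ θ y).continuousAt.continuousWithinAt) fun y hy => ?_
  rw [interior_Ici] at hy
  rw [(hasDerivAt_focusLevel μ θ y).deriv]
  exact div_pos (sub_pos.2 hy) (by positivity)

theorem strictMonoOn_saddleLevel {κ : ℝ} (hκ : -1 < κ) :
    StrictMonoOn (saddleLevel κ) (Ico κ 1) := by
  have hd : ∀ y ∈ Ico κ 1, HasDerivAt (saddleLevel κ) ((y - κ) / ((1 + y) * (1 - y))) y :=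
    fun y hy => hasDerivAt_saddleLevel (by linarith [hy.1]) (by linarith [hy.2])
  refine strictMonoOn_of_deriv_pos (convex_Ico _ _)
    (fun y hy => (hd y hy).continuousAt.continuousWithinAt) fun y hy => ?_
  rw [interior_Ico] at hy
  rw [(hd y ⟨hy.1.le, hy.2⟩).deriv]
  exact div_pos (sub_pos.2 hy.1) (mul_pos (by linarith [hy.1]) (by linarith [hy.2]))

/-- The level equation says that the radius grows by the factor that belongs to the transit time. -/
theorem exp_mul_cos_of_focusLevel_eq {μ θ y y' : ℝ}
    (h : focusLevel μ θ y = focusLevel (-μ) θ y') :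
    Real.exp (μ * (2 * θ - Real.arctan y - Real.arctan y')) * Real.cos (Real.arctan y') =
      Real.cos (Real.arctan y) := by
  have c := Real.cos_arctan_pos y
  have c' := Real.cos_arctan_pos y'
  have key : ∀ x : ℝ, 1 / 2 * Real.log (1 + x ^ 2) = -Real.log (Real.cos (Real.arctan x)) := by
    intro x
    rw [Real.cos_arctan, one_div (√_), Real.log_inv, Real.log_sqrt (by positivity)]
    ring
  rw [focusLevel, focusLevel, key, key] at h
  rw [← Real.exp_log c', ← Real.exp_add, ← Real.exp_log c]
  congr 1
  linarith

/-- The analogue of `exp_mul_cos_of_focusLevel_eq` for the saddle zone. -/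
theorem exp_mul_cosh_of_saddleLevel_eq {κ y y' : ℝ} (hy : y ∈ Ioo (-1) 1) (hy' : y' ∈ Ioo (-1) 1)
    (h : saddleLevel κ y = saddleLevel (-κ) y') :
    Real.exp (κ * (Real.artanh y + Real.artanh y')) * Real.cosh (Real.artanh y') =
      Real.cosh (Real.artanh y) := by
  have key : ∀ x ∈ Ioo (-1 : ℝ) 1, ∀ a : ℝ, saddleLevel a x =
      Real.log (Real.cosh (Real.artanh x)) - a * Real.artanh x := by
    intro x hx a
    have h1 : (0 : ℝ) < 1 + x := by linarith [hx.1]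
    have h2 : (0 : ℝ) < 1 - x := by linarith [hx.2]
    rw [Real.cosh_artanh hx, one_div (√_), Real.log_inv,
      Real.log_sqrt (by nlinarith), show 1 - x ^ 2 = (1 + x) * (1 - x) by ring,
      Real.log_mul h1.ne' h2.ne', Real.artanh_eq_half_log (Ioo_subset_Icc_self hx),
      Real.log_div h1.ne' h2.ne', saddleLevel]
    ring
  rw [key y hy, key y' hy'] at h
  rw [← Real.exp_log (Real.cosh_pos (Real.artanh y')), ← Real.exp_add,
    ← Real.exp_log (Real.cosh_pos (Real.artanh y))]
  congr 1
  linarith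

namespace Strengths

/-- The ordinate of the saddle of the perturbed right subsystem. -/
noncomputable def ordinate (k : Strengths) (ε : ℝ) : ℝ := -(ε * k.r) / (1 - (ε * k.q) ^ 2)

/-- The distance of the saddle of the perturbed right subsystem from the line `x = 1`. -/
noncomputable def dist (k : Strengths) (ε : ℝ) : ℝ := 1 - ε * k.q * k.ordinate ε

/-- The level functions at the departures from the gates. -/
noncomputable def levelOut (k : Strengths) (ε : ℝ) : Fin 4 → ℝ → ℝ
  | 0, y => focusLevel (ε * k.p) (Real.pi / 2) y
  | 1, y => saddleLevel (ε * k.q) ((y - k.ordinate ε) / k.dist ε)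
  | 2, y => focusLevel (ε * k.p) (Real.pi / 2) y
  | 3, y => focusLevel (ε * k.m) Real.pi y

/-- The level functions at the arrivals at the next gates. -/
noncomputable def levelIn (k : Strengths) (ε : ℝ) : Fin 4 → ℝ → ℝ
  | 0, y => focusLevel (-(ε * k.p)) (Real.pi / 2) y
  | 1, y => saddleLevel (-(ε * k.q)) ((y + k.ordinate ε) / k.dist ε)
  | 2, y => focusLevel (-(ε * k.p)) (Real.pi / 2) y
  | 3, y => focusLevel (-(ε * k.m)) Real.pi y

/-- The orbits of the perturbed subsystems that start at the gates. In the left zone the point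
`((x + 3) / 2, (x + 2 y + 1) / 2)` moves as the reflection in the origin of `focusArc`. -/
noncomputable def arc (k : Strengths) (ε : ℝ) : Fin 4 → ℝ → ℝ → ℝ × ℝ
  | 0, y, t => focusArc (ε * k.p) y t
  | 1, y, t =>
    (1 + k.dist ε + k.dist ε * (saddleArc (ε * k.q) ((y - k.ordinate ε) / k.dist ε) t).1,
      k.ordinate ε + k.dist ε * (saddleArc (ε * k.q) ((y - k.ordinate ε) / k.dist ε) t).2)
  | 2, y, t => -focusArc (ε * k.p) y t
  | 3, y, t => (-2 * (focusArc (ε * k.m) y t).1 - 3,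
      (focusArc (ε * k.m) y t).1 - (focusArc (ε * k.m) y t).2 + 1)

/-- The times that the arcs between the gates take. -/
noncomputable def time (k : Strengths) (ε : ℝ) : Fin 4 → ℝ → ℝ → ℝ
  | 0, y, y' => Real.pi - Real.arctan y - Real.arctan y'
  | 1, y, y' => Real.artanh ((y - k.ordinate ε) / k.dist ε) +
      Real.artanh ((y' + k.ordinate ε) / k.dist ε)
  | 2, y, y' => Real.pi - Real.arctan y - Real.arctan y'
  | 3, y, y' => 2 * Real.pi - Real.arctan y - Real.arctan y'

/-- The perturbation is small compared with the heights in `(l, u)`. -/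
structure IsSmall (k : Strengths) (ε l u : ℝ) : Prop where
  l_pos : 0 < l
  lt : l < u
  p_lt : |ε * k.p| < l
  m_lt : |ε * k.m| < l
  q_lt_one : |ε * k.q| < 1
  r_lt : |ε * (k.r - k.q)| < l
  dist_pos : 0 < k.dist ε
  q_lt : |ε * k.q| * k.dist ε + |k.ordinate ε| < l
  u_lt : u + |k.ordinate ε| < k.dist ε

theorem IsSmall.mem {k : Strengths} {ε l u y : ℝ} (h : k.IsSmall ε l u) (hy : y ∈ Ioo l u) {s : ℝ}
    (hs : |s| = |k.ordinate ε|) : (y + s) / k.dist ε ∈ Ioo |ε * k.q| 1 := by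
  have h1 := h.q_lt
  have h2 := h.u_lt
  rw [← hs] at h1 h2
  constructor
  · rw [lt_div_iff₀ h.dist_pos]
    linarith [hy.1, neg_abs_le s]
  · rw [div_lt_one h.dist_pos]
    linarith [hy.2, le_abs_self s]

theorem IsSmall.mem_out {k : Strengths} {ε l u y : ℝ} (h : k.IsSmall ε l u) (hy : y ∈ Ioo l u) :
    (y - k.ordinate ε) / k.dist ε ∈ Ioo |ε * k.q| 1 := by
  rw [sub_eq_add_neg]
  exact h.mem hy (abs_neg _)

theorem IsSmall.mem_in {k : Strengths} {ε l u y : ℝ} (h : k.IsSmall ε l u) (hy : y ∈ Ioo l u) :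
    (y + k.ordinate ε) / k.dist ε ∈ Ioo |ε * k.q| 1 := h.mem hy rfl

theorem hasDerivAt_arc {k : Strengths} {ε : ℝ} (hq : |ε * k.q| < 1) (i : Fin 4) (y t : ℝ) :
    HasDerivAt (k.arc ε i y) ((k.sys ε).arcField i (k.arc ε i y t)) t := by
  have hne : 1 - (ε * k.q) ^ 2 ≠ 0 := by
    have := (sq_lt_one_iff_abs_lt_one _).2 hq
    linarith
  have ho : k.ordinate ε * (1 - (ε * k.q) ^ 2) = -(ε * k.r) := div_mul_cancel₀ _ hne
  fin_cases i
  · refine ((hasDerivAt_focusArc_fst (ε * k.p) y t).prodMk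
      (hasDerivAt_focusArc_snd (ε * k.p) y t)).congr_deriv ?_
    exact (k.sys_center ε _).symm
  · set Y := (y - k.ordinate ε) / k.dist ε with hY
    refine (((hasDerivAt_saddleArc_fst (ε * k.q) Y t).const_mul (k.dist ε)
      |>.const_add (1 + k.dist ε)).prodMk
      ((hasDerivAt_saddleArc_snd (ε * k.q) Y t).const_mul (k.dist ε)
        |>.const_add (k.ordinate ε))).congr_deriv ?_
    refine Eq.trans ?_ (k.sys_right ε _).symm
    simp only [arc, ← hY]
    ext
    · simp only [dist]
      linear_combination -ho
    · simp only [dist]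
      ring
  · refine (((hasDerivAt_focusArc_fst (ε * k.p) y t).prodMk
      (hasDerivAt_focusArc_snd (ε * k.p) y t)).neg).congr_deriv ?_
    refine Eq.trans ?_ (k.sys_center ε _).symm
    simp only [arc]
    ext
    · simp
      ring
    · simp
      ring
  · refine (((hasDerivAt_focusArc_fst (ε * k.m) y t).const_mul (-2)
      |>.sub_const 3).prodMk
      (((hasDerivAt_focusArc_fst (ε * k.m) y t).fun_sub
        (hasDerivAt_focusArc_snd (ε * k.m) y t)).add_const 1)).congr_deriv ?_
    refine Eq.trans ?_ (k.sys_left ε _).symm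
    simp only [arc]
    ext
    · simp only
      ring
    · simp only
      ring

theorem lipschitz_arcField (k : Strengths) (ε : ℝ) (i : Fin 4) :
    ∃ K, LipschitzWith K ((k.sys ε).arcField i) := by
  have c : ∃ K, LipschitzWith K (k.sys ε).center :=
    exists_lipschitzWith_affine (ε * k.p) 1 0 (-1) (ε * k.p) 0 fun z => by
      rw [sys_center]; ext <;> simp only <;> ring
  fin_cases i
  · exact c
  · exact exists_lipschitzWith_affine (ε * k.q) 1 (ε * (k.r - 2 * k.q)) 1 (ε * k.q) (-2)
      fun z => by
        refine (k.sys_right ε z).trans ?_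
        ext <;> simp only <;> ring
  · exact c
  · exact exists_lipschitzWith_affine (1 + ε * k.m) 2 (1 + 3 * (ε * k.m)) (-1) (-1 + ε * k.m)
      (-2 - ε * k.m) fun z => by
        refine (k.sys_left ε z).trans ?_
        ext <;> simp only <;> ring

theorem IsSmall.gateSigns {k : Strengths} {ε l u y : ℝ} (h : k.IsSmall ε l u) (hy : l < y) :
    (k.sys ε).GateSigns y := by
  obtain ⟨p1, p2⟩ := abs_lt.1 h.p_lt
  obtain ⟨m1, m2⟩ := abs_lt.1 h.m_lt
  obtain ⟨r1, r2⟩ := abs_lt.1 h.r_lt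
  constructor <;> simp only [sys_left, sys_center, sys_right] <;> linarith

theorem abs_mul_cos_arctan_lt {μ y : ℝ} (h : |μ| < y) :
    μ * Real.cos (Real.arctan y) < Real.sin (Real.arctan y) ∧
      -μ * Real.cos (Real.arctan y) < Real.sin (Real.arctan y) := by
  have c := Real.cos_arctan_pos y
  have e : Real.sin (Real.arctan y) = y * Real.cos (Real.arctan y) := by
    conv_rhs => rw [← Real.tan_arctan y]
    rw [Real.arctan_tan (Real.neg_pi_div_two_lt_arctan y) (Real.arctan_lt_pi_div_two y),
      Real.tan_mul_cos c.ne']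
  rw [e]
  obtain ⟨h1, h2⟩ := abs_lt.1 h
  constructor <;> gcongr
  linarith

/-- Small perturbations have the expected orbits near the periodic annulus. -/
theorem IsSmall.isAnnulus {k : Strengths} {ε l u : ℝ} (h : k.IsSmall ε l u) :
    ∃ τ₀, (k.sys ε).IsAnnulus l u τ₀ (k.levelOut ε) (k.levelIn ε) (k.arc ε) (k.time ε) := by
  have hl := h.l_pos
  have hq0 := abs_nonneg (ε * k.q)
  have hmemF : ∀ y ∈ Ioo l u, (y - k.ordinate ε) / k.dist ε ∈ Ico (ε * k.q) 1 := fun y hy =>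
    ⟨(le_abs_self _).trans (h.mem_out hy).1.le, (h.mem_out hy).2⟩
  have hmemG : ∀ y ∈ Ioo l u, (y + k.ordinate ε) / k.dist ε ∈ Ico (-(ε * k.q)) 1 := fun y hy =>
    ⟨(neg_le_abs _).trans (h.mem_in hy).1.le, (h.mem_in hy).2⟩
  obtain ⟨q1, q2⟩ := abs_lt.1 h.q_lt_one
  have focus : ∀ {a θ : ℝ}, |a| < l → StrictMonoOn (focusLevel a θ) (Ioo l u) := fun ha =>
    (strictMonoOn_focusLevel _ _).mono fun y hy => ((le_abs_self _).trans ha.le).trans hy.1.le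
  have focusc : ∀ {a θ : ℝ}, ContinuousOn (focusLevel a θ) (Ioo l u) := fun y _ =>
    (hasDerivAt_focusLevel _ _ y).continuousAt.continuousWithinAt
  have monoF : ∀ i, StrictMonoOn (k.levelOut ε i) (Ioo l u) := by
    intro i
    fin_cases i
    · exact focus h.p_lt
    · exact fun y hy y' hy' hlt => strictMonoOn_saddleLevel q1 (hmemF y hy) (hmemF y' hy')
        (div_lt_div_of_pos_right (by linarith) h.dist_pos)
    · exact focus h.p_lt
    · exact focus h.m_lt
  have monoG : ∀ i, StrictMonoOn (k.levelIn ε i) (Ioo l u) := by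
    intro i
    fin_cases i
    · exact focus (by rw [abs_neg]; exact h.p_lt)
    · exact fun y hy y' hy' hlt => strictMonoOn_saddleLevel (by linarith) (hmemG y hy)
        (hmemG y' hy') (div_lt_div_of_pos_right (by linarith) h.dist_pos)
    · exact focus (by rw [abs_neg]; exact h.p_lt)
    · exact focus (by rw [abs_neg]; exact h.m_lt)
  have contF : ∀ i, ContinuousOn (k.levelOut ε i) (Ioo l u) := by
    intro i
    fin_cases i
    · exact focusc
    · intro y hy
      have h1 := hmemF y hy
      exact (ContinuousAt.comp (f := fun y => (y - k.ordinate ε) / k.dist ε)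
        (hasDerivAt_saddleLevel (by linarith [h1.1]) (by linarith [h1.2])).continuousAt
        (by fun_prop)).continuousWithinAt
    · exact focusc
    · exact focusc
  have contG : ∀ i, ContinuousOn (k.levelIn ε i) (Ioo l u) := by
    intro i
    fin_cases i
    · exact focusc
    · intro y hy
      have h1 := hmemG y hy
      exact (ContinuousAt.comp (f := fun y => (y + k.ordinate ε) / k.dist ε)
        (hasDerivAt_saddleLevel (by linarith [h1.1]) (by linarith [h1.2])).continuousAt
        (by fun_prop)).continuousWithinAt
    · exact focusc
    · exact focusc
  have hu1 := Real.arctan_lt_pi_div_two u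
  set a := (l - |k.ordinate ε|) / k.dist ε with ha
  have ha0 : 0 < a := div_pos (by nlinarith [h.q_lt, mul_nonneg hq0 h.dist_pos.le]) h.dist_pos
  have hay : ∀ y ∈ Ioo l u, a ≤ (y - k.ordinate ε) / k.dist ε ∧
      a ≤ (y + k.ordinate ε) / k.dist ε := fun y hy =>
    ⟨div_le_div_of_nonneg_right (by linarith [hy.1, le_abs_self (k.ordinate ε)]) h.dist_pos.le,
      div_le_div_of_nonneg_right (by linarith [hy.1, neg_abs_le (k.ordinate ε)]) h.dist_pos.le⟩
  have ha1 : a < 1 := by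
    have hm : (l + u) / 2 ∈ Ioo l u := ⟨by linarith [h.lt], by linarith [h.lt]⟩
    exact (hay _ hm).1.trans_lt (hmemF _ hm).2
  have hat : 0 < Real.artanh a := Real.artanh_pos ⟨ha0, ha1⟩
  have arct : ∀ y ∈ Ioo l u, 0 < Real.arctan y ∧ Real.arctan y < Real.arctan u := fun y hy =>
    ⟨Real.arctan_pos.2 (hl.trans hy.1), Real.arctan_strictMono hy.2⟩
  have center : ∀ y ∈ Ioo l u, ∀ y' ∈ Ioo l u,
      focusLevel (ε * k.p) (Real.pi / 2) y = focusLevel (-(ε * k.p)) (Real.pi / 2) y' →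
      focusArc (ε * k.p) y (Real.pi - Real.arctan y - Real.arctan y') = (1, y') ∧
      ∀ t ∈ Ioo 0 (Real.pi - Real.arctan y - Real.arctan y'),
        -1 < (focusArc (ε * k.p) y t).1 ∧ (focusArc (ε * k.p) y t).1 < 1 := by
    intro y hy y' hy' e
    have := focusArc_center (arct y hy).1 (arct y' hy').1 (Real.arctan_lt_pi_div_two y)
      (Real.arctan_lt_pi_div_two y') (abs_mul_cos_arctan_lt (h.p_lt.trans hy.1)).1
      (abs_mul_cos_arctan_lt (h.p_lt.trans hy'.1)).2
      (by rw [← exp_mul_cos_of_focusLevel_eq e]; ring_nf)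
    rwa [Real.tan_arctan, Real.tan_arctan] at this
  refine ⟨min (Real.pi - 2 * Real.arctan u) (2 * Real.artanh a), h.l_pos,
    lt_min (by linarith) (by linarith), k.lipschitz_arcField ε, fun y hy => h.gateSigns hy.1,
    monoF, monoG, contF, contG, fun i y t => hasDerivAt_arc h.q_lt_one i y t, fun i y => ?_,
    fun i y hy y' hy' e => ?_⟩
  · have hd := h.dist_pos.ne'
    fin_cases i
    · simp [arc, focusArc, ThreeZoneField.gate]
    · simp [arc, saddleArc, ThreeZoneField.gate, mul_div_cancel₀ _ hd]
    · simp [arc, focusArc, ThreeZoneField.gate]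
    · simp [arc, focusArc, ThreeZoneField.gate]
      constructor <;> ring
  · have b := arct y hy
    have b' := arct y' hy'
    fin_cases i
    · obtain ⟨c1, c2⟩ := center y hy y' hy' e
      exact ⟨(min_le_left _ _).trans (by simp only [time]; linarith), c1, c2⟩
    · have v := h.mem_out hy
      have v' := h.mem_in hy'
      have w : (y - k.ordinate ε) / k.dist ε ∈ Ioo (-1 : ℝ) 1 := ⟨by linarith [v.1], v.2⟩
      have w' : (y' + k.ordinate ε) / k.dist ε ∈ Ioo (-1 : ℝ) 1 := ⟨by linarith [v'.1], v'.2⟩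
      obtain ⟨c1, c2⟩ := saddleArc_right (Real.artanh_pos ⟨by linarith [v.1], v.2⟩)
        (Real.artanh_pos ⟨by linarith [v'.1], v'.2⟩) h.q_lt_one
        (exp_mul_cosh_of_saddleLevel_eq w w' e)
      rw [Real.tanh_artanh w] at c1 c2
      rw [Real.tanh_artanh w'] at c1
      refine ⟨(min_le_right _ _).trans ?_, ?_, fun t ht => ?_⟩
      · have d1 := Real.artanh_le_artanh (by linarith) w.2 (hay y hy).1
        have d2 := Real.artanh_le_artanh (by linarith) w'.2 (hay y' hy').2
        simp only [time]
        linarith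
      · simp only [arc, time]
        rw [c1]
        have hd := h.dist_pos.ne'
        refine Prod.ext ?_ ?_
        · simp [ThreeZoneField.gate]
        · change k.ordinate ε + k.dist ε * -((y' + k.ordinate ε) / k.dist ε) = -y'
          field_simp
          ring
      · have := c2 t ht
        simp only [ThreeZoneField.arcZone, mem_ofPred_eq, arc]
        nlinarith [h.dist_pos]
    · obtain ⟨c1, c2⟩ := center y hy y' hy' e
      refine ⟨(min_le_left _ _).trans (by simp only [time]; linarith), ?_, fun t ht => ?_⟩
      · simp only [arc, time]
        rw [c1]
        rfl
      · have := c2 t ht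
        simp only [ThreeZoneField.arcZone, mem_ofPred_eq, arc, Prod.fst_neg]
        constructor <;> linarith
    · obtain ⟨c1, c2⟩ := focusArc_left b.1 b'.1 (Real.arctan_lt_pi_div_two y)
        (Real.arctan_lt_pi_div_two y') (abs_mul_cos_arctan_lt (h.m_lt.trans hy.1)).1
        (abs_mul_cos_arctan_lt (h.m_lt.trans hy'.1)).2 (exp_mul_cos_of_focusLevel_eq e)
      rw [Real.tan_arctan] at c1 c2
      rw [Real.tan_arctan] at c1
      refine ⟨(min_le_left _ _).trans (by simp only [time]; linarith [Real.pi_pos]), ?_,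
        fun t ht => ?_⟩
      · simp only [arc, time]
        rw [c1]
        refine Prod.ext ?_ ?_
        · simp [ThreeZoneField.gate]
          norm_num
        · simp [ThreeZoneField.gate]
      · have := c2 t ht
        simp only [ThreeZoneField.arcZone, mem_ofPred_eq, arc]
        linarith

end Strengths

/-! ### A chain of four displacement equations -/

/-- The inverse function theorem for a closed chain of four displacement equations
`Φ i ε (y i) ((y (i + 1) - y i) / ε) = 0`, where `Φ i 0 y d = d - D i y`: near a simple zero `h` of
`∑ i, D i` there is a locally unique solution for every small `ε > 0`, and it tends to `h`. -/
theorem exists_chain_solution {Φ : Fin 4 → ℝ → ℝ → ℝ → ℝ} {D : Fin 4 → ℝ → ℝ} {D' : Fin 4 → ℝ}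
    {h : ℝ} (hΦ : ∀ i, ContDiffAt ℝ 1 (fun q : ℝ × ℝ × ℝ => Φ i q.1 q.2.1 q.2.2) (0, h, D i h))
    (hs : ∀ i, ∀ᶠ y in 𝓝 h, ∀ d, Φ i 0 y d = d - D i y)
    (hD : ∀ i, HasDerivAt (D i) (D' i) h) (h0 : ∑ i, D i h = 0) (h1 : ∑ i, D' i ≠ 0) :
    ∃ y : ℝ → Fin 4 → ℝ, Tendsto y (𝓝 0) (𝓝 fun _ => h) ∧ ∀ᶠ ε in 𝓝[>] 0,
      (∀ i, Φ i ε (y ε i) ((y ε (i + 1) - y ε i) / ε) = 0) ∧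
      ∃ δ > 0, ∀ z : Fin 4 → ℝ, (∀ i, |z i - y ε i| < δ) →
        (∀ i, Φ i ε (z i) ((z (i + 1) - z i) / ε) = 0) → z = y ε := by
  rw [Fin.sum_univ_four] at h0 h1
  -- the unknowns are `ε`, the first height and the first three quotients
  let Ψ : ℝ × ℝ × ℝ × ℝ × ℝ → ℝ × ℝ × ℝ × ℝ × ℝ := fun v =>
    (v.1, Φ 0 v.1 v.2.1 v.2.2.1, Φ 1 v.1 (v.2.1 + v.1 * v.2.2.1) v.2.2.2.1,
      Φ 2 v.1 (v.2.1 + v.1 * (v.2.2.1 + v.2.2.2.1)) v.2.2.2.2,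
      Φ 3 v.1 (v.2.1 + v.1 * (v.2.2.1 + v.2.2.2.1 + v.2.2.2.2))
        (-(v.2.2.1 + v.2.2.2.1 + v.2.2.2.2)))
  let v₀ : ℝ × ℝ × ℝ × ℝ × ℝ := (0, h, D 0 h, D 1 h, D 2 h)
  have hD3 : -(D 0 h + D 1 h + D 2 h) = D 3 h := by linarith
  have hΨ : ContDiffAt ℝ 1 Ψ v₀ := by
    have aux : ∀ (i : Fin 4) (f g : ℝ × ℝ × ℝ × ℝ × ℝ → ℝ), ContDiff ℝ 1 f → ContDiff ℝ 1 g →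
        f v₀ = h → g v₀ = D i h → ContDiffAt ℝ 1 (fun v => Φ i v.1 (f v) (g v)) v₀ := by
      intro i f g hf hg ef eg
      have := hΦ i
      rw [← eg, ← ef] at this
      exact ContDiffAt.comp (f := fun v : ℝ × ℝ × ℝ × ℝ × ℝ => (v.1, f v, g v)) v₀ this
        (contDiff_fst.prodMk (hf.prodMk hg)).contDiffAt
    refine contDiff_fst.contDiffAt.prodMk ((aux 0 _ _ ?_ ?_ ?_ ?_).prodMk
      ((aux 1 _ _ ?_ ?_ ?_ ?_).prodMk ((aux 2 _ _ ?_ ?_ ?_ ?_).prodMk (aux 3 _ _ ?_ ?_ ?_ ?_))))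
    all_goals first | fun_prop | rfl | (simp [v₀]; done) | exact hD3
  have hder : HasFDerivAt Ψ (fderiv ℝ Ψ v₀) v₀ := (hΨ.differentiableAt one_ne_zero).hasFDerivAt
  -- a vector in the kernel has a vanishing first component; on the slice `ε = 0` the four equations
  -- are `d - D i y`, and the sum of their linearizations is `-(∑ i, D' i) y`
  have hinj : Function.Injective (fderiv ℝ Ψ v₀).toLinearMap := by
    rw [injective_iff_map_eq_zero]
    intro w hw
    have hw : fderiv ℝ Ψ v₀ w = 0 := hw
    have w1 : w.1 = 0 := by
      have e : HasFDerivAt (fun v => (Ψ v).1) ((ContinuousLinearMap.fst ℝ ℝ _).comp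
        (fderiv ℝ Ψ v₀)) v₀ := hasFDerivAt_fst.comp v₀ hder
      have e' : HasFDerivAt (fun v => (Ψ v).1) (ContinuousLinearMap.fst ℝ ℝ (ℝ × ℝ × ℝ × ℝ)) v₀ :=
        hasFDerivAt_fst
      have := congrArg (fun L => L w) (e.unique e')
      simpa [hw] using this.symm
    obtain ⟨w₀, y, a, b, c⟩ := w
    obtain rfl : w₀ = 0 := w1
    have hl : HasDerivAt (fun t : ℝ => v₀ + t • ((0, y, a, b, c) : ℝ × ℝ × ℝ × ℝ × ℝ))
        ((0, y, a, b, c) : ℝ × ℝ × ℝ × ℝ × ℝ) 0 := by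
      simpa using ((hasDerivAt_id (0 : ℝ)).smul_const
        ((0, y, a, b, c) : ℝ × ℝ × ℝ × ℝ × ℝ)).const_add v₀
    have hcomp : HasDerivAt (fun t : ℝ => Ψ (v₀ + t • ((0, y, a, b, c) : ℝ × ℝ × ℝ × ℝ × ℝ)))
        0 0 := by
      rw [← hw]
      refine HasFDerivAt.comp_hasDerivAt (l := Ψ) 0 ?_ hl
      rw [zero_smul, add_zero]
      exact hder
    have line : HasDerivAt (fun t : ℝ => h + t * y) y 0 := by
      simpa using ((hasDerivAt_id (0 : ℝ)).mul_const y).const_add h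
    have ev : ∀ i, ∀ᶠ t in 𝓝 (0 : ℝ), ∀ d, Φ i 0 (h + t * y) d = d - D i (h + t * y) := by
      intro i
      have : Tendsto (fun t : ℝ => h + t * y) (𝓝 0) (𝓝 h) := by
        simpa using line.continuousAt.tendsto
      exact this.eventually (hs i)
    have slice : ∀ i (d e : ℝ), HasDerivAt (fun t : ℝ => Φ i 0 (h + t * y) (d + t * e))
        (e - D' i * y) 0 := by
      intro i d e
      have h2 : HasDerivAt (fun t : ℝ => D i (h + t * y)) (D' i * y) 0 :=
        HasDerivAt.comp (h₂ := D i) 0 (by simpa using hD i) line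
      have h3 : HasDerivAt (fun t : ℝ => d + t * e - D i (h + t * y)) (e - D' i * y) 0 := by
        simpa using (((hasDerivAt_id (0 : ℝ)).mul_const e).const_add d).fun_sub h2
      refine h3.congr_of_eventuallyEq ?_
      filter_upwards [ev i] with t ht using ht _
    have comp : ∀ {f : ℝ × ℝ × ℝ × ℝ × ℝ → ℝ} (L : ℝ × ℝ × ℝ × ℝ × ℝ →L[ℝ] ℝ), (∀ v, f v = L v) →
        HasDerivAt (fun t : ℝ => f (Ψ (v₀ + t • ((0, y, a, b, c) : ℝ × ℝ × ℝ × ℝ × ℝ)))) 0 0 := by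
      intro f L hf
      simp only [hf]
      have := (L.hasFDerivAt (x := Ψ (v₀ + (0 : ℝ) • (0, y, a, b, c)))).comp_hasDerivAt 0 hcomp
      rw [map_zero] at this
      exact this
    let S := ContinuousLinearMap.snd ℝ ℝ (ℝ × ℝ × ℝ × ℝ)
    have c0 : HasDerivAt (fun t : ℝ => Φ 0 0 (h + t * y) (D 0 h + t * a)) 0 0 := by
      simpa [Ψ, v₀] using comp (f := fun v => v.2.1)
        ((ContinuousLinearMap.fst ℝ ℝ (ℝ × ℝ × ℝ)).comp S) (fun _ => rfl)
    let S2 := (ContinuousLinearMap.snd ℝ ℝ (ℝ × ℝ × ℝ)).comp S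
    have c1 : HasDerivAt (fun t : ℝ => Φ 1 0 (h + t * y) (D 1 h + t * b)) 0 0 := by
      simpa [Ψ, v₀] using comp (f := fun v => v.2.2.1)
        ((ContinuousLinearMap.fst ℝ ℝ (ℝ × ℝ)).comp S2) (fun _ => rfl)
    let S3 := (ContinuousLinearMap.snd ℝ ℝ (ℝ × ℝ)).comp S2
    have c2 : HasDerivAt (fun t : ℝ => Φ 2 0 (h + t * y) (D 2 h + t * c)) 0 0 := by
      simpa [Ψ, v₀] using comp (f := fun v => v.2.2.2.1)
        ((ContinuousLinearMap.fst ℝ ℝ ℝ).comp S3) (fun _ => rfl)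
    have c3 : HasDerivAt (fun t : ℝ => Φ 3 0 (h + t * y) (D 3 h + t * -(a + b + c))) 0 0 := by
      have := comp (f := fun v => v.2.2.2.2)
        ((ContinuousLinearMap.snd ℝ ℝ ℝ).comp S3) (fun _ => rfl)
      convert this using 2 with t
      simp [Ψ, v₀, ← hD3]
      ring_nf
    have u0 := c0.unique (slice 0 _ _)
    have u1 := c1.unique (slice 1 _ _)
    have u2 := c2.unique (slice 2 _ _)
    have u3 := c3.unique (slice 3 _ _)
    have hy : (D' 0 + D' 1 + D' 2 + D' 3) * y = 0 := by linear_combination u0 + u1 + u2 + u3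
    have hy : y = 0 := (mul_eq_zero.1 hy).resolve_left h1
    subst hy
    simp only [mul_zero, sub_zero] at u0 u1 u2
    rw [← u0, ← u1, ← u2]
    rfl
  let e := (LinearEquiv.ofInjectiveEndo _ hinj).toContinuousLinearEquiv
  have hstrict : HasStrictFDerivAt Ψ (e : ℝ × ℝ × ℝ × ℝ × ℝ →L[ℝ] ℝ × ℝ × ℝ × ℝ × ℝ) v₀ :=
    hΨ.hasStrictFDerivAt' hder one_ne_zero
  let R := hstrict.toOpenPartialHomeomorph Ψ
  have hR : ∀ v, R v = Ψ v := fun v => rfl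
  have hv₀ : v₀ ∈ R.source := hstrict.mem_toOpenPartialHomeomorph_source
  have hΨ0 : Ψ v₀ = (0, 0, 0, 0, 0) := by
    have s := fun i => (hs i).self_of_nhds
    simp only [Ψ, v₀, s, zero_mul, add_zero, hD3, sub_self]
  let p : ℝ → ℝ × ℝ × ℝ × ℝ × ℝ := fun ε => (ε, 0, 0, 0, 0)
  have hp : Tendsto p (𝓝 0) (𝓝 (R v₀)) := by
    rw [hR, hΨ0]
    exact (Continuous.prodMk_left (0, 0, 0, 0)).tendsto 0
  have htar : ∀ᶠ ε in 𝓝 0, p ε ∈ R.target :=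
    hp.eventually (R.open_target.mem_nhds (R.map_source hv₀))
  have hv : Tendsto (fun ε => R.symm (p ε)) (𝓝 0) (𝓝 v₀) := by
    have := (R.continuousAt_symm (R.map_source hv₀)).tendsto.comp hp
    rwa [R.left_inv hv₀] at this
  let Y : ℝ × ℝ × ℝ × ℝ × ℝ → Fin 4 → ℝ := fun v =>
    ![v.2.1, v.2.1 + v.1 * v.2.2.1, v.2.1 + v.1 * (v.2.2.1 + v.2.2.2.1),
      v.2.1 + v.1 * (v.2.2.1 + v.2.2.2.1 + v.2.2.2.2)]
  have hY : Continuous Y := by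
    refine continuous_pi fun i => ?_
    fin_cases i <;> simp [Y] <;> fun_prop
  refine ⟨fun ε => Y (R.symm (p ε)), ?_, ?_⟩
  · have := (hY.tendsto v₀).comp hv
    have e : (fun _ => h) = Y v₀ := by
      funext i
      fin_cases i <;> simp [Y, v₀]
    rwa [e]
  · filter_upwards [nhdsWithin_le_nhds htar, self_mem_nhdsWithin] with ε hε hpos
    have hpos : 0 < ε := hpos
    have hinv : Ψ (R.symm (p ε)) = p ε := R.right_inv hε
    have hsrc : R.symm (p ε) ∈ R.source := R.map_target hε
    obtain ⟨w, hw⟩ : ∃ w, w = R.symm (p ε) := ⟨_, rfl⟩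
    rw [← hw] at hinv hsrc ⊢
    obtain ⟨e', y, a, b, c⟩ := w
    simp only [Ψ, p, Prod.mk.injEq] at hinv
    obtain ⟨rfl, i0, i1, i2, i3⟩ := hinv
    constructor
    · intro i
      fin_cases i <;> simp [Y]
      · rwa [mul_div_cancel_left₀ _ hpos.ne']
      · convert i1 using 2
        field_simp
        ring
      · convert i2 using 2
        field_simp
        ring
      · convert i3 using 2
        field_simp
    · let W : (Fin 4 → ℝ) → ℝ × ℝ × ℝ × ℝ × ℝ := fun z =>
        (e', z 0, (z 1 - z 0) / e', (z 2 - z 1) / e', (z 3 - z 2) / e')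
      have hW : Continuous W := by fun_prop
      have hWY : W (Y (e', y, a, b, c)) = (e', y, a, b, c) := by
        simp only [W, Y, Prod.mk.injEq, true_and]
        refine ⟨rfl, ?_, ?_, ?_⟩ <;> simp <;> field_simp <;> ring
      have hnear : ∀ᶠ z in 𝓝 (Y (e', y, a, b, c)), W z ∈ R.source :=
        hW.continuousAt.eventually (by rw [hWY]; exact R.open_source.mem_nhds hsrc)
      obtain ⟨δ, hδ, H⟩ := Metric.eventually_nhds_iff.1 hnear
      refine ⟨δ, hδ, fun z hz hzero => ?_⟩
      have hzs := H ((dist_pi_lt_iff hδ).2 fun i => by rw [Real.dist_eq]; exact hz i)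
      have z0 := hzero 0
      have z1 := hzero 1
      have z2 := hzero 2
      have z3 := hzero 3
      simp only [zero_add, Fin.reduceAdd] at z0 z1 z2 z3
      have hΨz : Ψ (W z) = Ψ (e', y, a, b, c) := by
        simp only [Ψ, W, i0, i1, i2, i3, Prod.mk.injEq, true_and]
        refine ⟨z0, ?_, ?_, ?_⟩
        · convert z1 using 2
          field_simp
          ring
        · convert z2 using 2
          field_simp
          ring
        · convert z3 using 2
          · field_simp
            ring
          · field_simp
            ring
      have := R.injOn hzs hsrc hΨz
      rw [← this]
      funext i
      fin_cases i <;> simp [Y, W] <;> field_simp <;> ring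

/-! ### Displacement equations of the zones -/

/-- The analytic function `log (1 + x) / x`. -/
noncomputable def logQuot : ℝ → ℝ := dslope (fun x => Real.log (1 + x)) 0

theorem mul_logQuot (x : ℝ) : x * logQuot x = Real.log (1 + x) := by
  have := sub_smul_dslope (fun x => Real.log (1 + x)) 0 x
  simpa [logQuot] using this

theorem logQuot_zero : logQuot 0 = 1 := by
  have h : HasDerivAt (fun x : ℝ => Real.log (1 + x)) 1 0 := by
    simpa using ((hasDerivAt_id' (0 : ℝ)).const_add 1).log (by norm_num)
  rw [logQuot, dslope_same, h.deriv]

theorem contDiffAt_logQuot : ContDiffAt ℝ 1 logQuot 0 := by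
  have h : AnalyticAt ℝ (fun x : ℝ => Real.log (1 + x)) 0 :=
    AnalyticAt.fun_comp (g := Real.log) (analyticAt_log (by norm_num)) (by fun_prop)
  obtain ⟨p, hp⟩ := h
  exact (hp.has_fpower_series_dslope_fslope.analyticAt).contDiffAt

/-- `artanh`, written with logarithms. -/
noncomputable def halfLog (y : ℝ) : ℝ := 1 / 2 * (Real.log (1 + y) - Real.log (1 - y))

theorem hasDerivAt_halfLog {y : ℝ} (h : 1 + y ≠ 0) (h' : 1 - y ≠ 0) :
    HasDerivAt halfLog (1 / ((1 + y) * (1 - y))) y := by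
  refine (((((hasDerivAt_id' y).const_add 1).log h).fun_sub
    (((hasDerivAt_id' y).const_sub 1).log h')).const_mul (1 / 2)).congr_deriv ?_
  field_simp
  ring

/-- The difference of the level functions of a focus zone at the heights `y` and `y + ε d`, divided
by `ε` and normalized. -/
noncomputable def focusDisp (p θ ε y d : ℝ) : ℝ :=
  d * logQuot (ε * d * (2 * y + ε * d) / (1 + y ^ 2)) -
    2 * p * (2 * θ - Real.arctan y - Real.arctan (y + ε * d)) * (1 + y ^ 2) / (2 * y + ε * d)

theorem focusDisp_spec (p θ ε : ℝ) {y d : ℝ} (h : 0 < 2 * y + ε * d) :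
    focusLevel (-(ε * p)) θ (y + ε * d) - focusLevel (ε * p) θ y =
      ε * ((2 * y + ε * d) / (2 * (1 + y ^ 2)) * focusDisp p θ ε y d) := by
  have h1 : 0 < 1 + y ^ 2 := by positivity
  have h2 : 0 < 1 + (y + ε * d) ^ 2 := by positivity
  have e := mul_logQuot (ε * d * (2 * y + ε * d) / (1 + y ^ 2))
  have e1 : 1 + ε * d * (2 * y + ε * d) / (1 + y ^ 2) = (1 + (y + ε * d) ^ 2) / (1 + y ^ 2) := by
    field_simp
    ring
  rw [e1, Real.log_div h2.ne' h1.ne'] at e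
  have e2 : Real.log (1 + (y + ε * d) ^ 2) = Real.log (1 + y ^ 2) +
      ε * d * (2 * y + ε * d) / (1 + y ^ 2) *
        logQuot (ε * d * (2 * y + ε * d) / (1 + y ^ 2)) := by linarith
  rw [focusLevel, focusLevel, focusDisp, e2]
  have h3 := h.ne'
  field_simp
  ring

theorem focusDisp_zero (p θ : ℝ) {y : ℝ} (hy : y ≠ 0) (d : ℝ) :
    focusDisp p θ 0 y d = d - 2 * p * (θ - Real.arctan y) * (1 + y ^ 2) / y := by
  rw [focusDisp]
  simp only [zero_mul, zero_div, logQuot_zero, add_zero, mul_one]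
  field_simp
  ring

theorem contDiffAt_focusDisp (p θ : ℝ) {h : ℝ} (hh : 0 < h) (d : ℝ) :
    ContDiffAt ℝ 1 (fun q : ℝ × ℝ × ℝ => focusDisp p θ q.1 q.2.1 q.2.2) (0, h, d) := by
  have h1 : ∀ q : ℝ × ℝ × ℝ, 1 + q.2.1 ^ 2 ≠ 0 := fun q => by positivity
  have h2 : 2 * h + 0 * d ≠ 0 := by
    rw [zero_mul, add_zero]
    positivity
  have hx : ContDiffAt ℝ 1 (fun q : ℝ × ℝ × ℝ =>
      q.1 * q.2.2 * (2 * q.2.1 + q.1 * q.2.2) / (1 + q.2.1 ^ 2)) (0, h, d) :=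
    ContDiffAt.div (by fun_prop) (by fun_prop) (h1 _)
  have hl : ContDiffAt ℝ 1 (fun q : ℝ × ℝ × ℝ => logQuot
      (q.1 * q.2.2 * (2 * q.2.1 + q.1 * q.2.2) / (1 + q.2.1 ^ 2))) (0, h, d) :=
    ContDiffAt.comp (g := logQuot) (0, h, d) (by simpa using contDiffAt_logQuot) hx
  have ha : ContDiff ℝ 1 Real.arctan := Real.contDiff_arctan
  unfold focusDisp
  exact ContDiffAt.sub (ContDiffAt.mul (by fun_prop) hl)
    (ContDiffAt.div (by fun_prop) (by fun_prop) h2)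

namespace Strengths

/-- `k.ordinate ε / ε`. -/
noncomputable def ordinateQuot (k : Strengths) (ε : ℝ) : ℝ := -k.r / (1 - (ε * k.q) ^ 2)

theorem ordinate_eq (k : Strengths) (ε : ℝ) : k.ordinate ε = ε * k.ordinateQuot ε := by
  rw [ordinate, ordinateQuot]
  ring

/-- The difference of the level functions of the saddle zone at the heights `y` and `y + ε d`,
divided by `ε` and normalized. -/
noncomputable def saddleDisp (k : Strengths) (ε y d : ℝ) : ℝ :=
  (d + 2 * k.ordinateQuot ε) * logQuot (-(ε * (d + 2 * k.ordinateQuot ε) *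
      ((y - k.ordinate ε) / k.dist ε + (y + ε * d + k.ordinate ε) / k.dist ε) /
      (k.dist ε * (1 - ((y - k.ordinate ε) / k.dist ε) ^ 2)))) +
    2 * k.q * (halfLog ((y - k.ordinate ε) / k.dist ε) +
      halfLog ((y + ε * d + k.ordinate ε) / k.dist ε)) *
      (k.dist ε * (1 - ((y - k.ordinate ε) / k.dist ε) ^ 2)) /
      ((y - k.ordinate ε) / k.dist ε + (y + ε * d + k.ordinate ε) / k.dist ε)

theorem saddleDisp_spec (k : Strengths) {ε y d : ℝ} (hd : k.dist ε ≠ 0)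
    (h : (y - k.ordinate ε) / k.dist ε ∈ Ioo 0 1)
    (h' : (y + ε * d + k.ordinate ε) / k.dist ε ∈ Ioo 0 1) :
    saddleLevel (-(ε * k.q)) ((y + ε * d + k.ordinate ε) / k.dist ε) -
        saddleLevel (ε * k.q) ((y - k.ordinate ε) / k.dist ε) =
      ε * (((y - k.ordinate ε) / k.dist ε + (y + ε * d + k.ordinate ε) / k.dist ε) /
        (2 * (k.dist ε * (1 - ((y - k.ordinate ε) / k.dist ε) ^ 2))) * k.saddleDisp ε y d) := by
  have hdiff : (y + ε * d + k.ordinate ε) / k.dist ε =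
      (y - k.ordinate ε) / k.dist ε + ε * (d + 2 * k.ordinateQuot ε) / k.dist ε := by
    rw [ordinate_eq]
    field_simp
    ring
  rw [saddleDisp]
  set Y := (y - k.ordinate ε) / k.dist ε
  set Y' := (y + ε * d + k.ordinate ε) / k.dist ε
  set D := d + 2 * k.ordinateQuot ε
  obtain ⟨a1, a2⟩ := h
  obtain ⟨b1, b2⟩ := h'
  have h1 : (0 : ℝ) < 1 + Y := by linarith
  have h2 : (0 : ℝ) < 1 - Y := by linarith
  have h3 : (0 : ℝ) < 1 + Y' := by linarith
  have h4 : (0 : ℝ) < 1 - Y' := by linarith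
  have h5 : (1 - Y ^ 2) ≠ 0 := by nlinarith
  have h6 : Y + Y' ≠ 0 := by linarith
  have e := mul_logQuot (-(ε * D * (Y + Y') / (k.dist ε * (1 - Y ^ 2))))
  have e1 : 1 + -(ε * D * (Y + Y') / (k.dist ε * (1 - Y ^ 2))) =
      ((1 + Y') * (1 - Y')) / ((1 + Y) * (1 - Y)) := by
    have : ε * D / k.dist ε = Y' - Y := by linarith
    rw [show ε * D * (Y + Y') / (k.dist ε * (1 - Y ^ 2)) =
        ε * D / k.dist ε * ((Y + Y') / (1 - Y ^ 2)) by field_simp,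
      this, show (1 + Y) * (1 - Y) = 1 - Y ^ 2 by ring]
    field_simp
    ring
  rw [e1, Real.log_div (by positivity) (by positivity), Real.log_mul h1.ne' h2.ne',
    Real.log_mul h3.ne' h4.ne'] at e
  have e2 : ε * D * (Y + Y') / (k.dist ε * (1 - Y ^ 2)) *
      logQuot (-(ε * D * (Y + Y') / (k.dist ε * (1 - Y ^ 2)))) =
      Real.log (1 + Y) + Real.log (1 - Y) - Real.log (1 + Y') - Real.log (1 - Y') := by linarith
  have e3 : ∀ A B : ℝ, ε * ((Y + Y') / (2 * (k.dist ε * (1 - Y ^ 2))) *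
      (D * A + 2 * k.q * B * (k.dist ε * (1 - Y ^ 2)) / (Y + Y'))) =
      1 / 2 * (ε * D * (Y + Y') / (k.dist ε * (1 - Y ^ 2)) * A) + ε * k.q * B := by
    intro A B
    field_simp
  rw [e3, e2, halfLog, halfLog, saddleLevel, saddleLevel]
  ring

theorem saddleDisp_zero (k : Strengths) {y : ℝ} (hy : y ≠ 0) (d : ℝ) :
    k.saddleDisp 0 y d = d - (2 * k.r - 2 * k.q * halfLog y * (1 - y ^ 2) / y) := by
  have h1 : k.ordinate 0 = 0 := by simp [ordinate]
  have h2 : k.ordinateQuot 0 = -k.r := by simp [ordinateQuot]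
  have h3 : k.dist 0 = 1 := by simp [dist]
  simp only [saddleDisp, h1, h2, h3, zero_mul, zero_div, neg_zero, logQuot_zero, add_zero, sub_zero,
    div_one, mul_one, one_mul]
  field_simp
  ring

theorem contDiffAt_ordinateQuot (k : Strengths) : ContDiffAt ℝ 1 k.ordinateQuot 0 :=
  ContDiffAt.div (by fun_prop) (by fun_prop) (by simp)

theorem contDiffAt_ordinate (k : Strengths) : ContDiffAt ℝ 1 k.ordinate 0 :=
  ContDiffAt.div (by fun_prop) (by fun_prop) (by simp)

theorem contDiffAt_dist (k : Strengths) : ContDiffAt ℝ 1 k.dist 0 :=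
  contDiffAt_const.sub (ContDiffAt.mul (by fun_prop) k.contDiffAt_ordinate)

theorem contDiffAt_saddleDisp (k : Strengths) {h : ℝ} (hh : 0 < h) (hh' : h < 1) (d : ℝ) :
    ContDiffAt ℝ 1 (fun q : ℝ × ℝ × ℝ => k.saddleDisp q.1 q.2.1 q.2.2) (0, h, d) := by
  have o0 : k.ordinate 0 = 0 := by simp [ordinate]
  have d0 : k.dist 0 = 1 := by simp [dist]
  have o : ContDiffAt ℝ 1 (fun q : ℝ × ℝ × ℝ => k.ordinate q.1) (0, h, d) :=
    ContDiffAt.comp (g := k.ordinate) (0, h, d) k.contDiffAt_ordinate contDiffAt_fst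
  have oq : ContDiffAt ℝ 1 (fun q : ℝ × ℝ × ℝ => k.ordinateQuot q.1) (0, h, d) :=
    ContDiffAt.comp (g := k.ordinateQuot) (0, h, d) k.contDiffAt_ordinateQuot contDiffAt_fst
  have di : ContDiffAt ℝ 1 (fun q : ℝ × ℝ × ℝ => k.dist q.1) (0, h, d) :=
    ContDiffAt.comp (g := k.dist) (0, h, d) k.contDiffAt_dist contDiffAt_fst
  have hY : ContDiffAt ℝ 1 (fun q : ℝ × ℝ × ℝ => (q.2.1 - k.ordinate q.1) / k.dist q.1)
      (0, h, d) := ContDiffAt.div (by fun_prop) di (by simp [d0])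
  have hY' : ContDiffAt ℝ 1
      (fun q : ℝ × ℝ × ℝ => (q.2.1 + q.1 * q.2.2 + k.ordinate q.1) / k.dist q.1)
      (0, h, d) := ContDiffAt.div (by fun_prop) di (by simp [d0])
  have hH : ContDiffAt ℝ 1 halfLog h := by
    have c1 : ContDiffAt ℝ 1 (fun y : ℝ => Real.log (1 + y)) h :=
      ContDiffAt.log (by fun_prop) (by linarith)
    have c2 : ContDiffAt ℝ 1 (fun y : ℝ => Real.log (1 - y)) h :=
      ContDiffAt.log (by fun_prop) (by linarith)
    exact contDiffAt_const.mul (c1.sub c2)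
  have hHY : ContDiffAt ℝ 1 (fun q : ℝ × ℝ × ℝ => halfLog ((q.2.1 - k.ordinate q.1) / k.dist q.1))
      (0, h, d) := ContDiffAt.comp (g := halfLog) (0, h, d) (by simpa [o0, d0] using hH) hY
  have hHY' : ContDiffAt ℝ 1 (fun q : ℝ × ℝ × ℝ =>
      halfLog ((q.2.1 + q.1 * q.2.2 + k.ordinate q.1) / k.dist q.1)) (0, h, d) :=
    ContDiffAt.comp (g := halfLog) (0, h, d) (by simpa [o0, d0] using hH) hY'
  have hden : ContDiffAt ℝ 1 (fun q : ℝ × ℝ × ℝ => k.dist q.1 *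
      (1 - ((q.2.1 - k.ordinate q.1) / k.dist q.1) ^ 2)) (0, h, d) :=
    di.mul (contDiffAt_const.sub (hY.pow 2))
  have hsum := hY.add hY'
  have hlq : ContDiffAt ℝ 1 (fun q : ℝ × ℝ × ℝ =>
      logQuot (-(q.1 * (q.2.2 + 2 * k.ordinateQuot q.1) *
      ((q.2.1 - k.ordinate q.1) / k.dist q.1 +
        (q.2.1 + q.1 * q.2.2 + k.ordinate q.1) / k.dist q.1) /
      (k.dist q.1 * (1 - ((q.2.1 - k.ordinate q.1) / k.dist q.1) ^ 2))))) (0, h, d) := by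
    refine ContDiffAt.comp (g := logQuot) (0, h, d) (by simpa using contDiffAt_logQuot) ?_
    refine (ContDiffAt.div (ContDiffAt.mul (by fun_prop) hsum) hden ?_).neg
    simp [o0, d0]
    nlinarith
  unfold saddleDisp
  refine ContDiffAt.add (ContDiffAt.mul (by fun_prop) hlq) (ContDiffAt.div ?_ hsum ?_)
  · exact (contDiffAt_const.mul (hHY.add hHY')).mul hden
  · simp [o0, d0]
    linarith

/-- The displacement equations of the four zones. -/
noncomputable def disp (k : Strengths) : Fin 4 → ℝ → ℝ → ℝ → ℝ
  | 0, ε, y, d => focusDisp k.p (Real.pi / 2) ε y d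
  | 1, ε, y, d => k.saddleDisp ε y d
  | 2, ε, y, d => focusDisp k.p (Real.pi / 2) ε y d
  | 3, ε, y, d => focusDisp k.m Real.pi ε y d

/-- The first order displacements of the height in the four zones. -/
noncomputable def shift (k : Strengths) : Fin 4 → ℝ → ℝ
  | 0, y => 2 * k.p * (Real.pi / 2 - Real.arctan y) * (1 + y ^ 2) / y
  | 1, y => 2 * k.r - 2 * k.q * halfLog y * (1 - y ^ 2) / y
  | 2, y => 2 * k.p * (Real.pi / 2 - Real.arctan y) * (1 + y ^ 2) / y
  | 3, y => 2 * k.m * (Real.pi - Real.arctan y) * (1 + y ^ 2) / y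

theorem disp_zero (k : Strengths) (i : Fin 4) {y : ℝ} (hy : y ≠ 0) (d : ℝ) :
    k.disp i 0 y d = d - k.shift i y := by
  fin_cases i
  · exact focusDisp_zero _ _ hy d
  · exact saddleDisp_zero k hy d
  · exact focusDisp_zero _ _ hy d
  · exact focusDisp_zero _ _ hy d

theorem contDiffAt_disp (k : Strengths) (i : Fin 4) {h : ℝ} (hh : 0 < h) (hh' : h < 1) (d : ℝ) :
    ContDiffAt ℝ 1 (fun q : ℝ × ℝ × ℝ => k.disp i q.1 q.2.1 q.2.2) (0, h, d) := by
  fin_cases i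
  · exact contDiffAt_focusDisp _ _ hh d
  · exact contDiffAt_saddleDisp k hh hh' d
  · exact contDiffAt_focusDisp _ _ hh d
  · exact contDiffAt_focusDisp _ _ hh d

theorem IsSmall.level_iff {k : Strengths} {ε l u y y' : ℝ} (h : k.IsSmall ε l u) (hε : ε ≠ 0)
    (hy : y ∈ Ioo l u) (hy' : y' ∈ Ioo l u) (i : Fin 4) :
    k.levelOut ε i y = k.levelIn ε i y' ↔ k.disp i ε y ((y' - y) / ε) = 0 := by
  have hl := h.l_pos
  obtain ⟨d, hd⟩ : ∃ d, d = (y' - y) / ε := ⟨_, rfl⟩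
  obtain rfl : y' = y + ε * d := by
    rw [hd]
    field_simp
    ring
  rw [← hd]
  have h2 : 0 < 2 * y + ε * d := by linarith [hy.1, hy'.1]
  have close : ∀ {a b c D : ℝ}, b - a = ε * (c * D) → c ≠ 0 → (a = b ↔ D = 0) := by
    intro a b c D e hc
    rw [eq_comm, ← sub_eq_zero, e]
    simp [hε, hc]
  have hf : (2 * y + ε * d) / (2 * (1 + y ^ 2)) ≠ 0 := by positivity
  fin_cases i
  · exact close (focusDisp_spec _ _ _ h2) hf
  · have a := h.mem_out hy
    have b := h.mem_in hy'
    have a' : (y - k.ordinate ε) / k.dist ε ∈ Ioo (0 : ℝ) 1 := ⟨(abs_nonneg _).trans_lt a.1, a.2⟩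
    have b' : (y + ε * d + k.ordinate ε) / k.dist ε ∈ Ioo (0 : ℝ) 1 :=
      ⟨(abs_nonneg _).trans_lt b.1, b.2⟩
    refine close (saddleDisp_spec k h.dist_pos.ne' a' b') ?_
    have := h.dist_pos
    refine div_ne_zero (by linarith [a'.1, b'.1]) (mul_ne_zero two_ne_zero
      (mul_ne_zero this.ne' ?_))
    nlinarith [a'.1, a'.2]
  · exact close (focusDisp_spec _ _ _ h2) hf
  · exact close (focusDisp_spec _ _ _ h2) hf

end Strengths

/-! ### Periodic orbits inside a zone, the periodic annulus, and continuity -/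

/-- A nonzero growth rate excludes nonzero periodic solutions. -/
theorem eq_zero_of_periodic {f : ℝ → ℝ} {a T : ℝ} (ha : a ≠ 0) (hT : 0 < T)
    (hf : ∀ t, HasDerivAt f (a * f t) t) (per : Function.Periodic f T) (t : ℝ) : f t = 0 := by
  have hd : ∀ s, HasDerivAt (fun s => Real.exp (-a * s) * f s) 0 s := fun s =>
    ((hasDerivAt_exp_mul (-a) s).fun_mul (hf s)).congr_deriv (by ring)
  have hc := is_const_of_deriv_eq_zero (fun s => (hd s).differentiableAt) (fun s => (hd s).deriv)
    (t + T) t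
  simp only [per t] at hc
  by_contra hne
  have h1 := mul_right_cancel₀ hne hc
  rw [Real.exp_eq_exp] at h1
  have : a * T = 0 := by linarith
  exact (mul_ne_zero ha hT.ne') this

/-- No focus has a nonconstant periodic orbit. -/
theorem eq_zero_of_periodic_focus {x y : ℝ → ℝ} {μ T : ℝ} (hμ : μ ≠ 0) (hT : 0 < T)
    (hx : ∀ t, HasDerivAt x (y t + μ * x t) t) (hy : ∀ t, HasDerivAt y (-x t + μ * y t) t)
    (px : Function.Periodic x T) (py : Function.Periodic y T) (t : ℝ) : x t = 0 ∧ y t = 0 := by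
  have h := eq_zero_of_periodic (f := fun t => x t ^ 2 + y t ^ 2) (a := 2 * μ) (by simpa) hT
    (fun t => (((hx t).fun_pow 2).fun_add ((hy t).fun_pow 2)).congr_deriv (by
      norm_num
      ring)) (fun t => by simp only [px t, py t]) t
  constructor <;> nlinarith [sq_nonneg (x t), sq_nonneg (y t)]

namespace Strengths

theorem periodic_eq_const {k : Strengths} {ε : ℝ} (hp : ε * k.p ≠ 0) (hm : ε * k.m ≠ 0)
    (hq : |ε * k.q| < 1) (i : Fin 4) (γ : ℝ → ℝ × ℝ) (T : ℝ) (hT : 0 < T)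
    (per : Function.Periodic γ T)
    (hγ : ∀ t, HasDerivAt γ ((k.sys ε).arcField i (γ t)) t) (t : ℝ) : γ t = γ 0 := by
  have h1 : ∀ t, HasDerivAt (fun t => (γ t).1) ((k.sys ε).arcField i (γ t)).1 t := fun t =>
    (hasFDerivAt_fst (p := γ t)).comp_hasDerivAt t (hγ t)
  have h2 : ∀ t, HasDerivAt (fun t => (γ t).2) ((k.sys ε).arcField i (γ t)).2 t := fun t =>
    (hasFDerivAt_snd (p := γ t)).comp_hasDerivAt t (hγ t)
  have c : (∀ t, HasDerivAt (fun t => (γ t).1) ((k.sys ε).center (γ t)).1 t) →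
      (∀ t, HasDerivAt (fun t => (γ t).2) ((k.sys ε).center (γ t)).2 t) → γ t = γ 0 := by
    intro h1 h2
    simp only [sys_center] at h1 h2
    have := eq_zero_of_periodic_focus hp hT h1 h2 (fun t => by simp only [per t])
      (fun t => by simp only [per t])
    exact Prod.ext ((this t).1.trans (this 0).1.symm) ((this t).2.trans (this 0).2.symm)
  fin_cases i
  · exact c h1 h2
  · have h1 : ∀ t, HasDerivAt (fun t => (γ t).1) ((k.sys ε).right (γ t)).1 t := h1
    have h2 : ∀ t, HasDerivAt (fun t => (γ t).2) ((k.sys ε).right (γ t)).2 t := h2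
    simp only [sys_right] at h1 h2
    obtain ⟨q1, q2⟩ := abs_lt.1 hq
    have hne : 1 - (ε * k.q) ^ 2 ≠ 0 := by
      have := (sq_lt_one_iff_abs_lt_one _).2 hq
      linarith
    have ho : k.ordinate ε * (1 - (ε * k.q) ^ 2) = -(ε * k.r) := div_mul_cancel₀ _ hne
    have hdist : k.dist ε = 1 - ε * k.q * k.ordinate ε := rfl
    have w1 := eq_zero_of_periodic (a := ε * k.q + 1)
      (f := fun t => (γ t).1 - (1 + k.dist ε) + ((γ t).2 - k.ordinate ε)) (by linarith) hT
      (fun t => (((h1 t).sub_const _).fun_add ((h2 t).sub_const _)).congr_deriv (by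
        rw [hdist]
        linear_combination ho)) (fun t => by simp only [per t])
    have w2 := eq_zero_of_periodic (a := ε * k.q - 1)
      (f := fun t => (γ t).1 - (1 + k.dist ε) - ((γ t).2 - k.ordinate ε)) (by linarith) hT
      (fun t => (((h1 t).sub_const _).fun_sub ((h2 t).sub_const _)).congr_deriv (by
        rw [hdist]
        linear_combination ho)) (fun t => by simp only [per t])
    exact Prod.ext (by linarith [w1 t, w2 t, w1 0, w2 0]) (by linarith [w1 t, w2 t, w1 0, w2 0])
  · exact c h1 h2
  · have h1 : ∀ t, HasDerivAt (fun t => (γ t).1) ((k.sys ε).left (γ t)).1 t := h1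
    have h2 : ∀ t, HasDerivAt (fun t => (γ t).2) ((k.sys ε).left (γ t)).2 t := h2
    simp only [sys_left] at h1 h2
    have := eq_zero_of_periodic_focus (x := fun t => (γ t).1 + 3)
      (y := fun t => (γ t).1 + 2 * (γ t).2 + 1) hm hT
      (fun t => ((h1 t).add_const 3))
      (fun t => ((((h1 t).fun_add ((h2 t).const_mul 2)).add_const 1)).congr_deriv (by ring))
      (fun t => by simp only [per t]) (fun t => by simp only [per t])
    have a := this t
    have b := this 0
    exact Prod.ext (by linarith [a.1, b.1]) (by linarith [a.1, b.1, a.2, b.2])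

theorem eventually_isSmall (k : Strengths) {h : ℝ} (h0 : 0 < h) (h1 : h < 1) :
    ∀ᶠ ε in 𝓝 0, k.IsSmall ε (h / 2) ((1 + h) / 2) := by
  have hl : 0 < h / 2 := by linarith
  have o0 : k.ordinate 0 = 0 := by simp [ordinate]
  have d0 : k.dist 0 = 1 := by simp [dist]
  have co := k.contDiffAt_ordinate.continuousAt
  have cd := k.contDiffAt_dist.continuousAt
  have lin : ∀ a b : ℝ, 0 < b → ∀ᶠ ε in 𝓝 (0 : ℝ), |ε * a| < b := fun a b hb =>
    ContinuousAt.eventually_lt (by fun_prop) continuousAt_const (by simpa)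
  have e1 : ∀ᶠ ε in 𝓝 (0 : ℝ), 0 < k.dist ε :=
    ContinuousAt.eventually_lt continuousAt_const cd (by simp [d0])
  have e2 : ∀ᶠ ε in 𝓝 (0 : ℝ), |ε * k.q| * k.dist ε + |k.ordinate ε| < h / 2 :=
    ContinuousAt.eventually_lt (by fun_prop) continuousAt_const (by simpa [o0])
  have e3 : ∀ᶠ ε in 𝓝 (0 : ℝ), (1 + h) / 2 + |k.ordinate ε| < k.dist ε :=
    ContinuousAt.eventually_lt (by fun_prop) cd (by simp [o0, d0]; linarith)
  filter_upwards [lin k.p _ hl, lin k.m _ hl, lin k.q 1 one_pos, lin (k.r - k.q) _ hl, e1, e2, e3]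
    with ε a b c d e f g
  exact ⟨hl, by linarith, a, b, c, d, e, f, g⟩

theorem level_eq_zero (k : Strengths) (i : Fin 4) (y : ℝ) : k.levelOut 0 i y = k.levelIn 0 i y := by
  fin_cases i <;> simp [levelOut, levelIn, ordinate]

theorem sys_zero (k : Strengths) : k.sys 0 = ccsSystem.field := by
  simp [sys, ThreeZoneHam.perturbedField, ThreeZoneHam.field]

/-- The periodic orbit of the unperturbed system through the points `(±1, ±h)`. -/
noncomputable def annulusOrbit (k : Strengths) (h : ℝ) : Set (ℝ × ℝ) :=
  ThreeZoneField.cycle (k.arc 0) (k.time 0) fun _ => h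

theorem mem_Ioo_half {h : ℝ} (h0 : 0 < h) (h1 : h < 1) : h ∈ Ioo (h / 2) ((1 + h) / 2) :=
  ⟨by linarith, by linarith⟩

theorem isPeriodicOrbit_annulusOrbit (k : Strengths) {h : ℝ} (h0 : 0 < h) (h1 : h < 1) :
    ccsSystem.field.IsPeriodicOrbit (k.annulusOrbit h) ∧
      ∀ i, ThreeZoneField.gate i h ∈ k.annulusOrbit h := by
  obtain ⟨τ₀, M⟩ := (k.eventually_isSmall h0 h1).self_of_nhds.isAnnulus
  rw [← k.sys_zero]
  exact ⟨M.isPeriodicOrbit_cycle (fun _ => mem_Ioo_half h0 h1) fun i => k.level_eq_zero i h,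
    M.gate_mem_cycle (y := fun _ => h) (fun _ => mem_Ioo_half h0 h1) fun i => k.level_eq_zero i h⟩

theorem continuousAt_arc (k : Strengths) (i : Fin 4) (h t : ℝ) :
    ContinuousAt (fun v : ℝ × ℝ × ℝ => k.arc v.1 i v.2.1 v.2.2) (0, h, t) := by
  have d0 : k.dist 0 ≠ 0 := by simp [dist]
  have o : ContinuousAt (fun v : ℝ × ℝ × ℝ => k.ordinate v.1) (0, h, t) :=
    ContinuousAt.comp (g := k.ordinate) k.contDiffAt_ordinate.continuousAt continuousAt_fst
  have d : ContinuousAt (fun v : ℝ × ℝ × ℝ => k.dist v.1) (0, h, t) :=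
    ContinuousAt.comp (g := k.dist) k.contDiffAt_dist.continuousAt continuousAt_fst
  fin_cases i <;> simp only [arc, focusArc, saddleArc]
  · fun_prop
  · have := ContinuousAt.div (f := fun v : ℝ × ℝ × ℝ => v.2.1 - k.ordinate v.1)
      (by fun_prop) d d0
    fun_prop
  · fun_prop
  · fun_prop

theorem continuousAt_artanh {y : ℝ} (hy : y ∈ Ioo (-1) 1) : ContinuousAt Real.artanh y := by
  have h1 : 1 - y ≠ 0 := by linarith [hy.2]
  have h2 : 0 < (1 + y) / (1 - y) := div_pos (by linarith [hy.1]) (by linarith [hy.2])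
  unfold Real.artanh
  exact ContinuousAt.log (ContinuousAt.sqrt (by fun_prop (disch := assumption)))
    (Real.sqrt_pos.2 h2).ne'

theorem continuousAt_time (k : Strengths) (i : Fin 4) {h : ℝ} (h0 : 0 < h) (h1 : h < 1) :
    ContinuousAt (fun v : ℝ × ℝ × ℝ => k.time v.1 i v.2.1 v.2.2) (0, h, h) := by
  have d0 : k.dist 0 = 1 := by simp [dist]
  have o0 : k.ordinate 0 = 0 := by simp [ordinate]
  have o : ContinuousAt (fun v : ℝ × ℝ × ℝ => k.ordinate v.1) (0, h, h) :=
    ContinuousAt.comp (g := k.ordinate) k.contDiffAt_ordinate.continuousAt continuousAt_fst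
  have d : ContinuousAt (fun v : ℝ × ℝ × ℝ => k.dist v.1) (0, h, h) :=
    ContinuousAt.comp (g := k.dist) k.contDiffAt_dist.continuousAt continuousAt_fst
  have ha : ContinuousAt Real.artanh h := continuousAt_artanh ⟨by linarith, h1⟩
  have arct := Real.continuous_arctan
  fin_cases i <;> simp only [time]
  · fun_prop
  · have e1 := ContinuousAt.div (f := fun v : ℝ × ℝ × ℝ => v.2.1 - k.ordinate v.1)
      (by fun_prop) d (by simp [d0])
    have e2 := ContinuousAt.div (f := fun v : ℝ × ℝ × ℝ => v.2.2 + k.ordinate v.1)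
      (by fun_prop) d (by simp [d0])
    exact (ContinuousAt.comp (g := Real.artanh) (by simpa [d0, o0] using ha) e1).add
      (ContinuousAt.comp (g := Real.artanh) (by simpa [d0, o0] using ha) e2)
  · fun_prop
  · fun_prop

theorem time_zero_pos (k : Strengths) (i : Fin 4) {h : ℝ} (h0 : 0 < h) (h1 : h < 1) :
    0 < k.time 0 i h h := by
  have a := Real.arctan_lt_pi_div_two h
  have b := Real.artanh_pos ⟨h0, h1⟩
  have c := Real.pi_pos
  fin_cases i <;> simp [time, ordinate, dist] <;> linarith

/-- The closed curves through the gates at the heights `y ε i` depend continuously on `ε` at `0`. -/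
theorem tendsto_hausdorffEDist_cycle (k : Strengths) {h : ℝ} (h0 : 0 < h) (h1 : h < 1)
    {y : ℝ → Fin 4 → ℝ} (hy : Tendsto y (𝓝 0) (𝓝 fun _ => h)) :
    Tendsto (fun ε => Metric.hausdorffEDist
      (ThreeZoneField.cycle (k.arc ε) (k.time ε) (y ε)) (k.annulusOrbit h)) (𝓝 0) (𝓝 0) := by
  -- the limit includes the point `ε = 0` itself
  have hy0 : y 0 = fun _ => h := tendsto_nhds_unique (tendsto_pure_nhds y 0 |>.mono_right le_rfl)
    (hy.mono_left (pure_le_nhds 0))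
  have cy : ContinuousAt y 0 := by rwa [ContinuousAt, hy0]
  have ci : ∀ i, ContinuousAt (fun ε => y ε i) 0 := fun i =>
    (continuous_apply i).continuousAt.comp cy
  have ct : ∀ i, ContinuousAt (fun ε => k.time ε i (y ε i) (y ε (i + 1))) 0 := fun i =>
    ContinuousAt.comp (g := fun v : ℝ × ℝ × ℝ => k.time v.1 i v.2.1 v.2.2)
      (f := fun ε => (ε, y ε i, y ε (i + 1))) (by
        simp only [hy0]
        exact k.continuousAt_time i h0 h1) (continuousAt_id.prodMk ((ci i).prodMk (ci (i + 1))))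
  have tpos : ∀ᶠ ε in 𝓝 0, ∀ i, 0 < k.time ε i (y ε i) (y ε (i + 1)) :=
    eventually_all.2 fun i => ContinuousAt.eventually_lt continuousAt_const (ct i) (by
      simp only [hy0]
      exact k.time_zero_pos i h0 h1)
  let g : Fin 4 → ℝ → ℝ → ℝ × ℝ := fun i ε s =>
    k.arc ε i (y ε i) (s * k.time ε i (y ε i) (y ε (i + 1)))
  have cg : ∀ i s, ContinuousAt (fun v : ℝ × ℝ => g i v.1 v.2) (0, s) := by
    intro i s
    have f1 : ContinuousAt (fun v : ℝ × ℝ => y v.1 i) (0, s) :=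
      ContinuousAt.comp (g := fun ε => y ε i) (f := Prod.fst) (ci i) continuousAt_fst
    have f2 : ContinuousAt (fun v : ℝ × ℝ => v.2 * k.time v.1 i (y v.1 i) (y v.1 (i + 1)))
        (0, s) := continuousAt_snd.mul
      (ContinuousAt.comp (g := fun ε => k.time ε i (y ε i) (y ε (i + 1))) (f := Prod.fst) (ct i)
        continuousAt_fst)
    refine ContinuousAt.comp (g := fun v : ℝ × ℝ × ℝ => k.arc v.1 i v.2.1 v.2.2)
      (f := fun v : ℝ × ℝ => (v.1, y v.1 i, v.2 * k.time v.1 i (y v.1 i) (y v.1 (i + 1)))) ?_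
      (continuousAt_fst.prodMk (f1.prodMk f2))
    simp only [hy0]
    exact k.continuousAt_arc i h _
  have cg0 : ∀ i s, ContinuousAt (fun v : ℝ × ℝ => g i 0 v.2) (0, s) := fun i s =>
    ContinuousAt.comp (g := fun v : ℝ × ℝ => g i v.1 v.2) (f := fun v : ℝ × ℝ => (0, v.2)) (cg i s)
      (continuousAt_const.prodMk continuousAt_snd)
  have img : ∀ ε, (∀ i, 0 < k.time ε i (y ε i) (y ε (i + 1))) →
      ThreeZoneField.cycle (k.arc ε) (k.time ε) (y ε) = ⋃ i, g i ε '' Icc 0 1 := by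
    intro ε hε
    refine iUnion_congr fun i => ?_
    have : Icc 0 (k.time ε i (y ε i) (y ε (i + 1))) =
        (fun s => s * k.time ε i (y ε i) (y ε (i + 1))) '' Icc 0 1 := by
      rw [image_mul_right_Icc zero_le_one (hε i).le, zero_mul, one_mul]
    rw [this, image_image]
  have img0 : k.annulusOrbit h = ⋃ i, g i 0 '' Icc 0 1 := by
    rw [← img 0 tpos.self_of_nhds, hy0]
    rfl
  rw [ENNReal.tendsto_nhds_zero]
  intro η hη
  have close : ∀ᶠ ε in 𝓝 (0 : ℝ), ∀ i, ∀ s ∈ Icc (0 : ℝ) 1, edist (g i ε s) (g i 0 s) < η :=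
    eventually_all.2 fun i => isCompact_Icc.eventually_forall_of_forall_eventually fun s _ =>
      ContinuousAt.eventually_lt ((cg i s).edist (cg0 i s)) continuousAt_const (by simpa)
  filter_upwards [close, tpos] with ε hε ht
  rw [img ε ht, img0]
  refine Metric.hausdorffEDist_le_of_mem_edist ?_ ?_
  · rintro x hx
    obtain ⟨i, s, hs, rfl⟩ := mem_iUnion.1 hx
    exact ⟨g i 0 s, mem_iUnion.2 ⟨i, s, hs, rfl⟩, (hε i s hs).le⟩
  · rintro x hx
    obtain ⟨i, s, hs, rfl⟩ := mem_iUnion.1 hx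
    exact ⟨g i ε s, mem_iUnion.2 ⟨i, s, hs, rfl⟩, by rw [edist_comm]; exact (hε i s hs).le⟩

end Strengths

/-! ### The Melnikov function -/

namespace ThreeZoneField.IsAnnulus

variable {X : ThreeZoneField} {l u τ₀ : ℝ} {F G : Fin 4 → ℝ → ℝ} {c : Fin 4 → ℝ → ℝ → ℝ × ℝ}
  {τ : Fin 4 → ℝ → ℝ → ℝ} {y : Fin 4 → ℝ}

theorem eq_of_gate_mem_cycle (M : X.IsAnnulus l u τ₀ F G c τ) (hy : ∀ i, y i ∈ Ioo l u)
    (h : ∀ i, F i (y i) = G i (y (i + 1))) {i : Fin 4} {z : ℝ} (hz : 0 < z)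
    (hm : gate i z ∈ cycle c τ y) : z = y i := by
  obtain ⟨j, t, ht, e⟩ := mem_iUnion.1 hm
  obtain ⟨-, h2, h3⟩ := M.arc j _ (hy j) _ (hy (j + 1)) (h j)
  rcases ht.1.eq_or_lt with rfl | h0
  · rw [M.c_zero] at e
    obtain ⟨rfl, rfl⟩ := gate_injective (M.pos_of_mem (hy j)) hz e
    rfl
  · rcases ht.2.eq_or_lt with rfl | h1
    · rw [h2] at e
      obtain ⟨rfl, rfl⟩ := gate_injective (M.pos_of_mem (hy (j + 1))) hz e
      rfl
    · exact absurd (h3 t ⟨h0, h1⟩) (e ▸ gate_notMem_arcZone _ _ _)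

end ThreeZoneField.IsAnnulus

namespace Strengths

/-- The first order Melnikov function of the perturbation. -/
noncomputable def melnikov (k : Strengths) (h : ℝ) : ℝ :=
  k.r * h + (2 * k.p * (Real.pi / 2 - Real.arctan h) + k.m * (Real.pi - Real.arctan h)) *
    (1 + h ^ 2) - k.q * halfLog h * (1 - h ^ 2)

theorem sum_shift (k : Strengths) {h : ℝ} (hh : h ≠ 0) :
    ∑ i, k.shift i h = 2 / h * k.melnikov h := by
  rw [Fin.sum_univ_four]
  simp only [shift, melnikov]
  field_simp
  ring

theorem hasDerivAt_melnikov (k : Strengths) {h : ℝ} (h0 : 0 < h) (h1 : h < 1) :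
    HasDerivAt k.melnikov (k.r - (2 * k.p + k.m) - k.q +
      2 * h * (2 * k.p * (Real.pi / 2 - Real.arctan h) + k.m * (Real.pi - Real.arctan h) +
        k.q * halfLog h)) h := by
  have e1 : 1 + h ≠ 0 := by linarith
  have e2 : 1 - h ≠ 0 := by linarith
  have e3 : 1 + h ^ 2 ≠ 0 := by positivity
  have a := Real.hasDerivAt_arctan h
  have s := (hasDerivAt_id' h).fun_pow 2
  refine ((((hasDerivAt_id' h).const_mul k.r).fun_add
    ((((a.const_sub (Real.pi / 2)).const_mul (2 * k.p)).fun_add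
      ((a.const_sub Real.pi).const_mul k.m)).fun_mul (s.const_add 1))).fun_sub
    (((hasDerivAt_halfLog e1 e2).const_mul k.q).fun_mul (s.const_sub 1))).congr_deriv ?_
  field_simp
  norm_num
  ring

theorem differentiableAt_shift (k : Strengths) (i : Fin 4) {h : ℝ} (h0 : 0 < h) (h1 : h < 1) :
    DifferentiableAt ℝ (k.shift i) h := by
  have a : DifferentiableAt ℝ Real.arctan h := Real.differentiableAt_arctan h
  have b : DifferentiableAt ℝ halfLog h :=
    (hasDerivAt_halfLog (by linarith) (by linarith)).differentiableAt
  have hne := h0.ne'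
  fin_cases i
  · change DifferentiableAt ℝ (fun y => 2 * k.p * (Real.pi / 2 - Real.arctan y) * (1 + y ^ 2) / y) h
    fun_prop (disch := assumption)
  · change DifferentiableAt ℝ (fun y => 2 * k.r - 2 * k.q * halfLog y * (1 - y ^ 2) / y) h
    fun_prop (disch := assumption)
  · change DifferentiableAt ℝ (fun y => 2 * k.p * (Real.pi / 2 - Real.arctan y) * (1 + y ^ 2) / y) h
    fun_prop (disch := assumption)
  · change DifferentiableAt ℝ (fun y => 2 * k.m * (Real.pi - Real.arctan y) * (1 + y ^ 2) / y) h
    fun_prop (disch := assumption)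

/-- At a simple zero of the Melnikov function a branch of limit cycles leaves the annulus. The last
conjunct, that the cycle meets the gate `0` at one height only, serves to tell branches apart. -/
theorem exists_limitCycle_branch (k : Strengths) {h M' : ℝ} (h0 : 0 < h) (h1 : h < 1)
    (hp : k.p ≠ 0) (hm : k.m ≠ 0) (hz : k.melnikov h = 0) (hd : HasDerivAt k.melnikov M' h)
    (hM' : M' ≠ 0) : ∃ y : ℝ → Fin 4 → ℝ, Tendsto y (𝓝 0) (𝓝 fun _ => h) ∧
      ∀ᶠ ε in 𝓝[>] 0,
        (k.sys ε).IsLimitCycle (ThreeZoneField.cycle (k.arc ε) (k.time ε) (y ε)) ∧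
        ThreeZoneField.gate 0 (y ε 0) ∈ ThreeZoneField.cycle (k.arc ε) (k.time ε) (y ε) ∧
        ∀ z > 0, ThreeZoneField.gate 0 z ∈ ThreeZoneField.cycle (k.arc ε) (k.time ε) (y ε) →
          z = y ε 0 := by
  have hsum : ∑ i, deriv (k.shift i) h ≠ 0 := by
    have e1 : HasDerivAt (fun x => ∑ i, k.shift i x) (∑ i, deriv (k.shift i) h) h :=
      HasDerivAt.fun_sum fun i _ => (k.differentiableAt_shift i h0 h1).hasDerivAt
    have e2 : HasDerivAt (fun x => 2 / x * k.melnikov x) (2 / h * M') h := by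
      refine (((hasDerivAt_id' h).fun_inv h0.ne').const_mul 2 |>.fun_mul hd).congr_deriv ?_
      rw [hz, mul_zero, zero_add, div_eq_mul_inv]
    have e3 : (fun x => ∑ i, k.shift i x) =ᶠ[𝓝 h] fun x => 2 / x * k.melnikov x := by
      filter_upwards [lt_mem_nhds h0] with x hx using k.sum_shift (ne_of_gt hx)
    rw [e1.unique (e2.congr_of_eventuallyEq e3)]
    exact mul_ne_zero (div_ne_zero two_ne_zero h0.ne') hM'
  obtain ⟨y, hy, hev⟩ := exists_chain_solution (Φ := k.disp) (D := k.shift)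
    (D' := fun i => deriv (k.shift i) h) (fun i => k.contDiffAt_disp i h0 h1 _)
    (fun i => (lt_mem_nhds h0).mono fun y hy d => k.disp_zero i (ne_of_gt hy) d)
    (fun i => (k.differentiableAt_shift i h0 h1).hasDerivAt)
    (by rw [k.sum_shift h0.ne', hz, mul_zero]) hsum
  refine ⟨y, hy, ?_⟩
  have hI : ∀ᶠ ε in 𝓝 0, ∀ i, y ε i ∈ Ioo (h / 2) ((1 + h) / 2) := by
    refine eventually_all.2 fun i => ((tendsto_pi_nhds.1 hy) i).eventually ?_
    have := mem_Ioo_half h0 h1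
    exact Ioo_mem_nhds this.1 this.2
  filter_upwards [hev, nhdsWithin_le_nhds hI, nhdsWithin_le_nhds (k.eventually_isSmall h0 h1),
    self_mem_nhdsWithin] with ε ⟨hsol, δ, hδ, huniq⟩ hyI hsmall hε
  have hε : 0 < ε := hε
  obtain ⟨τ₀, A⟩ := hsmall.isAnnulus
  have lev : ∀ i, k.levelOut ε i (y ε i) = k.levelIn ε i (y ε (i + 1)) := fun i =>
    (hsmall.level_iff hε.ne' (hyI i) (hyI (i + 1)) i).2 (hsol i)
  refine ⟨A.isLimitCycle_cycle hyI lev ?_ fun i => periodic_eq_const (mul_ne_zero hε.ne' hp)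
    (mul_ne_zero hε.ne' hm) hsmall.q_lt_one i, A.gate_mem_cycle hyI lev 0,
    fun z hz hmem => A.eq_of_gate_mem_cycle hyI lev hz hmem⟩
  have near : ∀ᶠ ρ in 𝓝[>] (0 : ℝ), ∀ i, ∀ z, |z - y ε i| < ρ →
      z ∈ Ioo (h / 2) ((1 + h) / 2) := by
    refine eventually_all.2 fun i => ?_
    obtain ⟨r, hr, H⟩ := Metric.mem_nhds_iff.1 (Ioo_mem_nhds (hyI i).1 (hyI i).2)
    filter_upwards [nhdsWithin_le_nhds (gt_mem_nhds hr)] with ρ hρ z hz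
    exact H (by rw [Metric.mem_ball, Real.dist_eq]; exact hz.trans hρ)
  have small : ∀ᶠ ρ in 𝓝[>] (0 : ℝ), ρ < δ := nhdsWithin_le_nhds (gt_mem_nhds hδ)
  obtain ⟨ρ, hρ, hρδ, hnear⟩ := ((eventually_mem_nhdsWithin (a := (0 : ℝ)) (s := Ioi 0)).and
    (small.and near)).exists
  refine ⟨ρ, hρ, fun z hz hlev => huniq z (fun i => (hz i).trans hρδ) fun i => ?_⟩
  exact (hsmall.level_iff hε.ne' (hnear i _ (hz i)) (hnear (i + 1) _ (hz (i + 1))) i).1 (hlev i)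

end Strengths

/-- A comparison principle on `[0, b]`. -/
theorem le_of_deriv_le {f g f' g' : ℝ → ℝ} {b x : ℝ} (h0 : f 0 = g 0)
    (hf : ∀ t ∈ Icc 0 b, HasDerivAt f (f' t) t) (hg : ∀ t ∈ Icc 0 b, HasDerivAt g (g' t) t)
    (h : ∀ t ∈ Icc 0 b, f' t ≤ g' t) (hx : x ∈ Icc 0 b) : f x ≤ g x := by
  have hd : ∀ t ∈ Icc 0 b, HasDerivAt (fun t => g t - f t) (g' t - f' t) t := fun t ht =>
    (hg t ht).fun_sub (hf t ht)
  have mono : MonotoneOn (fun t => g t - f t) (Icc 0 b) := by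
    refine monotoneOn_of_deriv_nonneg (convex_Icc _ _)
      (fun t ht => (hd t ht).continuousAt.continuousWithinAt)
      (fun t ht => (hd t (interior_subset ht)).differentiableAt.differentiableWithinAt)
      fun t ht => ?_
    rw [(hd t (interior_subset ht)).deriv]
    linarith [h t (interior_subset ht)]
  have := mono ⟨le_rfl, hx.1.trans hx.2⟩ hx hx.1
  simp only [h0, sub_self] at this
  linarith

/-- `artanh h + arctan h`. -/
noncomputable def logAtanAdd (h : ℝ) : ℝ := halfLog h + Real.arctan h

/-- `artanh h - arctan h`. -/
noncomputable def logAtanSub (h : ℝ) : ℝ := halfLog h - Real.arctan h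

theorem hasDerivAt_logAtanAdd {h : ℝ} (h0 : 0 ≤ h) (h1 : h < 1) :
    HasDerivAt logAtanAdd (2 / (1 - h ^ 4)) h := by
  have e1 : 1 + h ≠ 0 := by linarith
  have e2 : 1 - h ≠ 0 := by linarith
  have e3 : 1 + h ^ 2 ≠ 0 := by positivity
  refine ((hasDerivAt_halfLog e1 e2).fun_add (Real.hasDerivAt_arctan h)).congr_deriv ?_
  rw [show 1 - h ^ 4 = (1 + h) * (1 - h) * (1 + h ^ 2) by ring]
  field_simp
  ring

theorem hasDerivAt_logAtanSub {h : ℝ} (h0 : 0 ≤ h) (h1 : h < 1) :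
    HasDerivAt logAtanSub (2 * h ^ 2 / (1 - h ^ 4)) h := by
  have e1 : 1 + h ≠ 0 := by linarith
  have e2 : 1 - h ≠ 0 := by linarith
  have e3 : 1 + h ^ 2 ≠ 0 := by positivity
  refine ((hasDerivAt_halfLog e1 e2).fun_sub (Real.hasDerivAt_arctan h)).congr_deriv ?_
  rw [show 1 - h ^ 4 = (1 + h) * (1 - h) * (1 + h ^ 2) by ring]
  field_simp
  ring

/-- Partial sums of the geometric series; the constant `6 / 5` suffices while `t⁴ ≤ 1 / 6`. -/
theorem geom_bounds {t : ℝ} (ht : t ∈ Icc (0 : ℝ) (63 / 100)) :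
    1 + t ^ 4 + t ^ 8 ≤ 1 / (1 - t ^ 4) ∧ 1 / (1 - t ^ 4) ≤ 1 + t ^ 4 + 6 / 5 * t ^ 8 := by
  have h4 : t ^ 4 ≤ (63 / 100) ^ 4 := pow_le_pow_left₀ ht.1 ht.2 4
  have h4' : t ^ 4 ≤ 1 / 6 := h4.trans (by norm_num)
  have h0 : 0 ≤ t ^ 4 := pow_nonneg ht.1 4
  have h8 : t ^ 8 = t ^ 4 * t ^ 4 := by ring
  have hpos : 0 < 1 - t ^ 4 := by linarith
  rw [le_div_iff₀ hpos, div_le_iff₀ hpos, h8]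
  set s := t ^ 4
  constructor
  · nlinarith [mul_nonneg (mul_nonneg h0 h0) h0]
  · nlinarith [mul_nonneg (mul_nonneg h0 h0) (sub_nonneg.2 h4')]

theorem logAtanAdd_bounds {h : ℝ} (hh : h ∈ Icc (0 : ℝ) (63 / 100)) :
    2 * h + 2 / 5 * h ^ 5 + 2 / 9 * h ^ 9 ≤ logAtanAdd h ∧
      logAtanAdd h ≤ 2 * h + 2 / 5 * h ^ 5 + 6 / 5 * (2 / 9 * h ^ 9) := by
  have hp : ∀ c t : ℝ, HasDerivAt (fun t : ℝ => 2 * t + 2 / 5 * t ^ 5 + c * (2 / 9 * t ^ 9))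
      (2 * (1 + t ^ 4 + c * t ^ 8)) t := fun c t =>
    (((hasDerivAt_id' t).const_mul 2).fun_add (((hasDerivAt_id' t).fun_pow 5).const_mul (2 / 5))
      |>.fun_add ((((hasDerivAt_id' t).fun_pow 9).const_mul (2 / 9)).const_mul c)).congr_deriv
      (by norm_num; ring)
  have hd : ∀ t ∈ Icc (0 : ℝ) (63 / 100), HasDerivAt logAtanAdd (2 / (1 - t ^ 4)) t := fun t ht =>
    hasDerivAt_logAtanAdd ht.1 (by linarith [ht.2])
  have z : logAtanAdd 0 = 0 := by simp [logAtanAdd, halfLog]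
  constructor
  · have := le_of_deriv_le (by simp [z]) (fun t _ => hp 1 t) hd (fun t ht => by
      have := (geom_bounds ht).1
      rw [show 2 / (1 - t ^ 4) = 2 * (1 / (1 - t ^ 4)) by ring]
      linarith) hh
    linarith
  · exact le_of_deriv_le (by simp [z]) hd (fun t _ => hp (6 / 5) t) (fun t ht => by
      have := (geom_bounds ht).2
      rw [show 2 / (1 - t ^ 4) = 2 * (1 / (1 - t ^ 4)) by ring]
      linarith) hh

theorem logAtanSub_bounds {h : ℝ} (hh : h ∈ Icc (0 : ℝ) (63 / 100)) :
    2 / 3 * h ^ 3 + 2 / 7 * h ^ 7 + 2 / 11 * h ^ 11 ≤ logAtanSub h ∧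
      logAtanSub h ≤ 2 / 3 * h ^ 3 + 2 / 7 * h ^ 7 + 6 / 5 * (2 / 11 * h ^ 11) := by
  have hp : ∀ c t : ℝ, HasDerivAt
      (fun t : ℝ => 2 / 3 * t ^ 3 + 2 / 7 * t ^ 7 + c * (2 / 11 * t ^ 11))
      (2 * t ^ 2 * (1 + t ^ 4 + c * t ^ 8)) t := fun c t =>
    ((((hasDerivAt_id' t).fun_pow 3).const_mul (2 / 3)).fun_add
      (((hasDerivAt_id' t).fun_pow 7).const_mul (2 / 7))
      |>.fun_add ((((hasDerivAt_id' t).fun_pow 11).const_mul (2 / 11)).const_mul c)).congr_deriv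
      (by norm_num; ring)
  have hd : ∀ t ∈ Icc (0 : ℝ) (63 / 100), HasDerivAt logAtanSub (2 * t ^ 2 / (1 - t ^ 4)) t :=
    fun t ht => hasDerivAt_logAtanSub ht.1 (by linarith [ht.2])
  have z : logAtanSub 0 = 0 := by simp [logAtanSub, halfLog]
  constructor
  · have := le_of_deriv_le (by simp [z]) (fun t _ => hp 1 t) hd (fun t ht => by
      rw [← mul_one_div (2 * t ^ 2), one_mul]
      exact mul_le_mul_of_nonneg_left (geom_bounds ht).1 (by positivity)) hh
    linarith
  · exact le_of_deriv_le (by simp [z]) hd (fun t _ => hp (6 / 5) t) (fun t ht => by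
      rw [← mul_one_div (2 * t ^ 2)]
      exact mul_le_mul_of_nonneg_left (geom_bounds ht).2 (by positivity)) hh

/-- Strengths for which the Melnikov function changes sign three times on `(0, 1)`. They are chosen
such that `melnikov h = 1 / 100 - (17 / 200) h + h² / 100 + (11 / 20) h³ - h⁵ + O(h⁷)`: the dominant
terms, of the degrees `0`, `1`, `3` and `5`, have alternating signs. -/
noncomputable def strengths : Strengths where
  p := -(333 / 80) - 1 / 100 / Real.pi
  m := 333 / 80 + 1 / 50 / Real.pi
  q := -(267 / 80)
  r := -(1517 / 200)

theorem melnikov_strengths (h : ℝ) : strengths.melnikov h =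
    (1 + h ^ 2) / 100 - 1517 / 200 * h + (15 / 4 + 33 / 80 * h ^ 2) * logAtanAdd h -
      (33 / 80 + 15 / 4 * h ^ 2) * logAtanSub h := by
  have := Real.pi_ne_zero
  simp only [Strengths.melnikov, strengths, logAtanAdd, logAtanSub]
  field_simp
  ring

theorem hasDerivAt_melnikov_strengths {h : ℝ} (h0 : 0 < h) (h1 : h < 1) :
    HasDerivAt strengths.melnikov
      (h / 50 - 17 / 200 + h * (33 / 40 * logAtanAdd h - 15 / 2 * logAtanSub h)) h := by
  refine (strengths.hasDerivAt_melnikov h0 h1).congr_deriv ?_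
  have := Real.pi_ne_zero
  simp only [strengths, logAtanAdd, logAtanSub]
  field_simp
  ring

/-! ### Simple zeros of the Melnikov function -/

theorem logAtanAdd_mem {l u h : ℝ} (l0 : 0 ≤ l) (u1 : u ≤ 63 / 100) (hh : h ∈ Icc l u) :
    2 * l + 2 / 5 * l ^ 5 + 2 / 9 * l ^ 9 ≤ logAtanAdd h ∧
      logAtanAdd h ≤ 2 * u + 2 / 5 * u ^ 5 + 6 / 5 * (2 / 9 * u ^ 9) := by
  obtain ⟨hl, hu⟩ := hh
  have h0 := l0.trans hl
  have := logAtanAdd_bounds ⟨h0, hu.trans u1⟩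
  constructor
  · refine le_trans ?_ this.1
    gcongr
  · refine this.2.trans ?_
    gcongr

theorem logAtanSub_mem {l u h : ℝ} (l0 : 0 ≤ l) (u1 : u ≤ 63 / 100) (hh : h ∈ Icc l u) :
    2 / 3 * l ^ 3 + 2 / 7 * l ^ 7 + 2 / 11 * l ^ 11 ≤ logAtanSub h ∧
      logAtanSub h ≤ 2 / 3 * u ^ 3 + 2 / 7 * u ^ 7 + 6 / 5 * (2 / 11 * u ^ 11) := by
  obtain ⟨hl, hu⟩ := hh
  have h0 := l0.trans hl
  have := logAtanSub_bounds ⟨h0, hu.trans u1⟩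
  constructor
  · refine le_trans ?_ this.1
    gcongr
  · refine this.2.trans ?_
    gcongr

/-- A sign change of the Melnikov function yields a zero, which is simple if the derivative does not
vanish in between. The derivative is tested with all values `a` and `b` that the bounds admit for
`logAtanAdd h` and `logAtanSub h`. -/
theorem exists_simple_zero {l u : ℝ} (l0 : 0 < l) (lu : l < u) (u1 : u ≤ 63 / 100)
    (hs : strengths.melnikov l * strengths.melnikov u < 0)
    (hd : ∀ h ∈ Icc l u, ∀ a b : ℝ,
      2 * l + 2 / 5 * l ^ 5 + 2 / 9 * l ^ 9 ≤ a →
      a ≤ 2 * u + 2 / 5 * u ^ 5 + 6 / 5 * (2 / 9 * u ^ 9) →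
      2 / 3 * l ^ 3 + 2 / 7 * l ^ 7 + 2 / 11 * l ^ 11 ≤ b →
      b ≤ 2 / 3 * u ^ 3 + 2 / 7 * u ^ 7 + 6 / 5 * (2 / 11 * u ^ 11) →
      h / 50 - 17 / 200 + h * (33 / 40 * a - 15 / 2 * b) ≠ 0) :
    ∃ h ∈ Icc l u, strengths.melnikov h = 0 ∧
      ∃ M', HasDerivAt strengths.melnikov M' h ∧ M' ≠ 0 := by
  have D : ∀ h ∈ Icc l u, HasDerivAt strengths.melnikov _ h := fun h hh =>
    hasDerivAt_melnikov_strengths (l0.trans_le hh.1) (by linarith [hh.2])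
  have cont : ContinuousOn strengths.melnikov (uIcc l u) := by
    rw [uIcc_of_le lu.le]
    exact fun h hh => (D h hh).continuousAt.continuousWithinAt
  have mem : (0 : ℝ) ∈ uIcc (strengths.melnikov l) (strengths.melnikov u) := by
    rcases mul_neg_iff.1 hs with h | h
    · exact mem_uIcc_of_ge h.2.le h.1.le
    · exact mem_uIcc_of_le h.1.le h.2.le
  obtain ⟨h, hh, hz⟩ := intermediate_value_uIcc cont mem
  rw [uIcc_of_le lu.le] at hh
  have A := logAtanAdd_mem l0.le u1 hh
  have B := logAtanSub_mem l0.le u1 hh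
  exact ⟨h, hh, hz, _, D h hh, hd h hh _ _ A.1 A.2 B.1 B.2⟩

theorem melnikov_strengths_bounds {h : ℝ} (hh : h ∈ Icc (0 : ℝ) (63 / 100)) :
    (1 + h ^ 2) / 100 - 1517 / 200 * h +
        (15 / 4 + 33 / 80 * h ^ 2) * (2 * h + 2 / 5 * h ^ 5 + 2 / 9 * h ^ 9) -
        (33 / 80 + 15 / 4 * h ^ 2) * (2 / 3 * h ^ 3 + 2 / 7 * h ^ 7 + 6 / 5 * (2 / 11 * h ^ 11)) ≤
      strengths.melnikov h ∧
    strengths.melnikov h ≤ (1 + h ^ 2) / 100 - 1517 / 200 * h +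
        (15 / 4 + 33 / 80 * h ^ 2) * (2 * h + 2 / 5 * h ^ 5 + 6 / 5 * (2 / 9 * h ^ 9)) -
        (33 / 80 + 15 / 4 * h ^ 2) * (2 / 3 * h ^ 3 + 2 / 7 * h ^ 7 + 2 / 11 * h ^ 11) := by
  rw [melnikov_strengths]
  have A := logAtanAdd_bounds hh
  have B := logAtanSub_bounds hh
  constructor
  · gcongr
    exacts [A.1, B.2]
  · gcongr
    exacts [A.2, B.1]

/-- The Melnikov function of `strengths` has a simple zero in each of the intervals
`[0.11, 0.15]`, `[0.34, 0.37]` and `[0.60, 0.63]`. -/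
theorem exists_three_simple_zeros : ∃ h : Fin 3 → ℝ, Function.Injective h ∧
    ∀ i, h i ∈ Ioo (0 : ℝ) 1 ∧ strengths.melnikov (h i) = 0 ∧
      ∃ M', HasDerivAt strengths.melnikov M' (h i) ∧ M' ≠ 0 := by
  have pos : ∀ h : ℝ, h ∈ Icc (0 : ℝ) (63 / 100) → _ := fun h hh =>
    (melnikov_strengths_bounds hh).1
  have neg : ∀ h : ℝ, h ∈ Icc (0 : ℝ) (63 / 100) → _ := fun h hh =>
    (melnikov_strengths_bounds hh).2
  have z1 : ∃ h ∈ Icc (11 / 100 : ℝ) (15 / 100), strengths.melnikov h = 0 ∧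
      ∃ M', HasDerivAt strengths.melnikov M' h ∧ M' ≠ 0 := by
    refine exists_simple_zero (by norm_num) (by norm_num) (by norm_num)
      (mul_neg_of_pos_of_neg ?_ ?_) fun h hh a b a1 a2 b1 b2 => ne_of_lt ?_
    · exact lt_of_lt_of_le (by norm_num) (pos _ (by norm_num))
    · exact lt_of_le_of_lt (neg _ (by norm_num)) (by norm_num)
    · have : h * (33 / 40 * a - 15 / 2 * b) ≤ 15 / 100 * (33 / 40 * (31 / 100)) := by
        norm_num at a1 a2 b1 b2
        have : 33 / 40 * a - 15 / 2 * b ≤ 33 / 40 * (31 / 100) := by linarith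
        nlinarith [hh.1, hh.2]
      linarith [hh.2]
  have z2 : ∃ h ∈ Icc (34 / 100 : ℝ) (37 / 100), strengths.melnikov h = 0 ∧
      ∃ M', HasDerivAt strengths.melnikov M' h ∧ M' ≠ 0 := by
    refine exists_simple_zero (by norm_num) (by norm_num) (by norm_num)
      (mul_neg_of_neg_of_pos ?_ ?_) fun h hh a b a1 a2 b1 b2 => ne_of_gt ?_
    · exact lt_of_le_of_lt (neg _ (by norm_num)) (by norm_num)
    · exact lt_of_lt_of_le (by norm_num) (pos _ (by norm_num))
    · norm_num at a1 a2 b1 b2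
      obtain ⟨x, y⟩ := hh
      nlinarith
  have z3 : ∃ h ∈ Icc (60 / 100 : ℝ) (63 / 100), strengths.melnikov h = 0 ∧
      ∃ M', HasDerivAt strengths.melnikov M' h ∧ M' ≠ 0 := by
    refine exists_simple_zero (by norm_num) (by norm_num) (by norm_num)
      (mul_neg_of_pos_of_neg ?_ ?_) fun h hh a b a1 a2 b1 b2 => ne_of_lt ?_
    · exact lt_of_lt_of_le (by norm_num) (pos _ (by norm_num))
    · exact lt_of_le_of_lt (neg _ (by norm_num)) (by norm_num)
    · norm_num at a1 a2 b1 b2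
      obtain ⟨x, y⟩ := hh
      nlinarith
  obtain ⟨h1, m1, hz1⟩ := z1
  obtain ⟨h2, m2, hz2⟩ := z2
  obtain ⟨h3, m3, hz3⟩ := z3
  refine ⟨![h1, h2, h3], ?_, ?_⟩
  · refine (Fin.strictMono_iff_lt_succ.2 ?_).injective
    intro i
    fin_cases i
    · change h1 < h2; linarith [m1.2, m2.1]
    · change h2 < h3; linarith [m2.2, m3.1]
  · intro i
    fin_cases i
    · exact ⟨Icc_subset_Ioo (by norm_num) (by norm_num) m1, hz1⟩
    · exact ⟨Icc_subset_Ioo (by norm_num) (by norm_num) m2, hz2⟩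
    · exact ⟨Icc_subset_Ioo (by norm_num) (by norm_num) m3, hz3⟩

theorem strengths_p_ne_zero : strengths.p ≠ 0 := by
  have : 0 < 1 / 100 / Real.pi := by positivity
  refine ne_of_lt ?_
  simp only [strengths]
  linarith

theorem strengths_m_ne_zero : strengths.m ≠ 0 := by
  have : 0 < 1 / 50 / Real.pi := by positivity
  refine ne_of_gt ?_
  simp only [strengths]
  linarith

/-! ### The equilibria of the subsystems -/

theorem left_isCenter : ccsSystem.left.IsCenter (-3, 1) := by
  refine ⟨?_, 1, one_pos, ?_⟩
  · rw [HamCoeff.field_eq]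
    norm_num [ccsSystem, normalForm]
  · rw [Matrix.charpoly_fin_two]
    norm_num [ccsSystem, normalForm, HamCoeff.linearPart, Matrix.trace_fin_two, Matrix.det_fin_two]

theorem center_isCenter : ccsSystem.center.IsCenter (0, 0) := by
  refine ⟨?_, 1, one_pos, ?_⟩
  · rw [HamCoeff.field_eq]
    norm_num [ccsSystem, normalForm]
  · rw [Matrix.charpoly_fin_two]
    norm_num [ccsSystem, normalForm, HamCoeff.linearPart, Matrix.trace_fin_two, Matrix.det_fin_two]

theorem right_isSaddle : ccsSystem.right.IsSaddle (2, 0) := by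
  refine ⟨?_, -1, 1, by norm_num, one_pos, ?_⟩
  · rw [HamCoeff.field_eq]
    norm_num [ccsSystem, normalForm]
  · rw [Matrix.charpoly_fin_two]
    simp [ccsSystem, normalForm, HamCoeff.linearPart, Matrix.trace_fin_two, Matrix.det_fin_two]
    ring

/-! ### Bifurcation of three limit cycles -/

theorem mainTheorem9 :
    -- a real left center, a real central center and a real right saddle
    (∃ p : ℝ × ℝ, p.1 < -1 ∧ ccsSystem.left.IsCenter p) ∧
    (∃ p : ℝ × ℝ, -1 < p.1 ∧ p.1 < 1 ∧ ccsSystem.center.IsCenter p) ∧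
    (∃ p : ℝ × ℝ, 1 < p.1 ∧ ccsSystem.right.IsSaddle p) ∧
    -- the periodic annulus, formed by the periodic orbits `L h` with `0 < h < 1`
    ∃ L : ℝ → Set (ℝ × ℝ),
      (∀ h ∈ Set.Ioo (0 : ℝ) 1, ccsSystem.field.IsPeriodicOrbit (L h) ∧
        (1, h) ∈ L h ∧ (1, -h) ∈ L h ∧ (-1, -h) ∈ L h ∧ (-1, h) ∈ L h) ∧
      -- for a suitable perturbation, three limit cycles bifurcate from the annulus
      ∃ (w : ThreeZonePert) (h : Fin 3 → ℝ),
        Function.Injective h ∧ (∀ i, h i ∈ Set.Ioo (0 : ℝ) 1) ∧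
        ∃ (ε₀ : ℝ) (Γ : Fin 3 → ℝ → Set (ℝ × ℝ)), 0 < ε₀ ∧
          (∀ ε ∈ Set.Ioo (0 : ℝ) ε₀,
            Function.Injective (fun i => Γ i ε) ∧
            ∀ i, (ccsSystem.perturbedField w ε).IsLimitCycle (Γ i ε)) ∧
          ∀ i, Filter.Tendsto (fun ε => Metric.hausdorffEDist (Γ i ε) (L (h i)))
            (nhdsWithin 0 (Set.Ioi 0)) (nhds 0) := by
  refine ⟨⟨_, by norm_num, left_isCenter⟩, ⟨_, by norm_num, by norm_num, center_isCenter⟩,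
    ⟨_, by norm_num, right_isSaddle⟩, strengths.annulusOrbit, fun h hh => ?_, ?_⟩
  · have H := strengths.isPeriodicOrbit_annulusOrbit hh.1 hh.2
    exact ⟨H.1, H.2 1, H.2 2, H.2 3, H.2 0⟩
  obtain ⟨h, hinj, H⟩ := exists_three_simple_zeros
  choose hI hz M' hM hM' using H
  choose y hy hev using fun i => strengths.exists_limitCycle_branch (hI i).1 (hI i).2
    strengths_p_ne_zero strengths_m_ne_zero (hz i) (hM i) (hM' i)
  have lim : ∀ i, Tendsto (fun ε => y i ε 0) (𝓝[>] 0) (𝓝 (h i)) := fun i =>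
    ((tendsto_pi_nhds.1 (hy i)) 0).mono_left nhdsWithin_le_nhds
  have distinct : ∀ᶠ ε in 𝓝[>] (0 : ℝ), ∀ i j, i ≠ j → y i ε 0 ≠ y j ε 0 := by
    refine eventually_all.2 fun i => eventually_all.2 fun j => ?_
    by_cases hij : i = j
    · exact Eventually.of_forall fun _ hn => absurd hij hn
    · filter_upwards [((lim i).sub (lim j)).eventually_ne
        (sub_ne_zero.2 (hinj.ne hij))] with ε hε _ using sub_ne_zero.1 hε
  have pos : ∀ᶠ ε in 𝓝[>] (0 : ℝ), ∀ i, 0 < y i ε 0 :=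
    eventually_all.2 fun i => (lim i).eventually (lt_mem_nhds (hI i).1)
  have good := (eventually_all.2 hev).and (distinct.and pos)
  obtain ⟨ε₀, hε₀, good⟩ := (nhdsGT_basis (0 : ℝ)).eventually_iff.1 good
  refine ⟨strengths.pert, h, hinj, hI, ε₀,
    fun i ε => ThreeZoneField.cycle (strengths.arc ε) (strengths.time ε) (y i ε), hε₀,
    fun ε hε => ?_, fun i => ?_⟩
  · obtain ⟨g, d, p⟩ := good hε
    refine ⟨fun i j hij => ?_, fun i => (g i).1⟩
    by_contra hne
    refine d i j hne ((g j).2.2 _ (p i) ?_)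
    exact hij.subset (g i).2.1
  · exact (strengths.tendsto_hausdorffEDist_cycle (hI i).1 (hI i).2 (hy i)).mono_left
      nhdsWithin_le_nhds
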